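/- Let $\Bbbk$ be an algebraically closed field of characteristic $0$ and let $D=\Bbbk[x]/(x^2)$. Let $\mathscr{D}$ be the $2$-category with one object $\mathtt{i}$, whose $1$-morphisms are the endofunctors of the category of finite-dimensional $D$-modules that are isomorphic to $B\otimes_D-$ for a finite-dimensional $D$-$D$-bimodule $B$ ($\Bbbk$ acting centrally), and whose $2$-morphisms are all natural transformations. For $k\ge 0$, let $M_k$ be the $D$-$D$-bimodule with basis $m_1,\dots,m_{2k+3}$ such that $x\,m_{2i}=m_{2i+1}$ and $m_{2i}\,x=m_{2i-1}$ for $1\le i\le k+1$, and $x$ annihilates every $m_j$ with $j$ odd from both sides. Put $N_k=M_k/\langle m_{2k+3}\rangle$, $S_k=M_k/\langle m_1\rangle$ and $W_k=M_k/\langle m_1,m_{2k+3}\rangle$. Let $\mathcal{J}_k$ be the class of $1$-morphisms isomorphic to tensoring with one of $W_k,S_k,N_k,M_k$. For indecomposable $1$-morphisms write $F\le_J G$ if $G$ is isomorphic to a direct summand of $H_1\circ F\circ H_2$ for some $1$-morphisms $H_1,H_2$; the classes of the induced equivalence relation are the two-sided cells. A finitary $2$-representation $\mathbf{M}$ of $\mathscr{D}$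 is a $2$-functor (strict, or more generally respecting composition up to coherent isomorphism) that is $\Bbbk$-linear on $2$-morphisms and acts by additive $\Bbbk$-linear endofunctors on a category $\mathbf{M}(\mathtt{i})$ that is $\Bbbk$-linear, additive and idempotent split, has finite-dimensional morphism spaces, and has finitely many isomorphism classes of indecomposable objects; their number is the rank of $\mathbf{M}$. It is transitive if for all indecomposable $X,Y\in\mathbf{M}(\mathtt{i})$ there is a $1$-morphism $U$ such that $Y$ is isomorphic to a direct summand of $\mathbf{M}(U)X$, and simple if $\mathbf{M}(\mathtt{i})$ has no proper nonzero ideal of morphisms stable under all $\mathbf{M}(F)$. The apex of a transitive $\mathbf{M}$ is the two-sided cell that is maximal with respect to $\le_J$ among those not annihilated by $\mathbf{M}$. If $X_1,\dots,X_r$ is a complete list of representatives of the isomorphism classes of indecomposable objects of $\mathbf{M}(\mathtt{i})$, the action matrix $[F]$ of a $1$-morphism $F$ is the $r\times r$ matrix whose $(i,j)$ entry is the multiplicity of $X_i$ as a direct summand of $\mathbf{M}(F)X_j$. **Proposition.** Let $\mathbf{M}$ be a simple transitive finitary $2$-representation of $\mathscr{D}$ with apex $\mathcal{J}_k$, where $k\ge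 1$. Then, for a suitable numbering of the isomorphism classes of indecomposable objects of $\mathbf{M}(\mathtt{i})$, the action matrices of the $1$-morphisms in $\mathcal{J}_k$ are either all equal to $[1]$ (and $\mathbf{M}$ has rank $1$), or $\mathbf{M}$ has rank $2$ and $$[N_k]=[W_k]=\begin{bmatrix}1&1\\0&0\end{bmatrix},\qquad [M_k]=[S_k]=\begin{bmatrix}0&0\\1&1\end{bmatrix}.$$ In particular, the rank of $\mathbf{M}$ is $1$ or $2$. -/

import Mathlib

open CategoryTheory CategoryTheory.Limits MonoidalCategory
open scoped DualNumber TensorProduct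

universe u v w

noncomputable section

/-! ### Bimodules over the dual numbers `D = k[ε]/(ε²)` -/

/-- A finite-dimensional `D`-`D`-bimodule on which `k` acts centrally, where `D = k[ε]` is the
ring of dual numbers. As `D` is commutative, the right action is recorded as a `D`-module
structure; the left action is a ring homomorphism from `D` to the endomorphisms commuting with
the right action. -/
structure DualBimodule (k : Type u) [Field k] where
  carrier : Type u
  [addCommGroup : AddCommGroup carrier]
  /-- the right action, `d • b` standing for `b · d` -/
  [rightModule : Module k[ε] carrier]
  [finite : Module.Finite k[ε] carrier]
  /-- the left action, `leftAction d b` standing for `d · b` -/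
  leftAction : k[ε] →+* Module.End k[ε] carrier
  leftAction_algebraMap : ∀ (c : k) (b : carrier),
    leftAction (algebraMap k k[ε] c) b = algebraMap k k[ε] c • b

attribute [instance] DualBimodule.addCommGroup DualBimodule.rightModule DualBimodule.finite

/-- Finite generation over `D` only depends on the `k`-linear structure. -/
theorem DualNumber.finite_transfer {k : Type u} [Field k] {T T' : Type*} [AddCommGroup T]
    [Module k[ε] T] [AddCommGroup T'] [Module k[ε] T'] [Module.Finite k[ε] T] (e : T ≃+ T')
    (h : ∀ (c : k) (t : T), e (algebraMap k k[ε] c • t) = algebraMap k k[ε] c • e t) :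
    Module.Finite k[ε] T' := by
  let : Module k T := Module.compHom T (algebraMap k k[ε])
  have : IsScalarTower k k[ε] T := ⟨fun c d t => by
    rw [Algebra.smul_def, mul_smul]; rfl⟩
  let : Module k T' := Module.compHom T' (algebraMap k k[ε])
  have : IsScalarTower k k[ε] T' := ⟨fun c d t => by
    rw [Algebra.smul_def, mul_smul]; rfl⟩
  have : Module.Finite k k[ε] := inferInstanceAs (Module.Finite k (k × k))
  have hT : Module.Finite k T := Module.Finite.trans k[ε] T
  have : Module.Finite k T' :=
    Module.Finite.equiv ({ e with map_smul' := h } : T ≃ₗ[k] T')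
  exact Module.Finite.of_restrictScalars_finite k k[ε] T'

namespace DualBimodule

variable {k : Type u} [Field k] (B : DualBimodule k)

/-- The underlying group of `B ⊗_D X`: the elements `(b · d) ⊗ x` and `b ⊗ (d · x)` are
identified. -/
def TensorObj (X : Type u) [AddCommGroup X] [Module k[ε] X] : Type u :=
  B.carrier ⊗[k[ε]] X

section
variable (X : Type u) [AddCommGroup X] [Module k[ε] X]

instance : AddCommGroup (B.TensorObj X) :=
  inferInstanceAs (AddCommGroup (B.carrier ⊗[k[ε]] X))

/-- The pure tensor `b ⊗ x` in `B ⊗_D X`. -/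
def tmul {X : Type u} [AddCommGroup X] [Module k[ε] X] (b : B.carrier) (x : X) :
    B.TensorObj X := b ⊗ₜ[k[ε]] x

/-- The left action of `D` on `B ⊗_D X`, given by `d · (b ⊗ x) = (d · b) ⊗ x`. -/
instance : Module k[ε] (B.TensorObj X) :=
  Module.compHom (B.carrier ⊗[k[ε]] X)
    (((Module.End.rTensorAlgHom k[ε] B.carrier X : Module.End k[ε] B.carrier →ₐ[k[ε]] _) :
      Module.End k[ε] B.carrier →+* Module.End k[ε] (B.carrier ⊗[k[ε]] X)).comp B.leftAction)

variable {X}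

theorem smul_tmul (d : k[ε]) (b : B.carrier) (x : X) :
    d • B.tmul b x = B.tmul (B.leftAction d b) x := rfl

theorem tmul_balanced (d : k[ε]) (b : B.carrier) (x : X) :
    B.tmul (d • b) x = B.tmul b (d • x) := TensorProduct.smul_tmul d b x

theorem smul_eq_rTensor (d : k[ε]) (t : B.carrier ⊗[k[ε]] X) :
    (d • (show B.TensorObj X from t)) = (B.leftAction d).rTensor X t := rfl

@[elab_as_elim]
theorem tensor_induction {p : B.TensorObj X → Prop} (t : B.TensorObj X) (h0 : p 0)
    (h1 : ∀ b x, p (B.tmul b x)) (h2 : ∀ s t, p s → p t → p (s + t)) : p t :=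
  TensorProduct.induction_on t h0 h1 h2

/-- Additive maps out of `B ⊗_D X`. -/
def liftAdd {P : Type*} [AddCommMonoid P] (f : B.carrier →+ X →+ P)
    (hf : ∀ (d : k[ε]) (b : B.carrier) (x : X), f (d • b) x = f b (d • x)) :
    B.TensorObj X →+ P :=
  TensorProduct.liftAddHom f hf

@[simp] theorem liftAdd_tmul {P : Type*} [AddCommMonoid P] (f : B.carrier →+ X →+ P)
    (hf : ∀ (d : k[ε]) (b : B.carrier) (x : X), f (d • b) x = f b (d • x))
    (b : B.carrier) (x : X) : B.liftAdd f hf (B.tmul b x) = f b x := rfl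

theorem tmul_add (b : B.carrier) (x y : X) : B.tmul b (x + y) = B.tmul b x + B.tmul b y :=
  TensorProduct.tmul_add b x y

theorem add_tmul (b c : B.carrier) (x : X) : B.tmul (b + c) x = B.tmul b x + B.tmul c x :=
  TensorProduct.add_tmul b c x

theorem tmul_zero (b : B.carrier) : B.tmul b (0 : X) = 0 := TensorProduct.tmul_zero X b

theorem zero_tmul (x : X) : B.tmul 0 x = 0 := TensorProduct.zero_tmul B.carrier x

instance [Module.Finite k[ε] X] : Module.Finite k[ε] (B.TensorObj X) := by
  let e : (B.carrier ⊗[k[ε]] X) ≃+ B.TensorObj X := AddEquiv.refl _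
  refine DualNumber.finite_transfer e fun c t => ?_
  induction t using TensorProduct.induction_on with
  | zero => rw [smul_zero, map_zero, smul_zero]
  | tmul b x => exact congrArg (fun b => B.tmul b x) (B.leftAction_algebraMap c b).symm
  | add s t hs ht => rw [smul_add, map_add, map_add, smul_add, hs, ht]

/-- The map `B ⊗_D f`. -/
def tensorMap {Y : Type u} [AddCommGroup Y] [Module k[ε] Y] (f : X →ₗ[k[ε]] Y) :
    B.TensorObj X →ₗ[k[ε]] B.TensorObj Y where
  toFun := f.lTensor B.carrier
  map_add' := map_add (f.lTensor B.carrier)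
  map_smul' d t := by
    have h := (LinearMap.lTensor_comp_rTensor (f := B.leftAction d) (g := f)).trans
      (LinearMap.rTensor_comp_lTensor (f := B.leftAction d) (g := f)).symm
    exact LinearMap.congr_fun h t

@[simp] theorem tensorMap_tmul {Y : Type u} [AddCommGroup Y] [Module k[ε] Y]
    (f : X →ₗ[k[ε]] Y) (b : B.carrier) (x : X) :
    B.tensorMap f (B.tmul b x) = B.tmul b (f x) := rfl

theorem hom_ext {P : Type*} [AddCommMonoid P] {f g : B.TensorObj X →+ P}
    (h : ∀ b x, f (B.tmul b x) = g (B.tmul b x)) : f = g := by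
  ext t
  induction t using B.tensor_induction with
  | h0 => simp
  | h1 b x => exact h b x
  | h2 s t hs ht => simp [hs, ht]

end

/-- The functor `B ⊗_D -` on the category of finite-dimensional `D`-modules. -/
def tensorFunctor : FGModuleCat.{u} k[ε] ⥤ FGModuleCat.{u} k[ε] where
  obj X := FGModuleCat.of k[ε] (B.TensorObj X)
  map f := FGModuleCat.ofHom (B.tensorMap f.hom.hom)
  map_id X := by
    apply FGModuleCat.hom_ext
    apply LinearMap.toAddMonoidHom_injective
    exact B.hom_ext fun b x => rfl
  map_comp f g := by
    apply FGModuleCat.hom_ext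
    apply LinearMap.toAddMonoidHom_injective
    exact B.hom_ext fun b x => rfl

/-! #### The regular bimodule and tensor products of bimodules -/

/-- The regular bimodule `D`. -/
def regular (k : Type u) [Field k] : DualBimodule k where
  carrier := k[ε]
  leftAction := Module.toModuleEnd k[ε] (S := k[ε]) k[ε]
  leftAction_algebraMap _ _ := rfl

/-- The isomorphism `D ⊗_D X ≃ X`. -/
def regularEquiv (X : Type u) [AddCommGroup X] [Module k[ε] X] :
    (regular k).TensorObj X ≃ₗ[k[ε]] X where
  toFun := TensorProduct.lid k[ε] X
  map_add' := map_add (TensorProduct.lid k[ε] X)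
  map_smul' d t := by
    let g : (regular k).TensorObj X →+ X := (TensorProduct.lid k[ε] X).toLinearMap.toAddMonoidHom
    have h : g.comp (DistribSMul.toAddMonoidHom _ d) = (DistribSMul.toAddMonoidHom _ d).comp g :=
      (regular k).hom_ext fun b x => mul_smul d (show k[ε] from b) x
    exact DFunLike.congr_fun h t
  invFun := (TensorProduct.lid k[ε] X).symm
  left_inv := (TensorProduct.lid k[ε] X).left_inv
  right_inv := (TensorProduct.lid k[ε] X).right_inv

/-- `B` regarded as a left `D`-module. -/
def LeftCarrier : Type u := B.carrier

instance : AddCommGroup B.LeftCarrier := inferInstanceAs (AddCommGroup B.carrier)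

instance : Module k[ε] B.LeftCarrier where
  smul d b := B.leftAction d b
  one_smul b := by
    change B.leftAction 1 b = b
    rw [map_one]; rfl
  mul_smul d e b := by
    change B.leftAction (d * e) b = B.leftAction d (B.leftAction e b)
    rw [map_mul]; rfl
  smul_zero d := map_zero (B.leftAction d)
  smul_add d := map_add (B.leftAction d)
  add_smul d e b := by
    change B.leftAction (d + e) b = B.leftAction d b + B.leftAction e b
    rw [map_add]; rfl
  zero_smul b := by
    change B.leftAction 0 b = 0
    rw [map_zero]; rfl

theorem smul_leftCarrier (d : k[ε]) (b : B.carrier) :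
    (d • (show B.LeftCarrier from b)) = (show B.LeftCarrier from B.leftAction d b) := rfl

/-- Right multiplication by `d`, as an endomorphism of the left module `B`. -/
def rightMul : k[ε] →+* Module.End k[ε] B.LeftCarrier where
  toFun d :=
    { toFun := fun b => (show B.LeftCarrier from d • (show B.carrier from b))
      map_add' := fun b c => smul_add d (show B.carrier from b) (show B.carrier from c)
      map_smul' := fun e b => ((B.leftAction e).map_smul d (show B.carrier from b)).symm }
  map_one' := by ext b; exact one_smul _ (show B.carrier from b)
  map_mul' d e := by ext b; exact mul_smul d e (show B.carrier from b)
  map_zero' := by ext b; exact zero_smul _ (show B.carrier from b)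
  map_add' d e := by ext b; exact add_smul d e (show B.carrier from b)

variable (B' : DualBimodule k)

/-- The underlying group of `B ⊗_D B'`, to be equipped with the right action coming from `B'`. -/
def CompCarrier : Type u := B.carrier ⊗[k[ε]] B'.LeftCarrier

instance : AddCommGroup (B.CompCarrier B') :=
  inferInstanceAs (AddCommGroup (B.carrier ⊗[k[ε]] B'.LeftCarrier))

/-- The right action of `D` on `B ⊗_D B'`, given by `(b ⊗ b') · d = b ⊗ (b' · d)`. -/
instance : Module k[ε] (B.CompCarrier B') :=
  Module.compHom (B.carrier ⊗[k[ε]] B'.LeftCarrier)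
    (((Module.End.lTensorAlgHom k[ε] B'.LeftCarrier B.carrier :
        Module.End k[ε] B'.LeftCarrier →ₐ[k[ε]] _) :
      Module.End k[ε] B'.LeftCarrier →+*
        Module.End k[ε] (B.carrier ⊗[k[ε]] B'.LeftCarrier)).comp B'.rightMul)

variable {B'} in
/-- The pure tensor `b ⊗ b'` in `B ⊗_D B'`. -/
def ctmul (b : B.carrier) (b' : B'.carrier) : B.CompCarrier B' :=
  b ⊗ₜ[k[ε]] (show B'.LeftCarrier from b')

theorem ctmul_add (b : B.carrier) (x y : B'.carrier) :
    B.ctmul b (x + y) = B.ctmul b x + B.ctmul b y :=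
  TensorProduct.tmul_add b (show B'.LeftCarrier from x) (show B'.LeftCarrier from y)

theorem add_ctmul (b c : B.carrier) (x : B'.carrier) :
    B.ctmul (b + c) x = B.ctmul b x + B.ctmul c x :=
  TensorProduct.add_tmul b c (show B'.LeftCarrier from x)

theorem ctmul_zero (b : B.carrier) : B.ctmul b (0 : B'.carrier) = 0 :=
  TensorProduct.tmul_zero B'.LeftCarrier b

theorem zero_ctmul (x : B'.carrier) : B.ctmul 0 x = 0 :=
  TensorProduct.zero_tmul B.carrier (show B'.LeftCarrier from x)

theorem ctmul_balanced (d : k[ε]) (b : B.carrier) (x : B'.carrier) :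
    B.ctmul (d • b) x = B.ctmul b (B'.leftAction d x) :=
  TensorProduct.smul_tmul d b (show B'.LeftCarrier from x)

theorem smul_ctmul (d : k[ε]) (b : B.carrier) (x : B'.carrier) :
    d • B.ctmul b x = B.ctmul b (d • x) := rfl

@[elab_as_elim]
theorem comp_induction {p : B.CompCarrier B' → Prop} (t : B.CompCarrier B') (h0 : p 0)
    (h1 : ∀ b x, p (B.ctmul b x)) (h2 : ∀ s t, p s → p t → p (s + t)) : p t :=
  TensorProduct.induction_on t h0 h1 h2

theorem comp_hom_ext {P : Type*} [AddCommMonoid P] {f g : B.CompCarrier B' →+ P}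
    (h : ∀ b x, f (B.ctmul b x) = g (B.ctmul b x)) : f = g := by
  ext t
  induction t using B.comp_induction B' with
  | h0 => simp
  | h1 b x => exact h b x
  | h2 s t hs ht => simp [hs, ht]

instance : Module.Finite k[ε] B.LeftCarrier :=
  DualNumber.finite_transfer (T := B.carrier) (AddEquiv.refl _)
    fun c b => (B.leftAction_algebraMap c b).symm

instance : Module.Finite k[ε] (B.CompCarrier B') := by
  let e : (B.carrier ⊗[k[ε]] B'.LeftCarrier) ≃+ B.CompCarrier B' := AddEquiv.refl _
  refine DualNumber.finite_transfer e fun c t => ?_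
  induction t using TensorProduct.induction_on with
  | zero => rw [smul_zero, map_zero, smul_zero]
  | tmul b x =>
    exact (B.ctmul_balanced B' _ b x).trans
      (congrArg (fun y => B.ctmul b y) (B'.leftAction_algebraMap c x))
  | add s t hs ht => rw [smul_add, map_add, map_add, smul_add, hs, ht]

/-- The tensor product `B ⊗_D B'` of bimodules. -/
def comp : DualBimodule k where
  carrier := B.CompCarrier B'
  leftAction :=
    { toFun := fun d =>
        { toFun := (B.leftAction d).rTensor B'.LeftCarrier
          map_add' := map_add ((B.leftAction d).rTensor B'.LeftCarrier)
          map_smul' := fun e t => by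
            have h := (LinearMap.rTensor_comp_lTensor (f := B.leftAction d)
              (g := B'.rightMul e)).trans
              (LinearMap.lTensor_comp_rTensor (f := B.leftAction d) (g := B'.rightMul e)).symm
            exact LinearMap.congr_fun h t }
      map_one' := by
        apply LinearMap.toAddMonoidHom_injective
        refine B.comp_hom_ext B' fun b x => ?_
        change B.ctmul (B.leftAction 1 b) x = B.ctmul b x
        rw [map_one]; rfl
      map_mul' := fun d e => by
        apply LinearMap.toAddMonoidHom_injective
        refine B.comp_hom_ext B' fun b x => ?_
        change B.ctmul (B.leftAction (d * e) b) x =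
          B.ctmul (B.leftAction d (B.leftAction e b)) x
        rw [map_mul]; rfl
      map_zero' := by
        apply LinearMap.toAddMonoidHom_injective
        refine B.comp_hom_ext B' fun b x => ?_
        change B.ctmul (B.leftAction 0 b) x = 0
        rw [map_zero]; exact B.zero_ctmul B' x
      map_add' := fun d e => by
        apply LinearMap.toAddMonoidHom_injective
        refine B.comp_hom_ext B' fun b x => ?_
        change B.ctmul (B.leftAction (d + e) b) x =
          B.ctmul (B.leftAction d b) x + B.ctmul (B.leftAction e b) x
        rw [map_add, ← B.add_ctmul]; rfl }
  leftAction_algebraMap c t := by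
    induction t using B.comp_induction B' with
    | h0 => rw [map_zero, smul_zero]
    | h1 b x =>
      change B.ctmul (B.leftAction _ b) x = B.ctmul b (algebraMap k k[ε] c • (show B'.carrier from x))
      rw [B.leftAction_algebraMap, B.ctmul_balanced, B'.leftAction_algebraMap]
    | h2 s t hs ht => rw [map_add, smul_add, hs, ht]

section Assoc

variable (X : Type u) [AddCommGroup X] [Module k[ε] X]

/-- Additive maps out of `B ⊗_D B'`. -/
def compLift {P : Type*} [AddCommMonoid P] (f : B.carrier →+ B'.carrier →+ P)
    (hf : ∀ (d : k[ε]) (b : B.carrier) (x : B'.carrier),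
      f (d • b) x = f b (B'.leftAction d x)) :
    B.CompCarrier B' →+ P :=
  TensorProduct.liftAddHom (N := B'.LeftCarrier) f hf

@[simp] theorem compLift_ctmul {P : Type*} [AddCommMonoid P]
    (f : B.carrier →+ B'.carrier →+ P)
    (hf : ∀ (d : k[ε]) (b : B.carrier) (x : B'.carrier),
      f (d • b) x = f b (B'.leftAction d x)) (b : B.carrier) (x : B'.carrier) :
    B.compLift B' f hf (B.ctmul b x) = f b x := rfl

/-- Auxiliary map `b ⊗ b' ↦ (x ↦ b ⊗ (b' ⊗ x))`. -/
def assocAux : B.CompCarrier B' →+ X →+ B.TensorObj (B'.TensorObj X) :=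
  B.compLift B'
    { toFun := fun b =>
        { toFun := fun b' =>
            { toFun := fun x => B.tmul b (B'.tmul b' x)
              map_zero' := by rw [B'.tmul_zero, B.tmul_zero]
              map_add' := fun x y => by rw [B'.tmul_add, B.tmul_add] }
          map_zero' := by
            ext x
            exact (congrArg _ (B'.zero_tmul x)).trans (B.tmul_zero b)
          map_add' := fun c d => by
            ext x
            exact (congrArg _ (B'.add_tmul c d x)).trans (B.tmul_add b _ _) }
      map_zero' := by ext b' x; exact B.zero_tmul _
      map_add' := fun b c => by ext b' x; exact B.add_tmul _ _ _ }
    (fun d b b' => by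
      ext x
      exact B.tmul_balanced d b (B'.tmul b' x))

theorem assocAux_balanced (d : k[ε]) (t : B.CompCarrier B') (x : X) :
    B.assocAux B' X (d • t) x = B.assocAux B' X t (d • x) := by
  induction t using B.comp_induction B' with
  | h0 => rw [smul_zero, map_zero]; rfl
  | h1 b b' => exact congrArg (B.tmul b) (B'.tmul_balanced d b' x)
  | h2 s t hs ht =>
    rw [smul_add, map_add, map_add, AddMonoidHom.add_apply, AddMonoidHom.add_apply, hs, ht]

/-- The map `(b ⊗ b') ⊗ x ↦ b ⊗ (b' ⊗ x)`. -/
def assocHom : (B.comp B').TensorObj X →+ B.TensorObj (B'.TensorObj X) :=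
  (B.comp B').liftAdd (B.assocAux B' X) (B.assocAux_balanced B' X)

theorem assocHom_tmul (b : B.carrier) (b' : B'.carrier) (x : X) :
    B.assocHom B' X ((B.comp B').tmul (B.ctmul b b') x) = B.tmul b (B'.tmul b' x) := rfl

/-- The map `b ⊗ (b' ⊗ x) ↦ (b ⊗ b') ⊗ x`. -/
def assocInv : B.TensorObj (B'.TensorObj X) →+ (B.comp B').TensorObj X :=
  B.liftAdd
    { toFun := fun b =>
        B'.liftAdd
          { toFun := fun b' =>
              { toFun := fun x => (B.comp B').tmul (B.ctmul b b') x
                map_zero' := (B.comp B').tmul_zero _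
                map_add' := fun x y => (B.comp B').tmul_add _ x y }
            map_zero' := by
              ext x
              exact (congrArg (fun t => (B.comp B').tmul t x) (B.ctmul_zero B' b)).trans
                ((B.comp B').zero_tmul x)
            map_add' := fun c d => by
              ext x
              exact (congrArg (fun t => (B.comp B').tmul t x) (B.ctmul_add B' b c d)).trans
                ((B.comp B').add_tmul _ _ x) }
          (fun d b' x => (B.comp B').tmul_balanced d (B.ctmul b b') x)
      map_zero' := B'.hom_ext fun b' x =>
        (congrArg (fun t => (B.comp B').tmul t x) (B.zero_ctmul B' b')).trans
          ((B.comp B').zero_tmul x)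
      map_add' := fun b c => B'.hom_ext fun b' x =>
        (congrArg (fun t => (B.comp B').tmul t x) (B.add_ctmul B' b c b')).trans
          ((B.comp B').add_tmul _ _ x) }
    (fun d b t => by
      induction t using B'.tensor_induction with
      | h0 => rw [smul_zero, map_zero, map_zero]
      | h1 b' x =>
        exact congrArg (fun t => (B.comp B').tmul t x) (B.ctmul_balanced B' d b b')
      | h2 s t hs ht => rw [smul_add, map_add, map_add, hs, ht])

theorem comp_tensor_hom_ext {P : Type*} [AddCommMonoid P]
    {f g : (B.comp B').TensorObj X →+ P}
    (h : ∀ b b' x, f ((B.comp B').tmul (B.ctmul b b') x) =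
      g ((B.comp B').tmul (B.ctmul b b') x)) : f = g := by
  refine (B.comp B').hom_ext fun t x => ?_
  induction t using B.comp_induction B' with
  | h0 => exact (congrArg f ((B.comp B').zero_tmul x)).trans ((map_zero f).trans
      ((map_zero g).symm.trans (congrArg g ((B.comp B').zero_tmul x)).symm))
  | h1 b b' => exact h b b' x
  | h2 s t hs ht =>
    exact (congrArg f ((B.comp B').add_tmul s t x)).trans ((map_add f _ _).trans
      ((congrArg₂ (· + ·) hs ht).trans ((map_add g _ _).symm.trans
        (congrArg g ((B.comp B').add_tmul s t x)).symm)))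

/-- The associativity isomorphism `(B ⊗_D B') ⊗_D X ≃ B ⊗_D (B' ⊗_D X)`. -/
def assocEquiv : (B.comp B').TensorObj X ≃ₗ[k[ε]] B.TensorObj (B'.TensorObj X) where
  toFun := B.assocHom B' X
  map_add' := map_add _
  map_smul' d t := by
    let f : (B.comp B').TensorObj X →+ B.TensorObj (B'.TensorObj X) :=
      (B.assocHom B' X).comp (DistribSMul.toAddMonoidHom _ d)
    let g : (B.comp B').TensorObj X →+ B.TensorObj (B'.TensorObj X) :=
      (DistribSMul.toAddMonoidHom _ d).comp (B.assocHom B' X)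
    have h : f = g := B.comp_tensor_hom_ext B' X fun b b' x => rfl
    exact DFunLike.congr_fun h t
  invFun := B.assocInv B' X
  left_inv t := by
    have h : (B.assocInv B' X).comp (B.assocHom B' X) = AddMonoidHom.id _ :=
      B.comp_tensor_hom_ext B' X fun b b' x => rfl
    exact DFunLike.congr_fun h t
  right_inv t := by
    have h : (B.assocHom B' X).comp (B.assocInv B' X) = AddMonoidHom.id _ := by
      refine B.hom_ext fun b t => ?_
      induction t using B'.tensor_induction with
      | h0 => rw [B.tmul_zero, map_zero, map_zero]
      | h1 b' x => rfl
      | h2 s t hs ht => rw [B.tmul_add, map_add, map_add, hs, ht]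
    exact DFunLike.congr_fun h t

end Assoc

/-- Tensoring with `B'` and then with `B` is tensoring with `B ⊗_D B'`. -/
def tensorFunctorComp :
    B'.tensorFunctor ⋙ B.tensorFunctor ≅ (B.comp B').tensorFunctor :=
  (NatIso.ofComponents (fun X => (B.assocEquiv B' X).toFGModuleCatIso) (by
    intro X Y f
    apply FGModuleCat.hom_ext
    apply LinearMap.toAddMonoidHom_injective
    exact B.comp_tensor_hom_ext B' X fun b b' x => rfl)).symm

/-- Tensoring with the regular bimodule is the identity functor. -/
def tensorFunctorRegular :
    𝟭 (FGModuleCat.{u} k[ε]) ≅ (regular k).tensorFunctor :=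
  (NatIso.ofComponents (fun X => (regularEquiv (k := k) X).toFGModuleCatIso) (by
    intro X Y f
    apply FGModuleCat.hom_ext
    apply LinearMap.toAddMonoidHom_injective
    refine (regular k).hom_ext fun b x => ?_
    exact (map_smul f.hom.hom (show k[ε] from b) x).symm)).symm

end DualBimodule

/-! ### The 2-category `𝒟` -/

/-- The endofunctors of `D`-mod isomorphic to tensoring with a finite-dimensional
`D`-`D`-bimodule. -/
def isTensorFunctor (k : Type u) [Field k] :
    ObjectProperty (FGModuleCat.{u} k[ε] ⥤ FGModuleCat.{u} k[ε]) :=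
  fun F => ∃ B : DualBimodule k, Nonempty (F ≅ B.tensorFunctor)

/-- The category of 1-morphisms and 2-morphisms of the one-object 2-category `𝒟`: its objects
are the endofunctors of `D`-mod isomorphic to tensoring with a finite-dimensional
`D`-`D`-bimodule, its morphisms are all natural transformations. -/
abbrev DualCat (k : Type u) [Field k] := (isTensorFunctor k).FullSubcategory

instance isTensorFunctor_isMonoidal (k : Type u) [Field k] :
    @ObjectProperty.IsMonoidal _ _ (endofunctorMonoidalCategory (FGModuleCat.{u} k[ε]))
      (isTensorFunctor k) :=
  letI := endofunctorMonoidalCategory (FGModuleCat.{u} k[ε])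
  { prop_unit := ⟨_, ⟨DualBimodule.tensorFunctorRegular⟩⟩
    prop_tensor := by
      rintro F G ⟨B, ⟨e⟩⟩ ⟨C, ⟨f⟩⟩
      exact ⟨C.comp B, ⟨NatIso.hcomp e f ≪≫ C.tensorFunctorComp B⟩⟩ }

/-- The horizontal composition of `𝒟`, that is, composition of endofunctors. In accordance with
Mathlib's convention for endofunctors, `F ⊗ G` is the functor `F ⋙ G`, written `G ∘ F` on
paper. -/
instance (k : Type u) [Field k] : MonoidalCategory (DualCat k) :=
  @ObjectProperty.fullMonoidalSubcategory _ _
    (endofunctorMonoidalCategory (FGModuleCat.{u} k[ε])) (isTensorFunctor k)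
    (isTensorFunctor_isMonoidal k)

/-! ### String bimodules -/

section StringBimodules

variable {k : Type u} [Field k] {V : Type u} [AddCommGroup V] [Module k V]

/-- The action of `D` on a `k`-vector space in which `ε` acts by the square-zero operator `T`,
that is, `(a + bε) · v = a v + b T v`. -/
def epsAction (T : Module.End k V) (hT : T * T = 0) : k[ε] →+* Module.End k V :=
  (DualNumber.lift ⟨(Algebra.ofId k (Module.End k V), T), hT,
    fun a => (Algebra.commutes a T).symm⟩ : k[ε] →ₐ[k] Module.End k V)

theorem epsAction_apply (T : Module.End k V) (hT : T * T = 0) (d : k[ε]) (v : V) :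
    epsAction T hT d v = d.fst • v + d.snd • T v := rfl

/-- The bimodule with underlying space `V` on which `ε` acts from the left by `L` and from the
right by `R`, for commuting square-zero operators `L` and `R`. -/
def DualBimodule.ofOperators (V : Type u) [AddCommGroup V] [Module k V] [Module.Finite k V]
    (L R : Module.End k V) (hL : L * L = 0) (hR : R * R = 0) (hLR : Commute L R) :
    DualBimodule k :=
  letI : Module k[ε] V := Module.compHom V (epsAction R hR)
  { carrier := V
    finite := by
      have : IsScalarTower k k[ε] V := ⟨fun c d v => by
        change epsAction R hR (c • d) v = c • epsAction R hR d v
        simp [epsAction_apply, mul_smul]⟩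
      exact Module.Finite.of_restrictScalars_finite k k[ε] V
    leftAction :=
      { toFun := fun d =>
          { toFun := epsAction L hL d
            map_add' := map_add _
            map_smul' := fun e v => by
              have h : ∀ w, L (R w) = R (L w) := fun w => LinearMap.congr_fun hLR.eq w
              change epsAction L hL d (epsAction R hR e v) =
                epsAction R hR e (epsAction L hL d v)
              simp only [epsAction_apply, map_add, map_smul, smul_add, h]
              rw [smul_comm d.fst e.fst, smul_comm d.fst e.snd, smul_comm d.snd e.fst,
                smul_comm d.snd e.snd]
              abel }
        map_one' := by ext v; exact LinearMap.congr_fun (map_one (epsAction L hL)) v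
        map_mul' := fun d e => by
          ext v; exact LinearMap.congr_fun (map_mul (epsAction L hL) d e) v
        map_zero' := by ext v; exact LinearMap.congr_fun (map_zero (epsAction L hL)) v
        map_add' := fun d e => by
          ext v; exact LinearMap.congr_fun (map_add (epsAction L hL) d e) v }
    leftAction_algebraMap := fun c v => by
      change epsAction L hL (algebraMap k k[ε] c) v = epsAction R hR (algebraMap k k[ε] c) v
      have h : (algebraMap k k[ε] c).snd = 0 := by
        rw [TrivSqZeroExt.algebraMap_eq_inl]; exact TrivSqZeroExt.snd_inl k c
      simp only [epsAction_apply, h, zero_smul] }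

variable (k)

/-- The space with basis `m_j`, `lo ≤ j ≤ hi`, as the space of coordinate vectors. -/
abbrev StringSpace (lo hi : ℕ) : Type u := {j : ℕ // lo ≤ j ∧ j ≤ hi} → k

instance (lo hi : ℕ) : Finite {j : ℕ // lo ≤ j ∧ j ≤ hi} := (Set.finite_Icc lo hi).to_subtype

/-- The left action of `ε` on a string: `ε m_j = m_{j+1}` for `j` even (and `0` if `m_{j+1}` is
absent), `ε m_j = 0` for `j` odd. -/
def stringLeft (lo hi : ℕ) : Module.End k (StringSpace k lo hi) where
  toFun v j := if h : Odd j.1 ∧ lo < j.1 then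
    v ⟨j.1 - 1, Nat.le_sub_one_of_lt h.2, (Nat.sub_le _ _).trans j.2.2⟩ else 0
  map_add' v w := by ext j; by_cases h : Odd j.1 ∧ lo < j.1 <;> simp [h]
  map_smul' c v := by ext j; by_cases h : Odd j.1 ∧ lo < j.1 <;> simp [h]

/-- The right action of `ε` on a string: `m_j ε = m_{j-1}` for `j` even (and `0` if `m_{j-1}` is
absent), `m_j ε = 0` for `j` odd. -/
def stringRight (lo hi : ℕ) : Module.End k (StringSpace k lo hi) where
  toFun v j := if h : Odd j.1 ∧ j.1 < hi then
    v ⟨j.1 + 1, j.2.1.trans (Nat.le_succ _), h.2⟩ else 0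
  map_add' v w := by ext j; by_cases h : Odd j.1 ∧ j.1 < hi <;> simp [h]
  map_smul' c v := by ext j; by_cases h : Odd j.1 ∧ j.1 < hi <;> simp [h]

theorem stringLeft_apply (lo hi : ℕ) (v : StringSpace k lo hi)
    (j : {j : ℕ // lo ≤ j ∧ j ≤ hi}) :
    stringLeft k lo hi v j = if h : Odd j.1 ∧ lo < j.1 then
      v ⟨j.1 - 1, Nat.le_sub_one_of_lt h.2, (Nat.sub_le _ _).trans j.2.2⟩ else 0 := rfl

theorem stringRight_apply (lo hi : ℕ) (v : StringSpace k lo hi)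
    (j : {j : ℕ // lo ≤ j ∧ j ≤ hi}) :
    stringRight k lo hi v j = if h : Odd j.1 ∧ j.1 < hi then
      v ⟨j.1 + 1, j.2.1.trans (Nat.le_succ _), h.2⟩ else 0 := rfl

theorem stringLeft_eq_zero (lo hi : ℕ) (v : StringSpace k lo hi)
    (hv : ∀ j, ¬ Odd j.1 → v j = 0) : stringLeft k lo hi v = 0 := by
  ext j
  rw [stringLeft_apply]
  split_ifs with h
  · refine hv _ ?_
    obtain ⟨i, hi'⟩ := h.1
    rw [Nat.not_odd_iff_even]
    exact ⟨i, by simp only [hi']; omega⟩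
  · rfl

theorem stringRight_eq_zero (lo hi : ℕ) (v : StringSpace k lo hi)
    (hv : ∀ j, ¬ Odd j.1 → v j = 0) : stringRight k lo hi v = 0 := by
  ext j
  rw [stringRight_apply]
  split_ifs with h
  · refine hv _ ?_
    obtain ⟨i, hi'⟩ := h.1
    rw [Nat.not_odd_iff_even]
    exact ⟨i + 1, by simp only [hi']; omega⟩
  · rfl

theorem stringLeft_even (lo hi : ℕ) (v : StringSpace k lo hi)
    (j : {j : ℕ // lo ≤ j ∧ j ≤ hi}) (hj : ¬ Odd j.1) : stringLeft k lo hi v j = 0 := by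
  rw [stringLeft_apply, dif_neg fun h => hj h.1]

theorem stringRight_even (lo hi : ℕ) (v : StringSpace k lo hi)
    (j : {j : ℕ // lo ≤ j ∧ j ≤ hi}) (hj : ¬ Odd j.1) : stringRight k lo hi v j = 0 := by
  rw [stringRight_apply, dif_neg fun h => hj h.1]

/-- The bimodule with basis `m_lo, …, m_hi` and the actions of `stringLeft` and `stringRight`. -/
def stringOn (lo hi : ℕ) : DualBimodule k :=
  .ofOperators (StringSpace k lo hi) (stringLeft k lo hi) (stringRight k lo hi)
    (LinearMap.ext fun v => stringLeft_eq_zero k lo hi _ (stringLeft_even k lo hi v))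
    (LinearMap.ext fun v => stringRight_eq_zero k lo hi _ (stringRight_even k lo hi v))
    (LinearMap.ext fun v =>
      (stringLeft_eq_zero k lo hi _ (stringRight_even k lo hi v)).trans
        (stringRight_eq_zero k lo hi _ (stringLeft_even k lo hi v)).symm)

/-- The four shapes of string bimodules. -/
inductive StringShape
  | W | S | N | M

/-- The string bimodule of the given shape with `n` valleys. `M_n` is the full zigzag
`m_1 ← m_2 → m_3 ← ⋯ ← m_{2n+2} → m_{2n+3}`, in which `→` is the left and `←` the right action
of `ε`; `N_n` lacks `m_{2n+3}`, `S_n` lacks `m_1`, and `W_n` lacks both. -/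
def stringBimodule : StringShape → ℕ → DualBimodule k
  | .W, n => stringOn k 2 (2 * n + 2)
  | .S, n => stringOn k 2 (2 * n + 3)
  | .N, n => stringOn k 1 (2 * n + 2)
  | .M, n => stringOn k 1 (2 * n + 3)

end StringBimodules

/-- The 1-morphisms of `𝒟` isomorphic to tensoring with the string bimodule of the given shape
with `n` valleys. -/
def IsString {k : Type u} [Field k] (s : StringShape) (n : ℕ) (F : DualCat k) : Prop :=
  Nonempty (F.obj ≅ (stringBimodule k s n).tensorFunctor)

/-- The class `𝒥_n` of 1-morphisms given by the four string bimodules with `n` valleys. -/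
def cellJ (k : Type u) [Field k] (n : ℕ) : Set (DualCat k) :=
  {F | ∃ s, IsString s n F}

/-! ### Indecomposable objects and two-sided cells -/

section Summands

variable {C : Type*} [Category* C] [HasZeroMorphisms C]

/-- `Y` is isomorphic to a direct summand of `X`. -/
def IsSummand (Y X : C) : Prop :=
  ∃ (Z : C) (b : BinaryBicone Y Z), Nonempty b.IsBilimit ∧ Nonempty (b.pt ≅ X)

/-- `X` is nonzero and is not the direct sum of two nonzero objects. -/
def IsIndecomposable (X : C) : Prop :=
  ¬ IsZero X ∧ ∀ (Y Z : C) (b : BinaryBicone Y Z), b.IsBilimit → (b.pt ≅ X) →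
    IsZero Y ∨ IsZero Z

end Summands

/-- The set of isomorphism classes of indecomposable objects. -/
def IndecomposableClasses (C : Type*) [Category* C] [HasZeroMorphisms C] : Type _ :=
  {c : Quotient (isIsomorphicSetoid C) // ∃ X : C, IsIndecomposable X ∧ Quotient.mk _ X = c}

section Cells

variable {k : Type u} [Field k]

/-- The two-sided preorder: `F ≤_J G` if `G` is a direct summand of `H₁ ∘ F ∘ H₂` for some
1-morphisms `H₁` and `H₂`. -/
def LEJ (F G : DualCat k) : Prop :=
  ∃ H₁ H₂ : DualCat k, IsSummand G (H₂ ⊗ F ⊗ H₁)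

/-- A two-sided cell: an equivalence class of indecomposable 1-morphisms for the equivalence
relation induced by the two-sided preorder. -/
def IsTwoSidedCell (J : Set (DualCat k)) : Prop :=
  ∃ F : DualCat k, IsIndecomposable F ∧
    J = {G | IsIndecomposable G ∧ LEJ F G ∧ LEJ G F}

end Cells

/-! ### 2-representations -/

/-- A finitary `k`-linear category: additive, idempotent split, with finite-dimensional spaces
of morphisms and finitely many isomorphism classes of indecomposable objects. -/
class IsFinitary (k : Type u) [Field k] (A : Type w) [Category.{v} A] [Preadditive A]
    [Linear k A] : Prop where
  hasFiniteBiproducts : HasFiniteBiproducts A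
  isIdempotentComplete : IsIdempotentComplete A
  finite_hom : ∀ X Y : A, Module.Finite k (X ⟶ Y)
  finite_classes : Finite (IndecomposableClasses A)

attribute [instance] IsFinitary.hasFiniteBiproducts IsFinitary.isIdempotentComplete

/-- A finitary 2-representation of `𝒟` on the category `A` (the value at the unique object): a
`k`-linear monoidal functor from `𝒟` to the category of endofunctors of `A` with values in
additive `k`-linear functors. Composition is respected up to coherent isomorphism; strict
2-functors are the case in which these isomorphisms are identities. -/
structure FinitaryTwoRep (k : Type u) [Field k] (A : Type w) [Category.{v} A] [Preadditive A]
    [Linear k A] [IsFinitary k A] where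
  functor : DualCat k ⥤ (A ⥤ A)
  monoidal : letI := endofunctorMonoidalCategory A; functor.Monoidal
  additive_obj : ∀ F : DualCat k, (functor.obj F).Additive
  linear_obj : ∀ F : DualCat k, (functor.obj F).Linear k
  additive : functor.Additive
  linear : functor.Linear k

namespace FinitaryTwoRep

variable {k : Type u} [Field k] {A : Type w} [Category.{v} A] [Preadditive A] [Linear k A]
  [IsFinitary k A] (M : FinitaryTwoRep k A)

/-- The object `M(F) X`. -/
def act (F : DualCat k) (X : A) : A := (M.functor.obj F).obj X

/-- Every indecomposable object is, up to isomorphism, a direct summand of the image of any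
other one under some 1-morphism. -/
def IsTransitive : Prop :=
  ∀ X Y : A, IsIndecomposable X → IsIndecomposable Y →
    ∃ U : DualCat k, IsSummand Y (M.act U X)

/-- An ideal of `A` stable under the action of all 1-morphisms. -/
structure StableIdeal where
  hom : ∀ X Y : A, Submodule k (X ⟶ Y)
  comp_mem_left : ∀ {X Y Z : A} (f : X ⟶ Y) (g : Y ⟶ Z), g ∈ hom Y Z → f ≫ g ∈ hom X Z
  comp_mem_right : ∀ {X Y Z : A} (f : X ⟶ Y) (g : Y ⟶ Z), f ∈ hom X Y → f ≫ g ∈ hom X Z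
  map_mem : ∀ (F : DualCat k) {X Y : A} (f : X ⟶ Y), f ∈ hom X Y →
    (M.functor.obj F).map f ∈ hom ((M.functor.obj F).obj X) ((M.functor.obj F).obj Y)

/-- There are no proper nonzero stable ideals. -/
def IsSimple : Prop :=
  ∀ I : M.StableIdeal, (∀ X Y, I.hom X Y = ⊥) ∨ (∀ X Y, I.hom X Y = ⊤)

/-- A set of 1-morphisms is annihilated by `M` if all its members act by zero. -/
def Annihilates (J : Set (DualCat k)) : Prop :=
  ∀ F ∈ J, ∀ X : A, IsZero (M.act F X)

/-- `J` is the apex of `M`: a two-sided cell not annihilated by `M` and maximal with this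
property with respect to the two-sided preorder. -/
def IsApex (J : Set (DualCat k)) : Prop :=
  IsTwoSidedCell J ∧ ¬ M.Annihilates J ∧
    ∀ J' : Set (DualCat k), IsTwoSidedCell J' → ¬ M.Annihilates J' →
      (∃ F ∈ J, ∃ G ∈ J', LEJ F G) → J' = J

/-- The rank: the number of isomorphism classes of indecomposable objects. -/
def rank (_ : FinitaryTwoRep k A) : ℕ := Nat.card (IndecomposableClasses A)

/-- `X` is a complete, irredundant list of representatives of the isomorphism classes of
indecomposable objects of `A`. -/
def IsCompleteList (_ : FinitaryTwoRep k A) {r : ℕ} (X : Fin r → A) : Prop :=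
  (∀ i, IsIndecomposable (X i)) ∧ ∀ Y : A, IsIndecomposable Y → ∃! i, Nonempty (Y ≅ X i)

/-- `P` is the action matrix of `F` with respect to the list `X`: for each `j`, the object
`M(F) X_j` is the direct sum over `i` of `P i j` copies of `X_i`. -/
def IsActionMatrix {r : ℕ} (X : Fin r → A) (F : DualCat k) (P : Matrix (Fin r) (Fin r) ℕ) :
    Prop :=
  ∀ j, Nonempty (M.act F (X j) ≅ ⨁ fun p : (Σ i : Fin r, Fin (P i j)) => X p.1)

end FinitaryTwoRep

end

noncomputable section

/-! ### Retracts, summands and indecomposable objects -/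

/-! Write `n` for the number of valleys. The bimodules of the cell are the strings `stringOn k lo
hi` with `lo` equal to 1 or 2 and `hi` equal to `2n+2` or `2n+3`. Everything rests on one product,
`B ⊗_D B'` with `B = stringOn k lo hi`, where `B'` is a string of the cell starting with `m_2`. It
is graded by giving `m_a ⊗ m_b` the degree `⌊(a-b)/2⌋`. The part of degree 0 is a diagonal copy of
`stringOn k 2 hi`: it remembers the upper end of `B` and nothing of `B'`.

The other degrees contain nothing from the cell. To see this, evaluate at the simple module and
count generators: a string with `n` valleys needs `n+1` of them (`not_headGen_string`), while a part
of nonzero degree needs at most `n` (`exists_generators_grade`, where `n ≥ 1` enters). An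
indecomposable summand of a composition through the apex either lies in the apex or is killed by
`M`, by maximality of the apex. Hence `M` kills all nonzero degrees, and `M(B) M(B') ≅ M(stringOn k
2 hi)` on objects (`IsApex.nonempty_act_act_iso`). In particular `WW ≅ WS ≅ W` and `SW ≅ SS ≅ S`,
and `N`, `M` act like `W`, `S` on the images of `W` and `S`.

Now choose `Z` with `W Z ≠ 0` and `End (W Z)` of least dimension. If `W Z` were `X ⊕ Y` with both
terms nonzero, then `W Z ≅ W W Z ≅ W X ⊕ W Y` with both terms nonzero, and `W X` would have a
smaller endomorphism algebra. So `W Z` is indecomposable, and since `W S Z ≅ W Z`, so is `S Z`. By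
transitivity every indecomposable object is a summand of some `F (W Z)` with `F` in the cell, that
is, of `W Z` or `S Z`. The rank is 1 or 2 according to whether these two objects are isomorphic, and
the matrices are read off from the product rule.

The remaining input is of Krull–Schmidt type (local endomorphism algebras, finite decompositions of
1-morphisms), together with the identification of 2-morphisms with bimodule homomorphisms. -/

/-- Factor the minimal polynomial of `a` as `X^m q` with `X` and `q` coprime. A Bézout relation
gives complementary orthogonal idempotents that are polynomials in `a`. If the one divisible by
`X^m` is 0, then `a^m = 0`; if it is 1, then `a` is invertible. -/
theorem isUnit_or_isNilpotent_of_idempotents {k R : Type*} [Field k] [Ring R] [Algebra k R]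
    [Module.Finite k R] (hR : ∀ e : R, e * e = e → e = 0 ∨ e = 1) (a : R) :
    IsUnit a ∨ IsNilpotent a := by
  have ha : IsIntegral k a := Algebra.IsIntegral.isIntegral a
  obtain ⟨q, hq, hX⟩ := Polynomial.exists_eq_pow_rootMultiplicity_mul_and_not_dvd (minpoly k a)
    (minpoly.ne_zero ha) 0
  set m := (minpoly k a).rootMultiplicity 0
  rw [Polynomial.C_0, sub_zero] at hq hX
  have hpq : a ^ m * Polynomial.aeval a q = 0 := by
    have h := minpoly.aeval k a
    rw [hq] at h
    simpa using h
  have hcop : IsCoprime (Polynomial.X ^ m) q :=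
    IsCoprime.pow_left ((Polynomial.irreducible_X).coprime_iff_not_dvd.mpr hX)
  obtain ⟨s, t, hst⟩ := hcop
  have h1 : Polynomial.aeval a (s * Polynomial.X ^ m) + Polynomial.aeval a (t * q) = 1 := by
    rw [← map_add, hst, map_one]
  have h0 : Polynomial.aeval a (s * Polynomial.X ^ m) * Polynomial.aeval a (t * q) = 0 := by
    rw [← map_mul, show s * Polynomial.X ^ m * (t * q) = s * t * (Polynomial.X ^ m * q) by ring,
      map_mul, map_mul (Polynomial.aeval a) (Polynomial.X ^ m), map_pow, Polynomial.aeval_X, hpq,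
      mul_zero]
  have hidem : Polynomial.aeval a (s * Polynomial.X ^ m) *
      Polynomial.aeval a (s * Polynomial.X ^ m) = Polynomial.aeval a (s * Polynomial.X ^ m) := by
    have h := congrArg (Polynomial.aeval a (s * Polynomial.X ^ m) * ·) h1
    rwa [mul_add, h0, add_zero, mul_one] at h
  rcases hR _ hidem with h | h
  · right
    refine ⟨m, ?_⟩
    rw [h, zero_add] at h1
    calc a ^ m = a ^ m * Polynomial.aeval a (t * q) := by rw [h1, mul_one]
      _ = a ^ m * Polynomial.aeval a (q * t) := by rw [mul_comm q t]
      _ = 0 := by rw [map_mul, ← mul_assoc, hpq, zero_mul]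
  · left
    -- For `m = 0` the idempotent says nothing about `a`; then `q` itself annihilates `a`, and a
    -- Bézout relation between `X` and `q` yields the inverse.
    by_cases hm : m = 0
    · have hq0 : IsCoprime Polynomial.X q :=
        (Polynomial.irreducible_X).coprime_iff_not_dvd.mpr hX
      obtain ⟨s', t', h'⟩ := hq0
      have h2 := congrArg (Polynomial.aeval a) h'
      rw [hm, pow_zero, one_mul] at hpq
      rw [map_add, map_mul, map_mul, hpq, mul_zero, add_zero, Polynomial.aeval_X, map_one] at h2
      have h3 : a * Polynomial.aeval a s' = 1 := by
        rw [← h2]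
        have := congrArg (Polynomial.aeval a) (mul_comm Polynomial.X s')
        simpa using this
      exact ⟨⟨a, _, h3, h2⟩, rfl⟩
    · obtain ⟨l, hl⟩ := Nat.exists_eq_succ_of_ne_zero hm
      rw [hl, pow_succ] at h
      have h2 : Polynomial.aeval a (s * Polynomial.X ^ l) * a = 1 := by
        rw [← h, ← mul_assoc s, map_mul _ _ Polynomial.X, Polynomial.aeval_X]
      have h3 : a * Polynomial.aeval a (s * Polynomial.X ^ l) = 1 := by
        rw [← h]
        have := congrArg (Polynomial.aeval a) (show Polynomial.X * (s * Polynomial.X ^ l) =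
          s * (Polynomial.X ^ l * Polynomial.X) by ring)
        simpa using this
      exact ⟨⟨a, _, h3, h2⟩, rfl⟩

section Preadditive

variable {C : Type*} [Category* C] [Preadditive C]

/-- A decomposition of `X` as the direct sum of `Y` and `Z`, by orthogonal retractions. -/
structure Splitting (Y Z X : C) where
  fst : Retract Y X
  snd : Retract Z X
  total : fst.r ≫ fst.i + snd.r ≫ snd.i = 𝟙 X

namespace Splitting

variable {X Y Z : C} (s : Splitting Y Z X)

theorem inl_snd : s.fst.i ≫ s.snd.r = 0 := by
  have h := congrArg (fun f => s.fst.i ≫ f ≫ s.snd.r) s.total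
  simp only [Preadditive.add_comp, Preadditive.comp_add, Category.assoc, Retract.retract,
    Category.comp_id, Category.id_comp, Retract.retract_assoc] at h
  simpa using h

theorem inr_fst : s.snd.i ≫ s.fst.r = 0 := by
  have h := congrArg (fun f => s.snd.i ≫ f ≫ s.fst.r) s.total
  simp only [Preadditive.add_comp, Preadditive.comp_add, Category.assoc, Retract.retract,
    Category.comp_id, Category.id_comp, Retract.retract_assoc] at h
  simpa using h

/-- The binary bicone of a splitting. -/
def bicone : BinaryBicone Y Z where
  pt := X
  fst := s.fst.r
  snd := s.snd.r
  inl := s.fst.i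
  inr := s.snd.i
  inl_fst := s.fst.retract
  inl_snd := s.inl_snd
  inr_fst := s.inr_fst
  inr_snd := s.snd.retract

/-- The bicone of a splitting is a biproduct. -/
def isBilimit : s.bicone.IsBilimit := isBinaryBilimitOfTotal s.bicone s.total

/-- The splitting exchanging the two summands. -/
def swap : Splitting Z Y X := ⟨s.snd, s.fst, by rw [add_comm, s.total]⟩

/-- The splitting of the image under an additive functor. -/
def map {D : Type*} [Category* D] [Preadditive D] (F : C ⥤ D) [F.Additive] :
    Splitting (F.obj Y) (F.obj Z) (F.obj X) :=
  ⟨s.fst.map F, s.snd.map F, by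
    simp only [Retract.map_i, Retract.map_r, ← F.map_comp, ← F.map_add, s.total, F.map_id]⟩

/-- Transport of a splitting along an isomorphism. -/
def ofIso {X' : C} (e : X ≅ X') : Splitting Y Z X' :=
  ⟨s.fst.trans (Retract.ofIso e), s.snd.trans (Retract.ofIso e), by
    have h := congrArg (fun f => e.inv ≫ f ≫ e.hom) s.total
    simpa [Retract.trans, Retract.ofIso] using h⟩

/-- The splitting given by a bilimit bicone. -/
def ofBicone {b : BinaryBicone Y Z} (hb : b.IsBilimit) : Splitting Y Z b.pt :=
  ⟨⟨b.inl, b.fst, b.inl_fst⟩, ⟨b.inr, b.snd, b.inr_snd⟩, IsBilimit.binary_total hb⟩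

end Splitting

theorem IsSummand.exists_splitting {X Y : C} (h : IsSummand Y X) :
    ∃ Z, Nonempty (Splitting Y Z X) := by
  obtain ⟨Z, b, ⟨hb⟩, ⟨e⟩⟩ := h
  exact ⟨Z, ⟨(Splitting.ofBicone hb).ofIso e⟩⟩

theorem IsSummand.nonempty_retract {X Y : C} (h : IsSummand Y X) : Nonempty (Retract Y X) := by
  obtain ⟨Z, ⟨s⟩⟩ := h.exists_splitting
  exact ⟨s.fst⟩

theorem CategoryTheory.Retract.exists_splitting [IsIdempotentComplete C] {X Y : C}
    (h : Retract Y X) : ∃ Z, Nonempty (Splitting Y Z X) := by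
  obtain ⟨Z, i, r, h1, h2⟩ := IsIdempotentComplete.idempotents_split X (𝟙 X - h.r ≫ h.i)
    (Idempotents.idem_of_id_sub_idem _ (by simp))
  exact ⟨Z, ⟨⟨h, ⟨i, r, h1⟩, by rw [h2]; abel⟩⟩⟩

theorem CategoryTheory.Retract.isSummand [IsIdempotentComplete C] {X Y : C} (h : Retract Y X) :
    IsSummand Y X := by
  obtain ⟨Z, ⟨s⟩⟩ := h.exists_splitting
  exact ⟨Z, s.bicone, ⟨s.isBilimit⟩, ⟨Iso.refl _⟩⟩

theorem IsIndecomposable.isZero_or_isZero {X Y Z : C} (hX : IsIndecomposable X)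
    (s : Splitting Y Z X) : IsZero Y ∨ IsZero Z :=
  hX.2 Y Z s.bicone s.isBilimit (Iso.refl _)

theorem exists_splitting_of_not_isIndecomposable {X : C} (h0 : ¬ IsZero X)
    (h : ¬ IsIndecomposable X) :
    ∃ Y Z, Nonempty (Splitting Y Z X) ∧ ¬ IsZero Y ∧ ¬ IsZero Z := by
  unfold IsIndecomposable at h
  push Not at h
  obtain ⟨Y, Z, b, hb, e, hY, hZ⟩ := h h0
  exact ⟨Y, Z, ⟨(Splitting.ofBicone hb).ofIso e⟩, hY, hZ⟩

theorem isZero_of_retract {X Y : C} (h : Retract Y X) (hX : IsZero X) : IsZero Y := by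
  rw [IsZero.iff_id_eq_zero, ← h.retract, hX.eq_of_tgt h.i 0, zero_comp]

theorem isZero_of_splitting {X Y Z : C} (s : Splitting Y Z X) (hY : IsZero Y) (hZ : IsZero Z) :
    IsZero X := by
  rw [IsZero.iff_id_eq_zero, ← s.total, hY.eq_of_src s.fst.i 0, hZ.eq_of_src s.snd.i 0]
  simp

theorem isZero_of_iso {C : Type*} [Category* C] {X Y : C} (e : X ≅ Y) (hX : IsZero X) : IsZero Y :=
  hX.of_iso e.symm

/-- The first summand is everything if the second one vanishes. -/
def Splitting.isoOfIsZero {X Y Z : C} (s : Splitting Y Z X) (hZ : IsZero Z) : Y ≅ X where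
  hom := s.fst.i
  inv := s.fst.r
  hom_inv_id := s.fst.retract
  inv_hom_id := by
    rw [← s.total, hZ.eq_of_src s.snd.i 0, comp_zero, add_zero]

/-- Block-diagonal endomorphisms embed `End Y × End Z` in `End X`, and `End Z` is nonzero. This
strict drop is what makes descents on objects terminate. -/
theorem Splitting.finrank_end_lt {k : Type*} [Field k] [Linear k C] {X Y Z : C} [Module.Finite k (X ⟶ X)]
    [Module.Finite k (Y ⟶ Y)] [Module.Finite k (Z ⟶ Z)]
    (s : Splitting Y Z X) (hZ : ¬ IsZero Z) :
    Module.finrank k (Y ⟶ Y) < Module.finrank k (X ⟶ X) := by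
  let φ : ((Y ⟶ Y) × (Z ⟶ Z)) →ₗ[k] (X ⟶ X) :=
    { toFun := fun f => s.fst.r ≫ f.1 ≫ s.fst.i + s.snd.r ≫ f.2 ≫ s.snd.i
      map_add' := fun f g => by
        simp only [Prod.fst_add, Prod.snd_add, Preadditive.add_comp, Preadditive.comp_add]; abel
      map_smul' := fun c f => by simp }
  have hφ : Function.Injective φ := by
    rw [← LinearMap.ker_eq_bot, LinearMap.ker_eq_bot']
    rintro ⟨f, g⟩ h
    have h' : s.fst.r ≫ f ≫ s.fst.i + s.snd.r ≫ g ≫ s.snd.i = 0 := h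
    have h1 := congrArg (fun q => s.fst.i ≫ q ≫ s.fst.r) h'
    have h2 := congrArg (fun q => s.snd.i ≫ q ≫ s.snd.r) h'
    simp only [Preadditive.add_comp, Category.assoc, Retract.retract,
      Category.comp_id, Retract.retract_assoc, zero_comp, comp_zero, s.inr_fst,
      s.inl_snd, add_zero, zero_add] at h1 h2
    exact Prod.ext h1 h2
  have h1 := LinearMap.finrank_le_finrank_of_injective hφ
  rw [Module.finrank_prod] at h1
  have : Nontrivial (Z ⟶ Z) := ⟨𝟙 Z, 0, fun h => hZ ((IsZero.iff_id_eq_zero Z).mpr h)⟩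
  have h2 : 0 < Module.finrank k (Z ⟶ Z) := Module.finrank_pos
  omega

section IdempotentComplete

variable [IsIdempotentComplete C]

theorem IsIndecomposable.nonempty_iso_of_retract {X Y : C} (hX : IsIndecomposable X)
    (hY : ¬ IsZero Y) (h : Retract Y X) : Nonempty (Y ≅ X) := by
  obtain ⟨Z, ⟨s⟩⟩ := h.exists_splitting
  exact ⟨s.isoOfIsZero ((hX.isZero_or_isZero s).resolve_left hY)⟩

theorem IsIndecomposable.idempotent {X : C} (hX : IsIndecomposable X) (e : X ⟶ X)
    (he : e ≫ e = e) : e = 0 ∨ e = 𝟙 X := by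
  obtain ⟨Y, i, r, h1, h2⟩ := IsIdempotentComplete.idempotents_split X e he
  obtain ⟨Z, i', r', h1', h2'⟩ := IsIdempotentComplete.idempotents_split X (𝟙 X - e)
    (Idempotents.idem_of_id_sub_idem _ he)
  have s : Splitting Y Z X := ⟨⟨i, r, h1⟩, ⟨i', r', h1'⟩, by rw [h2, h2']; abel⟩
  rcases hX.isZero_or_isZero s with h | h
  · left
    rw [← h2, h.eq_of_src i 0, comp_zero]
  · right
    rw [h.eq_of_src i' 0, comp_zero] at h2'
    exact (sub_eq_zero.mp h2'.symm).symm

variable {k : Type*} [Field k] [Linear k C]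

/-- The endomorphism algebra is local: if `f` is not invertible it is nilpotent, and then `g = 1 -
f` is invertible. -/
theorem IsIndecomposable.isIso_or_isIso {X : C} [Module.Finite k (X ⟶ X)]
    (hX : IsIndecomposable X) {f g : X ⟶ X} (h : f + g = 𝟙 X) : IsIso f ∨ IsIso g := by
  have : Module.Finite k (End X) := inferInstanceAs (Module.Finite k (X ⟶ X))
  have key := isUnit_or_isNilpotent_of_idempotents (k := k) (R := End X)
    (fun e he => hX.idempotent e he)
  rcases key f with hf | hf
  · exact Or.inl ((isUnit_iff_isIso _).mp hf)
  · have : IsUnit (1 - (show End X from f)) := hf.isUnit_one_sub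
    right
    rw [← isUnit_iff_isIso]
    convert this using 1
    exact eq_sub_of_add_eq' h

/-- An indecomposable summand of a direct sum is a summand of one of the terms. -/
theorem IsIndecomposable.retract_or_retract {X Y Z A : C} [Module.Finite k (A ⟶ A)]
    (hA : IsIndecomposable A) (s : Splitting Y Z X) (h : Retract A X) :
    Nonempty (Retract A Y) ∨ Nonempty (Retract A Z) := by
  have hsum : (h.i ≫ s.fst.r) ≫ (s.fst.i ≫ h.r) + (h.i ≫ s.snd.r) ≫ (s.snd.i ≫ h.r) = 𝟙 A := by
    have := congrArg (fun f => h.i ≫ f ≫ h.r) s.total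
    simpa [Preadditive.add_comp, Preadditive.comp_add] using this
  rcases hA.isIso_or_isIso (k := k) hsum with h1 | h1
  · exact Or.inl ⟨⟨h.i ≫ s.fst.r, (s.fst.i ≫ h.r) ≫
      inv ((h.i ≫ s.fst.r) ≫ (s.fst.i ≫ h.r)), by
        rw [← Category.assoc]; exact IsIso.hom_inv_id _⟩⟩
  · exact Or.inr ⟨⟨h.i ≫ s.snd.r, (s.snd.i ≫ h.r) ≫
      inv ((h.i ≫ s.snd.r) ≫ (s.snd.i ≫ h.r)), by
        rw [← Category.assoc]; exact IsIso.hom_inv_id _⟩⟩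

end IdempotentComplete

end Preadditive

/-! ### Bimodule homomorphisms and natural transformations -/

namespace DualBimodule

variable {k : Type u} [Field k]

/-- A homomorphism of bimodules. -/
@[ext]
structure Hom (B C : DualBimodule k) where
  lin : B.carrier →ₗ[k[ε]] C.carrier
  map_leftAction : ∀ (d : k[ε]) (b : B.carrier),
    lin (B.leftAction d b) = C.leftAction d (lin b)

namespace Hom

variable {B C E : DualBimodule k}

/-- The identity homomorphism. -/
def id (B : DualBimodule k) : Hom B B := ⟨LinearMap.id, fun _ _ => rfl⟩

/-- The composition `B → C → E`. -/
def comp (f : Hom B C) (g : Hom C E) : Hom B E :=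
  ⟨g.lin ∘ₗ f.lin, fun d b => by
    rw [LinearMap.comp_apply, f.map_leftAction, g.map_leftAction, LinearMap.comp_apply]⟩

/-- The map `f ⊗_D X`. -/
def tensor (f : Hom B C) (X : Type u) [AddCommGroup X] [Module k[ε] X] :
    B.TensorObj X →ₗ[k[ε]] C.TensorObj X where
  toFun := f.lin.rTensor X
  map_add' := map_add (f.lin.rTensor X)
  map_smul' d t := by
    let g : B.TensorObj X →+ C.TensorObj X := (f.lin.rTensor X).toAddMonoidHom
    have h : g.comp (DistribSMul.toAddMonoidHom _ d) = (DistribSMul.toAddMonoidHom _ d).comp g :=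
      B.hom_ext fun b x => congrArg (fun c => C.tmul c x) (f.map_leftAction d b)
    exact DFunLike.congr_fun h t

theorem tensor_tmul (f : Hom B C) {X : Type u} [AddCommGroup X] [Module k[ε] X]
    (b : B.carrier) (x : X) : f.tensor X (B.tmul b x) = C.tmul (f.lin b) x := rfl

/-- The natural transformation `f ⊗_D -`. -/
def toNat (f : Hom B C) : B.tensorFunctor ⟶ C.tensorFunctor where
  app X := FGModuleCat.ofHom (f.tensor X)
  naturality X Y g := by
    apply FGModuleCat.hom_ext
    apply LinearMap.toAddMonoidHom_injective
    exact B.hom_ext fun b x => rfl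

end Hom

variable {B C E : DualBimodule k}

theorem natTrans_ext {F : FGModuleCat.{u} k[ε] ⥤ FGModuleCat.{u} k[ε]}
    {η θ : B.tensorFunctor ⟶ F}
    (h : ∀ (X : FGModuleCat.{u} k[ε]) (b : B.carrier) (x : X),
      (η.app X).hom.hom (B.tmul b x) = (θ.app X).hom.hom (B.tmul b x)) : η = θ := by
  apply NatTrans.ext
  funext X
  apply FGModuleCat.hom_ext
  apply LinearMap.toAddMonoidHom_injective
  exact B.hom_ext fun b x => h X b x

namespace Hom

theorem toNat_comp (f : Hom B C) (g : Hom C E) : (f.comp g).toNat = f.toNat ≫ g.toNat :=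
  natTrans_ext fun _ _ _ => rfl

theorem toNat_id (B : DualBimodule k) : (Hom.id B).toNat = 𝟙 B.tensorFunctor :=
  natTrans_ext fun _ _ _ => rfl

/-- The value of the transformation at `D` on `b ⊗ 1` recovers the image of `b`. -/
theorem toNat_injective : Function.Injective (toNat : Hom B C → _) := by
  intro f g h
  apply Hom.ext
  ext b
  have h1 := congrArg (fun η : B.tensorFunctor ⟶ C.tensorFunctor => (η.app (FGModuleCat.of k[ε] k[ε])).hom.hom
    (B.tmul b (1 : k[ε]))) h
  have h2 : C.tmul (f.lin b) (1 : k[ε]) = C.tmul (g.lin b) (1 : k[ε]) := h1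
  have h3 := congrArg (TensorProduct.rid k[ε] C.carrier) h2
  have h4 : ∀ c : C.carrier, TensorProduct.rid k[ε] C.carrier (C.tmul c (1 : k[ε])) = c :=
    fun c => (TensorProduct.rid_tmul (R := k[ε]) c (1 : k[ε])).trans (one_smul _ c)
  rwa [h4, h4] at h3

end Hom

/-- The map `C ⊗_D D → C`. -/
def ridAdd (C : DualBimodule k) : C.TensorObj k[ε] →+ C.carrier :=
  (TensorProduct.rid k[ε] C.carrier).toLinearMap.toAddMonoidHom

theorem ridAdd_tmul (C : DualBimodule k) (c : C.carrier) (d : k[ε]) :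
    C.ridAdd (C.tmul c d) = d • c := TensorProduct.rid_tmul (R := k[ε]) c d

theorem ridAdd_smul (C : DualBimodule k) (d : k[ε]) (t : C.TensorObj k[ε]) :
    C.ridAdd (d • t) = C.leftAction d (C.ridAdd t) := by
  induction t using C.tensor_induction with
  | h0 => simp
  | h1 b x => rw [smul_tmul, ridAdd_tmul, ridAdd_tmul, map_smul]
  | h2 s t hs ht => rw [smul_add, map_add, hs, ht, map_add, map_add]

theorem tmul_ridAdd (C : DualBimodule k) {X : Type u} [AddCommGroup X] [Module k[ε] X]
    (t : C.TensorObj k[ε]) (x : X) :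
    C.tmul (C.ridAdd t) x = C.tensorMap (LinearMap.toSpanSingleton k[ε] X x) t := by
  induction t using C.tensor_induction with
  | h0 => rw [map_zero, map_zero, zero_tmul]
  | h1 b d => rw [ridAdd_tmul, tmul_balanced, tensorMap_tmul, LinearMap.toSpanSingleton_apply]
  | h2 s t hs ht => rw [map_add, map_add, add_tmul, hs, ht]

/-- Natural transformations between tensor functors come from bimodule homomorphisms. -/
theorem Hom.toNat_surjective : Function.Surjective (Hom.toNat : Hom B C → _) := by
  intro η
  let D : FGModuleCat.{u} k[ε] := FGModuleCat.of k[ε] k[ε]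
  let ηD : B.TensorObj k[ε] →ₗ[k[ε]] C.TensorObj k[ε] := (η.app D).hom.hom
  -- Naturality along the map `D → X` sending 1 to `x`: the component at `D` determines all the
  -- others, and right linearity of the resulting map is the case `X = D`.
  have nat : ∀ (X : FGModuleCat.{u} k[ε]) (x : X) (t : B.TensorObj k[ε]),
      (η.app X).hom.hom (B.tensorMap (LinearMap.toSpanSingleton k[ε] X x) t) =
        C.tensorMap (LinearMap.toSpanSingleton k[ε] X x) (ηD t) := by
    intro X x t
    let φ : D ⟶ X := ⟨ModuleCat.ofHom (LinearMap.toSpanSingleton k[ε] X x)⟩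
    exact LinearMap.congr_fun (congrArg (fun g => g.hom.hom) (η.naturality φ)) t
  have nat1 : ∀ (X : FGModuleCat.{u} k[ε]) (x : X) (b : B.carrier),
      (η.app X).hom.hom (B.tmul b x) = C.tmul (C.ridAdd (ηD (B.tmul b (1 : k[ε])))) x := by
    intro X x b
    rw [tmul_ridAdd, ← nat, tensorMap_tmul, LinearMap.toSpanSingleton_apply, one_smul]
  refine ⟨⟨{ toFun := fun b => C.ridAdd (ηD (B.tmul b (1 : k[ε])))
             map_add' := fun b c => by rw [add_tmul, map_add, map_add]
             map_smul' := fun d b => ?_ }, fun d b => ?_⟩, ?_⟩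
  · have h : ηD (B.tmul b d) = C.tmul (C.ridAdd (ηD (B.tmul b (1 : k[ε])))) d := nat1 D d b
    rw [RingHom.id_apply, tmul_balanced, smul_eq_mul, mul_one, h, ridAdd_tmul]
  · change C.ridAdd (ηD (B.tmul (B.leftAction d b) (1 : k[ε]))) = _
    rw [← smul_tmul, map_smul, ridAdd_smul]
    rfl
  · exact natTrans_ext fun X b x => (nat1 X x b).symm

/-- The image of a bimodule endomorphism. -/
def range (f : Hom B B) : DualBimodule k where
  carrier := LinearMap.range f.lin
  leftAction :=
    { toFun := fun d => (B.leftAction d).restrict (p := LinearMap.range f.lin)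
        (q := LinearMap.range f.lin) (by
          rintro _ ⟨b, rfl⟩
          exact ⟨B.leftAction d b, f.map_leftAction d b⟩)
      map_one' := by ext b; simp
      map_mul' := fun d e => by ext b; simp
      map_zero' := by ext b; simp
      map_add' := fun d e => by ext b; simp }
  leftAction_algebraMap c b := Subtype.ext (B.leftAction_algebraMap c b.1)

/-- The inclusion of the image. -/
def rangeIncl (f : Hom B B) : Hom (range f) B :=
  ⟨(LinearMap.range f.lin).subtype, fun _ _ => rfl⟩

/-- The corestriction to the image. -/
def rangeProj (f : Hom B B) : Hom B (range f) :=
  ⟨f.lin.rangeRestrict, fun d b => Subtype.ext (f.map_leftAction d b)⟩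

theorem rangeProj_comp_rangeIncl (f : Hom B B) : (rangeProj f).comp (rangeIncl f) = f := rfl

theorem rangeIncl_comp_rangeProj (f : Hom B B) (hf : f.comp f = f) :
    (rangeIncl f).comp (rangeProj f) = Hom.id (range f) := by
  apply Hom.ext
  ext ⟨_, b, rfl⟩
  exact Subtype.ext (LinearMap.congr_fun (congrArg Hom.lin hf) b)

/-- The 1-morphism given by tensoring with `B`. -/
def toCat (B : DualBimodule k) : DualCat k := ⟨B.tensorFunctor, B, ⟨Iso.refl _⟩⟩

/-- The 2-morphism given by a homomorphism of bimodules. -/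
def Hom.toCat (f : Hom B C) : B.toCat ⟶ C.toCat := ObjectProperty.homMk f.toNat

theorem Hom.toCat_comp (f : Hom B C) (g : Hom C E) : (f.comp g).toCat = f.toCat ≫ g.toCat :=
  ObjectProperty.hom_ext _ (f.toNat_comp g)

theorem Hom.toCat_id (B : DualBimodule k) : (Hom.id B).toCat = 𝟙 B.toCat :=
  ObjectProperty.hom_ext _ (Hom.toNat_id B)

/-- The tensor product of bimodules gives the composition of 1-morphisms. -/
def toCatComp (B C : DualBimodule k) : C.toCat ⊗ B.toCat ≅ (B.comp C).toCat :=
  ObjectProperty.isoMk _ (B.tensorFunctorComp C)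

end DualBimodule

/-! ### Splitting idempotents and decomposing 1-morphisms -/

namespace DualCat

variable {k : Type u} [Field k]

theorem exists_iso_toCat (F : DualCat k) : ∃ B : DualBimodule k, Nonempty (F ≅ B.toCat) := by
  obtain ⟨B, ⟨e⟩⟩ := F.property
  exact ⟨B, ⟨ObjectProperty.isoMk _ e⟩⟩

/-- An idempotent 2-morphism comes from an idempotent bimodule endomorphism, and the image of the
latter is again a finite-dimensional bimodule. -/
instance : IsIdempotentComplete (DualCat k) where
  idempotents_split F p hp := by
    obtain ⟨B, ⟨e⟩⟩ := exists_iso_toCat F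
    obtain ⟨f, hf⟩ := DualBimodule.Hom.toNat_surjective (e.inv ≫ p ≫ e.hom).hom
    have hf' : f.toCat = e.inv ≫ p ≫ e.hom := ObjectProperty.hom_ext _ hf
    have hff : f.comp f = f := by
      apply DualBimodule.Hom.toNat_injective
      have h : (f.comp f).toCat = f.toCat := by
        rw [DualBimodule.Hom.toCat_comp, hf']
        simp [reassoc_of% hp]
      exact congrArg (fun g => g.hom) h
    refine ⟨(DualBimodule.range f).toCat, (DualBimodule.rangeIncl f).toCat ≫ e.inv,
      e.hom ≫ (DualBimodule.rangeProj f).toCat, ?_, ?_⟩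
    · rw [Category.assoc, e.inv_hom_id_assoc, ← DualBimodule.Hom.toCat_comp,
        DualBimodule.rangeIncl_comp_rangeProj f hff, DualBimodule.Hom.toCat_id]
    · rw [Category.assoc, ← Category.assoc (DualBimodule.Hom.toCat _),
        ← DualBimodule.Hom.toCat_comp, DualBimodule.rangeProj_comp_rangeIncl, hf']
      simp

/-- Evaluation of 1-morphisms at a module. -/
def eval (X : FGModuleCat.{u} k[ε]) : DualCat k ⥤ FGModuleCat.{u} k[ε] :=
  (isTensorFunctor k).ι ⋙ (evaluation _ _).obj X

instance (X : FGModuleCat.{u} k[ε]) : (eval X).Additive where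
  map_add := rfl

/-- The bimodule is the value of the functor at `D`, so it vanishes as soon as that value does. -/
theorem isZero_of_subsingleton (F : DualCat k)
    (h : Subsingleton ((eval (FGModuleCat.of k[ε] k[ε])).obj F)) : IsZero F := by
  obtain ⟨B, ⟨e⟩⟩ := exists_iso_toCat F
  refine isZero_of_iso e.symm ?_
  have hs : Subsingleton (B.TensorObj k[ε]) :=
    (FGModuleCat.isoToLinearEquiv ((eval (FGModuleCat.of k[ε] k[ε])).mapIso e)).symm.toEquiv.subsingleton
  rw [IsZero.iff_id_eq_zero]
  apply ObjectProperty.hom_ext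
  refine DualBimodule.natTrans_ext (F := B.tensorFunctor) fun X b x => ?_
  have hb : b = 0 := by
    rw [← one_smul k[ε] b, ← B.ridAdd_tmul, Subsingleton.elim (B.tmul b (1 : k[ε])) 0, map_zero]
  have h0 : B.tmul b x = 0 := by rw [hb, B.zero_tmul]
  have key : ∀ f g : B.TensorObj X →ₗ[k[ε]] B.TensorObj X, f (B.tmul b x) = g (B.tmul b x) := by
    intro f g
    rw [h0, map_zero, map_zero]
  exact key _ _

/-- The length of the value at `D`. -/
def size (F : DualCat k) : ℕ :=
  (Module.length k[ε] ((eval (FGModuleCat.of k[ε] k[ε])).obj F)).toNat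

end DualCat

theorem DualNumber.length_ne_top {k : Type u} [Field k] (X : FGModuleCat.{u} k[ε]) :
    Module.length k[ε] X ≠ ⊤ := by
  have : Module.Finite k k[ε] := inferInstanceAs (Module.Finite k (k × k))
  have : IsArtinianRing k[ε] := IsArtinianRing.of_finite k k[ε]
  exact Module.length_ne_top

theorem FGModuleCat.length_add_le {R : Type u} [CommRing R] {X Y Z : FGModuleCat.{u} R}
    (s : Splitting Y Z X) : Module.length R Y + Module.length R Z ≤ Module.length R X := by
  rw [← Module.length_prod]
  refine Module.length_le_of_injective (s.fst.i.hom.hom.coprod s.snd.i.hom.hom) ?_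
  rw [← LinearMap.ker_eq_bot, LinearMap.ker_eq_bot']
  rintro ⟨y, z⟩ h
  have e : ∀ {V W U : FGModuleCat.{u} R} (f : V ⟶ W) (g : W ⟶ U) (h : V ⟶ U), f ≫ g = h →
      ∀ x, g.hom.hom (f.hom.hom x) = h.hom.hom x := by
    rintro V W U f g _ rfl x; rfl
  rw [LinearMap.coprod_apply] at h
  have h1 := congrArg s.fst.r.hom.hom h
  have h2 := congrArg s.snd.r.hom.hom h
  rw [map_add, map_zero, e _ _ _ s.fst.retract, e _ _ _ s.inr_fst] at h1
  rw [map_add, map_zero, e _ _ _ s.snd.retract, e _ _ _ s.inl_snd] at h2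
  have h1' : y + 0 = 0 := h1
  have h2' : 0 + z = 0 := h2
  rw [add_zero] at h1'
  rw [zero_add] at h2'
  rw [h1', h2']
  rfl

namespace DualCat

variable {k : Type u} [Field k]

/-- The length at `D` is finite, positive on nonzero 1-morphisms, and bounds the sum of the lengths
of the two summands. It is the induction parameter for decomposing a 1-morphism. -/
theorem size_lt_of_splitting {F G H : DualCat k} (s : Splitting F G H) (hG : ¬ IsZero G) :
    F.size < H.size := by
  have h := FGModuleCat.length_add_le (s.map (eval (FGModuleCat.of k[ε] k[ε])))
  have hG' : Module.length k[ε] ((eval (FGModuleCat.of k[ε] k[ε])).obj G) ≠ 0 := fun h0 =>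
    hG (isZero_of_subsingleton G (Module.length_eq_zero_iff.mp h0))
  have hF := DualNumber.length_ne_top ((eval (FGModuleCat.of k[ε] k[ε])).obj F)
  have hH := DualNumber.length_ne_top ((eval (FGModuleCat.of k[ε] k[ε])).obj H)
  have hGt := DualNumber.length_ne_top ((eval (FGModuleCat.of k[ε] k[ε])).obj G)
  rw [← ENat.natCast_toNat hF, ← ENat.natCast_toNat hH, ← ENat.natCast_toNat hGt] at h
  rw [← ENat.natCast_toNat hGt] at hG'
  norm_cast at h hG'
  unfold size
  omega

/-- A property of 1-morphisms that holds for the indecomposable summands of `T` and is closed under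
direct sums holds for `T`. -/
theorem induction_retract {P : DualCat k → Prop} (T : DualCat k)
    (hzero : ∀ G, IsZero G → P G)
    (hadd : ∀ {G₁ G₂ G : DualCat k}, Splitting G₁ G₂ G → P G₁ → P G₂ → P G)
    (hind : ∀ G, IsIndecomposable G → Retract G T → P G) : P T := by
  suffices h : ∀ (n : ℕ) (G : DualCat k), G.size = n → Retract G T → P G from
    h _ T rfl (Retract.refl T)
  intro n
  induction n using Nat.strong_induction_on with
  | _ n ih =>
    intro G hG hr
    by_cases h0 : IsZero G
    · exact hzero G h0
    by_cases hi : IsIndecomposable G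
    · exact hind G hi hr
    obtain ⟨Y, Z, ⟨s⟩, hY, hZ⟩ := exists_splitting_of_not_isIndecomposable h0 hi
    exact hadd s (ih _ (hG ▸ size_lt_of_splitting s hZ) Y rfl (s.fst.trans hr))
      (ih _ (hG ▸ size_lt_of_splitting s.swap hY) Z rfl (s.snd.trans hr))

end DualCat

/-! ### Homomorphisms of string bimodules -/

theorem DualNumber.eq_add_mul_eps {k : Type u} [Field k] (d : k[ε]) :
    d = algebraMap k k[ε] d.fst + algebraMap k k[ε] d.snd * ε := by
  ext <;> simp [TrivSqZeroExt.algebraMap_eq_inl]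

namespace DualBimodule

variable {k : Type u} [Field k]

/-- An additive map commuting with the scalars and the two actions of `ε` is a homomorphism of
bimodules. -/
def Hom.ofAdd {B C : DualBimodule k} (f : B.carrier →+ C.carrier)
    (hk : ∀ (c : k) b, f (algebraMap k k[ε] c • b) = algebraMap k k[ε] c • f b)
    (hr : ∀ b, f ((ε : k[ε]) • b) = (ε : k[ε]) • f b)
    (hl : ∀ b, f (B.leftAction ε b) = C.leftAction ε (f b)) : Hom B C where
  lin :=
    { f with
      map_smul' := fun d b => by
        change f (d • b) = d • f b
        rw [DualNumber.eq_add_mul_eps d, add_smul, add_smul, map_add, mul_smul, mul_smul, hk, hk,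
          hr] }
  map_leftAction d b := by
    change f (B.leftAction d b) = C.leftAction d (f b)
    rw [DualNumber.eq_add_mul_eps d, map_add, map_add, map_mul, map_mul, LinearMap.add_apply,
      LinearMap.add_apply, map_add, Module.End.mul_apply, Module.End.mul_apply,
      B.leftAction_algebraMap, B.leftAction_algebraMap, C.leftAction_algebraMap,
      C.leftAction_algebraMap, hk, hk, hl]

/-- Over `k`, the algebra `D` is spanned by 1 and `ε`, and scalars act centrally, so balancedness
has to be tested on scalars and on `ε` only. -/
theorem balanced_of_eps {B C : DualBimodule k} {P : Type*} [AddCommMonoid P]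
    (f : B.carrier →+ C.carrier →+ P)
    (hk : ∀ (c : k) b x, f (algebraMap k k[ε] c • b) x = f b (algebraMap k k[ε] c • x))
    (he : ∀ b x, f ((ε : k[ε]) • b) x = f b (C.leftAction ε x)) (d : k[ε]) (b : B.carrier)
    (x : C.carrier) : f (d • b) x = f b (C.leftAction d x) := by
  have h : C.leftAction d x = algebraMap k k[ε] d.fst • x +
      C.leftAction ε (algebraMap k k[ε] d.snd • x) := by
    conv_lhs => rw [DualNumber.eq_add_mul_eps d, mul_comm, map_add, map_mul, LinearMap.add_apply,
      Module.End.mul_apply, C.leftAction_algebraMap, C.leftAction_algebraMap]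
  rw [h, map_add, ← hk, ← he, ← hk, ← AddMonoidHom.add_apply, ← map_add, smul_smul, ← add_smul,
    ← DualNumber.eq_add_mul_eps]

/-- The coordinate vector of `s m_a`. -/
def coordVec (lo hi a : ℕ) (s : k) : StringSpace k lo hi := fun j => if j.1 = a then s else 0

theorem coordVec_apply {lo hi : ℕ} (a : ℕ) (s : k) (j : {j : ℕ // lo ≤ j ∧ j ≤ hi}) :
    coordVec lo hi a s j = if j.1 = a then s else 0 := rfl

/-- The multiple `s m_a` of a basis vector of a string (zero if `m_a` is absent). -/
def vec (lo hi a : ℕ) : k →+ (stringOn k lo hi).carrier where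
  toFun s := coordVec lo hi a s
  map_zero' := by
    funext j
    exact ite_self _
  map_add' s t := by
    funext j
    change (if j.1 = a then s + t else 0) = (if j.1 = a then s else 0) + (if j.1 = a then t else 0)
    split_ifs <;> simp

section Vec

variable {lo hi : ℕ}

theorem vec_eq_zero {a : ℕ} (h : ¬ (lo ≤ a ∧ a ≤ hi)) (s : k) : vec lo hi a s = 0 := by
  funext j
  exact if_neg fun e : j.1 = a => h (e ▸ j.2)

theorem algebraMap_smul_string (c : k) (v : StringSpace k lo hi) :
    algebraMap k k[ε] c • (show (stringOn k lo hi).carrier from v) = (c • v : StringSpace k lo hi) := by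
  change (algebraMap k k[ε] c).fst • v + (algebraMap k k[ε] c).snd • stringRight k lo hi v = _
  rw [TrivSqZeroExt.algebraMap_eq_inl]
  change c • v + (0 : k) • _ = _
  rw [zero_smul, add_zero]

theorem eps_smul_string (v : StringSpace k lo hi) :
    (ε : k[ε]) • (show (stringOn k lo hi).carrier from v) = stringRight k lo hi v := by
  change (0 : k) • v + (1 : k) • stringRight k lo hi v = _
  rw [zero_smul, zero_add, one_smul]

theorem leftAction_eps_string (v : StringSpace k lo hi) :
    (stringOn k lo hi).leftAction ε v = stringLeft k lo hi v := by
  change (0 : k) • v + (1 : k) • stringLeft k lo hi v = _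
  rw [zero_smul, zero_add, one_smul]

theorem algebraMap_smul_vec (c : k) (a : ℕ) (s : k) :
    algebraMap k k[ε] c • vec lo hi a s = vec lo hi a (c * s) := by
  refine (algebraMap_smul_string c _).trans ?_
  change c • coordVec lo hi a s = coordVec lo hi a (c * s)
  funext j
  rw [Pi.smul_apply, coordVec_apply, coordVec_apply, smul_eq_mul, mul_ite, mul_zero]

theorem eps_smul_vec_odd {a : ℕ} (ha : a % 2 = 1) (s : k) : (ε : k[ε]) • vec lo hi a s = 0 := by
  refine (eps_smul_string _).trans (stringRight_eq_zero k lo hi _ fun j hj => ?_)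
  refine if_neg ?_
  rintro rfl
  exact hj (Nat.odd_iff.mpr ha)

theorem leftAction_eps_vec_odd {a : ℕ} (ha : a % 2 = 1) (s : k) :
    (stringOn k lo hi).leftAction ε (vec lo hi a s) = 0 := by
  refine (leftAction_eps_string _).trans (stringLeft_eq_zero k lo hi _ fun j hj => ?_)
  refine if_neg ?_
  rintro rfl
  exact hj (Nat.odd_iff.mpr ha)

/-- The bound `a ≤ hi` rules out `a = hi + 1`, where `m_a` is absent but `m_{a-1}` may be present.
No lower bound is needed: if `m_{a-1}` is absent, both sides are zero. The condition `a ≠ 0` guards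
against truncated subtraction. -/
theorem eps_smul_vec_even {a : ℕ} (ha : a % 2 = 0) (h0 : a ≠ 0) (h1 : a ≤ hi) (s : k) :
    (ε : k[ε]) • vec lo hi a s = vec lo hi (a - 1) s := by
  refine (eps_smul_string _).trans ?_
  change stringRight k lo hi (coordVec lo hi a s) = coordVec lo hi (a - 1) s
  funext j
  rw [stringRight_apply, coordVec_apply]
  simp only [coordVec_apply, Nat.odd_iff]
  have := j.2
  split_ifs <;> first | rfl | omega

theorem leftAction_eps_vec_even {a : ℕ} (ha : a % 2 = 0) (h1 : lo ≤ a) (s : k) :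
    (stringOn k lo hi).leftAction ε (vec lo hi a s) = vec lo hi (a + 1) s := by
  refine (leftAction_eps_string _).trans ?_
  change stringLeft k lo hi (coordVec lo hi a s) = coordVec lo hi (a + 1) s
  funext j
  rw [stringLeft_apply, coordVec_apply]
  simp only [coordVec_apply, Nat.odd_iff]
  have := j.2
  split_ifs <;> first | rfl | omega

instance : Fintype {j : ℕ // lo ≤ j ∧ j ≤ hi} := Fintype.ofFinite _

/-- The additive map out of a string with given values on the multiples of basis vectors. -/
def strLift {P : Type*} [AddCommMonoid P] (φ : ℕ → k →+ P) : (stringOn k lo hi).carrier →+ P where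
  toFun v := ∑ j, φ j.1 ((v : StringSpace k lo hi) j)
  map_zero' := Finset.sum_eq_zero fun j _ => map_zero (φ j.1)
  map_add' v w := by
    rw [← Finset.sum_add_distrib]
    exact Finset.sum_congr rfl fun j _ => map_add (φ j.1) _ _

theorem strLift_vec {P : Type*} [AddCommMonoid P] (φ : ℕ → k →+ P) {a : ℕ}
    (ha : lo ≤ a ∧ a ≤ hi) (s : k) : strLift φ (vec lo hi a s) = φ a s := by
  change ∑ j, φ j.1 (coordVec lo hi a s j) = _
  rw [Finset.sum_eq_single ⟨a, ha⟩]
  · rw [coordVec_apply, if_pos rfl]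
  · intro j _ hj
    rw [coordVec_apply, if_neg fun e => hj (Subtype.ext e), map_zero]
  · intro h
    exact absurd (Finset.mem_univ _) h

theorem sum_vec (v : (stringOn k lo hi).carrier) :
    strLift (fun a => vec lo hi a) v = v := by
  change ∑ j, vec lo hi j.1 ((v : StringSpace k lo hi) j) = (v : StringSpace k lo hi)
  funext i
  refine (Finset.sum_apply i _ _).trans ?_
  rw [Finset.sum_eq_single i]
  · exact if_pos rfl
  · intro j _ hj
    exact if_neg fun e => hj (Subtype.ext e.symm)
  · intro h
    exact absurd (Finset.mem_univ _) h

theorem str_hom_ext {P : Type*} [AddCommMonoid P] {f g : (stringOn k lo hi).carrier →+ P}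
    (h : ∀ a s, lo ≤ a → a ≤ hi → f (vec lo hi a s) = g (vec lo hi a s)) : f = g := by
  ext v
  rw [← sum_vec v]
  change f (∑ j, _) = g (∑ j, _)
  rw [map_sum, map_sum]
  exact Finset.sum_congr rfl fun j _ => h j.1 _ j.2.1 j.2.2

end Vec

/-! ### The tensor product of two strings -/

section Tensor

variable {lo hi hi' : ℕ}

variable (k lo hi hi') in
/-- The tensor product of a string with a string starting with `m_2`. -/
abbrev strTensor : DualBimodule k := (stringOn k lo hi).comp (stringOn k 2 hi')

variable (lo hi hi') in
/-- The element `s m_a ⊗ m_b`. -/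
def tvec (a b : ℕ) : k →+ (strTensor k lo hi hi').carrier where
  toFun s := (stringOn k lo hi).ctmul (vec lo hi a s) (vec 2 hi' b 1)
  map_zero' := by rw [map_zero, zero_ctmul]; rfl
  map_add' s t := by rw [map_add, add_ctmul]; rfl

theorem tvec_eq (a b : ℕ) (s : k) : tvec lo hi hi' a b s =
    (stringOn k lo hi).ctmul (vec lo hi a s) (vec 2 hi' b 1) := rfl

theorem ctmul_vec (a b : ℕ) (s t : k) : (stringOn k lo hi).ctmul (vec lo hi a s)
    (vec 2 hi' b t) = tvec lo hi hi' a b (t * s) := by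
  rw [tvec_eq, ← algebraMap_smul_vec t a s, ctmul_balanced, leftAction_algebraMap,
    algebraMap_smul_vec, mul_one]

theorem tvec_eq_zero_left {a : ℕ} (h : ¬ (lo ≤ a ∧ a ≤ hi)) (b : ℕ) (s : k) :
    tvec lo hi hi' a b s = 0 := by
  rw [tvec_eq, vec_eq_zero h, zero_ctmul]; rfl

theorem tvec_eq_zero_right {b : ℕ} (h : ¬ (2 ≤ b ∧ b ≤ hi')) (a : ℕ) (s : k) :
    tvec lo hi hi' a b s = 0 := by
  rw [tvec_eq, vec_eq_zero h, ctmul_zero]; rfl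

/-- Both sides arise from `m_a ε ⊗ m_b = m_a ⊗ ε m_b`. If `m_{a-1}` or `m_{b+1}` is absent, the
relation says that the other side vanishes; this is how the ends of the strings enter. -/
theorem tvec_pred {a b : ℕ} (ha : a % 2 = 0) (h0 : a ≠ 0) (h1 : a ≤ hi) (hb : b % 2 = 0)
    (hb' : 2 ≤ b) (s : k) : tvec lo hi hi' (a - 1) b s = tvec lo hi hi' a (b + 1) s := by
  rw [tvec_eq, tvec_eq, ← eps_smul_vec_even ha h0 h1, ctmul_balanced, leftAction_eps_vec_even hb hb']

/-- An odd `m_b` with `b ≥ 3` is `ε m_{b-1}`; moving `ε` across the tensor sign lets it act on `m_a`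
from the right, which gives zero. The string on the right has no `m_1`. -/
theorem tvec_odd {a b : ℕ} (ha : a % 2 = 1) (hb : b % 2 = 1) (s : k) :
    tvec lo hi hi' a b s = 0 := by
  by_cases h : 2 ≤ b
  · obtain ⟨c, rfl⟩ : ∃ c, b = c + 1 := ⟨b - 1, by omega⟩
    rw [tvec_eq, ← leftAction_eps_vec_even (by omega) (by omega), ← ctmul_balanced,
      eps_smul_vec_odd ha, zero_ctmul]
    rfl
  · exact tvec_eq_zero_right (fun h' => h h'.1) a s

theorem algebraMap_smul_tvec (c : k) (a b : ℕ) (s : k) :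
    algebraMap k k[ε] c • tvec lo hi hi' a b s = tvec lo hi hi' a b (c * s) := by
  refine (smul_ctmul _ _ _ _ _).trans ?_
  rw [algebraMap_smul_vec, ctmul_vec, mul_one]

theorem eps_smul_tvec_odd (a : ℕ) {b : ℕ} (hb : b % 2 = 1) (s : k) :
    (ε : k[ε]) • tvec lo hi hi' a b s = 0 := by
  refine (smul_ctmul _ _ _ _ _).trans ?_
  rw [eps_smul_vec_odd hb, ctmul_zero]
  rfl

theorem eps_smul_tvec_even (a : ℕ) {b : ℕ} (hb : b % 2 = 0) (h0 : b ≠ 0) (h1 : b ≤ hi') (s : k) :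
    (ε : k[ε]) • tvec lo hi hi' a b s = tvec lo hi hi' a (b - 1) s := by
  refine (smul_ctmul _ _ _ _ _).trans ?_
  rw [eps_smul_vec_even hb h0 h1]
  rfl

theorem leftAction_tvec (d : k[ε]) (a b : ℕ) (s : k) :
    (strTensor k lo hi hi').leftAction d (tvec lo hi hi' a b s) =
      (stringOn k lo hi).ctmul ((stringOn k lo hi).leftAction d (vec lo hi a s))
        (vec 2 hi' b 1) := rfl

theorem leftAction_eps_tvec_odd {a : ℕ} (ha : a % 2 = 1) (b : ℕ) (s : k) :
    (strTensor k lo hi hi').leftAction ε (tvec lo hi hi' a b s) = 0 := by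
  rw [leftAction_tvec, leftAction_eps_vec_odd ha, zero_ctmul]
  rfl

theorem leftAction_eps_tvec_even {a : ℕ} (ha : a % 2 = 0) (h : lo ≤ a) (b : ℕ) (s : k) :
    (strTensor k lo hi hi').leftAction ε (tvec lo hi hi' a b s) = tvec lo hi hi' (a + 1) b s := by
  rw [leftAction_tvec, leftAction_eps_vec_even ha h]
  rfl

theorem tensor_hom_ext {P : Type*} [AddCommMonoid P]
    {f g : (strTensor k lo hi hi').carrier →+ P}
    (h : ∀ a b s, lo ≤ a → a ≤ hi → 2 ≤ b → b ≤ hi' →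
      f (tvec lo hi hi' a b s) = g (tvec lo hi hi' a b s)) : f = g := by
  refine (stringOn k lo hi).comp_hom_ext (stringOn k 2 hi') fun v w => ?_
  let F : ((strTensor k lo hi hi').carrier →+ P) → (stringOn k lo hi).carrier →+
      (stringOn k 2 hi').carrier →+ P := fun f =>
    { toFun := fun v =>
        { toFun := fun w => f ((stringOn k lo hi).ctmul v w)
          map_zero' := by rw [ctmul_zero]; exact map_zero f
          map_add' := fun w w' => by rw [ctmul_add]; exact map_add f _ _ }
      map_zero' := by ext w; exact (congrArg f (zero_ctmul _ _ _)).trans (map_zero f)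
      map_add' := fun v v' => by
        ext w; exact (congrArg f (add_ctmul _ _ _ _ _)).trans (map_add f _ _) }
  have hF : F f = F g := str_hom_ext fun a s ha ha' => str_hom_ext fun b t hb hb' => by
    change f ((stringOn k lo hi).ctmul _ _) = g ((stringOn k lo hi).ctmul _ _)
    rw [ctmul_vec]
    exact h a b _ ha ha' hb hb'
  exact DFunLike.congr_fun (DFunLike.congr_fun hF v) w

/-- The biadditive map of strings with given values on pairs of basis vectors. -/
def strLift₂ {P : Type*} [AddCommMonoid P] (φ : ℕ → ℕ → k →+ P) :
    (stringOn k lo hi).carrier →+ (stringOn k 2 hi').carrier →+ P :=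
  strLift fun a =>
    { toFun := fun s => strLift fun b => (φ a b).comp (AddMonoidHom.mulRight s)
      map_zero' := str_hom_ext fun b t hb hb' => by
        rw [strLift_vec _ ⟨hb, hb'⟩]
        change φ a b (t * 0) = 0
        rw [mul_zero, map_zero]
      map_add' := fun s s' => str_hom_ext fun b t hb hb' => by
        rw [AddMonoidHom.add_apply, strLift_vec _ ⟨hb, hb'⟩, strLift_vec _ ⟨hb, hb'⟩,
          strLift_vec _ ⟨hb, hb'⟩]
        change φ a b (t * (s + s')) = φ a b (t * s) + φ a b (t * s')
        rw [mul_add, map_add] }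

theorem strLift₂_vec {P : Type*} [AddCommMonoid P] (φ : ℕ → ℕ → k →+ P) {a b : ℕ}
    (ha : lo ≤ a ∧ a ≤ hi) (hb : 2 ≤ b ∧ b ≤ hi') (s t : k) :
    strLift₂ φ (vec lo hi a s) (vec 2 hi' b t) = φ a b (t * s) := by
  unfold strLift₂
  rw [strLift_vec _ ha]
  exact strLift_vec _ hb _

/-- Compatibility of prescribed values on pairs of basis vectors with the relations of the tensor
product of strings. -/
structure TensorCompatible {P : Type*} [AddCommMonoid P] (lo hi hi' : ℕ) (φ : ℕ → ℕ → k →+ P) :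
    Prop where
  pred : ∀ a b s, a % 2 = 0 → b % 2 = 0 → lo ≤ a - 1 → a ≤ hi → 2 ≤ b → b + 1 ≤ hi' →
    φ (a - 1) b s = φ a (b + 1) s
  -- With `lo` even, the partner `m_{lo-1} ⊗ m_b` of this pair is absent, so the relation becomes a
  -- vanishing condition. The field `high` is the same at the other end, where `m_{hi'+1}` is
  -- absent.
  low : ∀ b s, lo % 2 = 0 → b % 2 = 0 → 2 ≤ b → b + 1 ≤ hi' → φ lo (b + 1) s = 0
  high : ∀ a s, hi' % 2 = 0 → a % 2 = 0 → lo ≤ a - 1 → a ≤ hi → φ (a - 1) hi' s = 0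
  odd : ∀ a b s, a % 2 = 1 → b % 2 = 1 → φ a b s = 0

/-- The additive map out of a tensor product of strings with given values. -/
def tensorLift {P : Type*} [AddCommMonoid P] (φ : ℕ → ℕ → k →+ P) (hlo : 1 ≤ lo)
    (hφ : TensorCompatible lo hi hi' φ) : (strTensor k lo hi hi').carrier →+ P :=
  (stringOn k lo hi).compLift (stringOn k 2 hi') (strLift₂ φ) (by
    refine balanced_of_eps _ (fun c v w => ?_) fun v w => ?_
    · let f₁ : (stringOn k lo hi).carrier →+ (stringOn k 2 hi').carrier →+ P :=
        (strLift₂ φ).comp (DistribSMul.toAddMonoidHom _ (algebraMap k k[ε] c))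
      let f₂ : (stringOn k lo hi).carrier →+ (stringOn k 2 hi').carrier →+ P :=
        (AddMonoidHom.compHom'
          (DistribSMul.toAddMonoidHom _ (algebraMap k k[ε] c))).comp (strLift₂ φ)
      have h : f₁ = f₂ := str_hom_ext fun a s ha ha' => str_hom_ext fun b t hb hb' => by
        change strLift₂ φ (algebraMap k k[ε] c • vec lo hi a s) (vec 2 hi' b t) =
          strLift₂ φ (vec lo hi a s) (algebraMap k k[ε] c • vec 2 hi' b t)
        rw [algebraMap_smul_vec, algebraMap_smul_vec, strLift₂_vec φ ⟨ha, ha'⟩ ⟨hb, hb'⟩,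
          strLift₂_vec φ ⟨ha, ha'⟩ ⟨hb, hb'⟩, mul_left_comm, mul_assoc]
      exact DFunLike.congr_fun (DFunLike.congr_fun h v) w
    · let f₁ : (stringOn k lo hi).carrier →+ (stringOn k 2 hi').carrier →+ P :=
        (strLift₂ φ).comp (DistribSMul.toAddMonoidHom _ (ε : k[ε]))
      let f₂ : (stringOn k lo hi).carrier →+ (stringOn k 2 hi').carrier →+ P :=
        (AddMonoidHom.compHom'
          ((stringOn k 2 hi').leftAction ε).toAddMonoidHom).comp (strLift₂ φ)
      have h : f₁ = f₂ := str_hom_ext fun a s ha ha' => str_hom_ext fun b t hb hb' => by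
        change strLift₂ φ ((ε : k[ε]) • vec lo hi a s) (vec 2 hi' b t) =
          strLift₂ φ (vec lo hi a s) ((stringOn k 2 hi').leftAction ε (vec 2 hi' b t))
        rcases Nat.mod_two_eq_zero_or_one a with h1 | h1 <;>
          rcases Nat.mod_two_eq_zero_or_one b with h2 | h2
        · rw [eps_smul_vec_even h1 (by omega) ha', leftAction_eps_vec_even h2 hb]
          -- The only substantial parity case. According to which of `m_{a-1}` and `m_{b+1}` are
          -- present, the identity is `pred`, `high`, `low` or `0 = 0`.
          by_cases h3 : lo ≤ a - 1 <;> by_cases h4 : b + 1 ≤ hi'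
          · rw [strLift₂_vec φ ⟨h3, by omega⟩ ⟨hb, hb'⟩, strLift₂_vec φ ⟨ha, ha'⟩ ⟨by omega, h4⟩]
            exact hφ.pred a b _ h1 h2 h3 ha' hb h4
          · obtain rfl : b = hi' := by omega
            rw [strLift₂_vec φ ⟨h3, by omega⟩ ⟨hb, hb'⟩, hφ.high a _ h2 h1 h3 ha',
              vec_eq_zero (fun h => h4 h.2), map_zero]
          · obtain rfl : a = lo := by omega
            rw [strLift₂_vec φ ⟨ha, ha'⟩ ⟨by omega, h4⟩, hφ.low b _ h1 h2 hb h4,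
              vec_eq_zero (fun h => h3 h.1), map_zero, AddMonoidHom.zero_apply]
          · rw [vec_eq_zero (fun h => h3 h.1), vec_eq_zero (fun h => h4 h.2), map_zero, map_zero,
              AddMonoidHom.zero_apply]
        · rw [eps_smul_vec_even h1 (by omega) ha', leftAction_eps_vec_odd h2, map_zero]
          by_cases h3 : lo ≤ a - 1
          · rw [strLift₂_vec φ ⟨h3, by omega⟩ ⟨hb, hb'⟩]
            exact hφ.odd _ _ _ (by omega) h2
          · rw [vec_eq_zero (fun h => h3 h.1), map_zero, AddMonoidHom.zero_apply]
        · rw [eps_smul_vec_odd h1, leftAction_eps_vec_even h2 hb, map_zero, AddMonoidHom.zero_apply]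
          by_cases h4 : b + 1 ≤ hi'
          · rw [strLift₂_vec φ ⟨ha, ha'⟩ ⟨by omega, h4⟩]
            exact (hφ.odd _ _ _ h1 (by omega)).symm
          · rw [vec_eq_zero (fun h => h4 h.2), map_zero]
        · rw [eps_smul_vec_odd h1, leftAction_eps_vec_odd h2, map_zero, map_zero,
            AddMonoidHom.zero_apply]
      exact DFunLike.congr_fun (DFunLike.congr_fun h v) w)

theorem tensorLift_tvec {P : Type*} [AddCommMonoid P] (φ : ℕ → ℕ → k →+ P) (hlo : 1 ≤ lo)
    (hφ : TensorCompatible lo hi hi' φ) {a b : ℕ} (ha : lo ≤ a ∧ a ≤ hi) (hb : 2 ≤ b ∧ b ≤ hi')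
    (s : k) : tensorLift φ hlo hφ (tvec lo hi hi' a b s) = φ a b s := by
  refine (strLift₂_vec φ ha hb s 1).trans ?_
  rw [one_mul]

end Tensor

end DualBimodule

namespace DualBimodule

variable {k : Type u} [Field k]

/-! ### Constructing homomorphisms from values on basis vectors -/

section Builders

variable {lo hi hi' : ℕ}

/-- A homomorphism out of a string, checked on multiples of basis vectors. -/
def Hom.ofString {C : DualBimodule k} (f : (stringOn k lo hi).carrier →+ C.carrier)
    (hk : ∀ (c : k) a s, lo ≤ a → a ≤ hi →
      f (vec lo hi a (c * s)) = algebraMap k k[ε] c • f (vec lo hi a s))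
    (hr : ∀ a s, lo ≤ a → a ≤ hi →
      f ((ε : k[ε]) • vec lo hi a s) = (ε : k[ε]) • f (vec lo hi a s))
    (hl : ∀ a s, lo ≤ a → a ≤ hi →
      f ((stringOn k lo hi).leftAction ε (vec lo hi a s)) = C.leftAction ε (f (vec lo hi a s))) :
    Hom (stringOn k lo hi) C :=
  Hom.ofAdd f
    (fun c => DFunLike.congr_fun (str_hom_ext
      (f := f.comp (DistribSMul.toAddMonoidHom _ (algebraMap k k[ε] c)))
      (g := (DistribSMul.toAddMonoidHom _ (algebraMap k k[ε] c)).comp f)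
      fun a s h h' => (congrArg f (algebraMap_smul_vec c a s)).trans (hk c a s h h')))
    (DFunLike.congr_fun (str_hom_ext
      (f := f.comp (DistribSMul.toAddMonoidHom _ (ε : k[ε])))
      (g := (DistribSMul.toAddMonoidHom _ (ε : k[ε])).comp f) hr))
    (DFunLike.congr_fun (str_hom_ext
      (f := f.comp ((stringOn k lo hi).leftAction ε).toAddMonoidHom)
      (g := ((C.leftAction ε).toAddMonoidHom).comp f) hl))

/-- A homomorphism out of a tensor product of strings, checked on multiples of pairs of basis
vectors. -/
def Hom.ofTensor {C : DualBimodule k} (f : (strTensor k lo hi hi').carrier →+ C.carrier)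
    (hk : ∀ (c : k) a b s, lo ≤ a → a ≤ hi → 2 ≤ b → b ≤ hi' →
      f (tvec lo hi hi' a b (c * s)) = algebraMap k k[ε] c • f (tvec lo hi hi' a b s))
    (hr : ∀ a b s, lo ≤ a → a ≤ hi → 2 ≤ b → b ≤ hi' →
      f ((ε : k[ε]) • tvec lo hi hi' a b s) = (ε : k[ε]) • f (tvec lo hi hi' a b s))
    (hl : ∀ a b s, lo ≤ a → a ≤ hi → 2 ≤ b → b ≤ hi' →
      f ((strTensor k lo hi hi').leftAction ε (tvec lo hi hi' a b s)) =
        C.leftAction ε (f (tvec lo hi hi' a b s))) :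
    Hom (strTensor k lo hi hi') C :=
  Hom.ofAdd f
    (fun c => DFunLike.congr_fun (tensor_hom_ext
      (f := f.comp (DistribSMul.toAddMonoidHom _ (algebraMap k k[ε] c)))
      (g := (DistribSMul.toAddMonoidHom _ (algebraMap k k[ε] c)).comp f)
      fun a b s h h' g g' =>
        (congrArg f (algebraMap_smul_tvec c a b s)).trans (hk c a b s h h' g g')))
    (DFunLike.congr_fun (tensor_hom_ext
      (f := f.comp (DistribSMul.toAddMonoidHom _ (ε : k[ε])))
      (g := (DistribSMul.toAddMonoidHom _ (ε : k[ε])).comp f) hr))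
    (DFunLike.congr_fun (tensor_hom_ext
      (f := f.comp ((strTensor k lo hi hi').leftAction ε).toAddMonoidHom)
      (g := ((C.leftAction ε).toAddMonoidHom).comp f) hl))

theorem Hom.ext_string {C : DualBimodule k} {f g : Hom (stringOn k lo hi) C}
    (h : ∀ a s, lo ≤ a → a ≤ hi → f.lin (vec lo hi a s) = g.lin (vec lo hi a s)) : f = g := by
  apply Hom.ext
  apply LinearMap.toAddMonoidHom_injective
  exact str_hom_ext h

theorem Hom.ext_tensor {C : DualBimodule k} {f g : Hom (strTensor k lo hi hi') C}
    (h : ∀ a b s, lo ≤ a → a ≤ hi → 2 ≤ b → b ≤ hi' →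
      f.lin (tvec lo hi hi' a b s) = g.lin (tvec lo hi hi' a b s)) : f = g := by
  apply Hom.ext
  apply LinearMap.toAddMonoidHom_injective
  exact tensor_hom_ext h

end Builders

/-! ### The degree decomposition of a product of strings and its diagonal part -/

section Diagonal

variable {lo hi hi' : ℕ} {n : ℕ}

/-- The bounds on the ends of a string with `n` valleys. -/
structure StringEnds (n lo hi : ℕ) : Prop where
  one_le : 1 ≤ lo
  le_two : lo ≤ 2
  le_hi : 2 * n + 2 ≤ hi
  hi_le : hi ≤ 2 * n + 3

/-- The images of the basis vectors under the diagonal embedding. -/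
def diagVal (lo hi hi' a : ℕ) : k →+ (strTensor k lo hi hi').carrier :=
  if a % 2 = 0 then tvec lo hi hi' a a else tvec lo hi hi' a (a - 1)

theorem diagVal_even {a : ℕ} (h : a % 2 = 0) (s : k) :
    diagVal lo hi hi' a s = tvec lo hi hi' a a s := by rw [diagVal, if_pos h]

theorem diagVal_odd {a : ℕ} (h : a % 2 = 1) (s : k) :
    diagVal lo hi hi' a s = tvec lo hi hi' a (a - 1) s := by rw [diagVal, if_neg (by omega)]

/-- The diagonal embedding of the string `m_2, …, m_hi` in the tensor product. -/
def diag (e : StringEnds n lo hi) (e' : StringEnds n 2 hi') :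
    Hom (stringOn k 2 hi) (strTensor k lo hi hi') :=
  Hom.ofString (strLift (diagVal lo hi hi'))
    (fun c a s h h' => by
      rw [strLift_vec _ ⟨h, h'⟩, strLift_vec _ ⟨h, h'⟩]
      unfold diagVal
      split_ifs <;> rw [algebraMap_smul_tvec])
    (fun a s h h' => by
      have := e.hi_le
      have := e'.le_hi
      rw [strLift_vec _ ⟨h, h'⟩]
      rcases Nat.mod_two_eq_zero_or_one a with ha | ha
      · rw [eps_smul_vec_even ha (by omega) h', diagVal_even ha,
          eps_smul_tvec_even a ha (by omega) (by omega)]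
        by_cases h2 : a = 2
        · rw [vec_eq_zero (by omega), map_zero, tvec_eq_zero_right (by omega)]
        · rw [strLift_vec _ (by omega), diagVal_odd (by omega)]
          -- The required identity is `m_{a-1} ⊗ m_{a-2} = m_a ⊗ m_{a-1}`, an instance of the basic
          -- relation.
          obtain ⟨b, rfl⟩ : ∃ b, a = b + 2 := ⟨a - 2, by omega⟩
          exact tvec_pred (a := b + 2) (b := b) ha (by omega) h' (by omega) (by omega) s
      · rw [eps_smul_vec_odd ha, map_zero, diagVal_odd ha,
          eps_smul_tvec_even a (by omega) (by omega) (by omega), tvec_odd ha (by omega)])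
    (fun a s h h' => by
      have := e.le_two
      rw [strLift_vec _ ⟨h, h'⟩]
      rcases Nat.mod_two_eq_zero_or_one a with ha | ha
      · rw [leftAction_eps_vec_even ha h, diagVal_even ha,
          leftAction_eps_tvec_even ha (by omega)]
        by_cases h2 : a + 1 ≤ hi
        · rw [strLift_vec _ (by omega), diagVal_odd (by omega), Nat.add_sub_cancel]
        · rw [vec_eq_zero (by omega), map_zero, tvec_eq_zero_left (by omega)]
      · rw [leftAction_eps_vec_odd ha, map_zero, diagVal_odd ha, leftAction_eps_tvec_odd ha])

theorem diag_vec (e : StringEnds n lo hi) (e' : StringEnds n 2 hi') {a : ℕ} (h : 2 ≤ a)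
    (h' : a ≤ hi) (s : k) : (diag e e').lin (vec 2 hi a s) = diagVal lo hi hi' a s :=
  strLift_vec _ ⟨h, h'⟩ s

/-- The images of pairs of basis vectors under the retraction of the diagonal embedding. -/
def codiagVal (hi a b : ℕ) : k →+ (stringOn k 2 hi).carrier :=
  if (a = b ∧ a % 2 = 0) ∨ (a = b + 1 ∧ b % 2 = 0) then vec 2 hi a
  else if a = b + 1 then vec 2 hi b else 0

theorem codiagVal_fst {a b : ℕ} (h : (a = b ∧ a % 2 = 0) ∨ (a = b + 1 ∧ b % 2 = 0)) (s : k) :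
    codiagVal hi a b s = vec 2 hi a s := by rw [codiagVal, if_pos h]

theorem codiagVal_snd {a b : ℕ} (h : a = b + 1) (hb : b % 2 = 1) (s : k) :
    codiagVal hi a b s = vec 2 hi b s := by
  rw [codiagVal, if_neg (by omega), if_pos h]

theorem codiagVal_eq_zero {a b : ℕ} (h : ¬ (a = b ∧ a % 2 = 0)) (h' : a ≠ b + 1) (s : k) :
    codiagVal hi a b s = 0 := by
  rw [codiagVal, if_neg (by omega), if_neg h', AddMonoidHom.zero_apply]

/-- For `b` even, the two expressions `m_{b+1} ⊗ m_b` and `m_{b+2} ⊗ m_{b+1}` of the same element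
both go to `m_{b+1}`. The pairs in the vanishing conditions at the ends have first index smaller
than the second, so they go to zero; at the upper end this uses that both strings have the same
number of valleys. -/
theorem codiag_compatible (e : StringEnds n lo hi) (e' : StringEnds n 2 hi') :
    TensorCompatible lo hi hi' (codiagVal (k := k) hi) where
  pred a b s ha hb h1 h2 h3 h4 := by
    have := e.one_le
    by_cases h : a = b + 2
    · rw [codiagVal_fst (by omega), codiagVal_snd (by omega) (by omega)]
      congr 2
      omega
    · rw [codiagVal_eq_zero (by omega) (by omega), codiagVal_eq_zero (by omega) (by omega)]
  low b s h1 h2 h3 h4 := by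
    have := e.le_two
    exact codiagVal_eq_zero (by omega) (by omega) s
  high a s h1 h2 h3 h4 := by
    have := e.one_le
    have := e.hi_le
    have := e'.le_hi
    exact codiagVal_eq_zero (by omega) (by omega) s
  odd a b s h1 h2 := codiagVal_eq_zero (by omega) (by omega) s

/-- The retraction of the diagonal embedding. -/
def codiag (e : StringEnds n lo hi) (e' : StringEnds n 2 hi') :
    Hom (strTensor k lo hi hi') (stringOn k 2 hi) :=
  Hom.ofTensor (tensorLift _ e.one_le (codiag_compatible e e'))
    (fun c a b s h h' g g' => by
      rw [tensorLift_tvec _ _ _ ⟨h, h'⟩ ⟨g, g'⟩, tensorLift_tvec _ _ _ ⟨h, h'⟩ ⟨g, g'⟩]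
      unfold codiagVal
      split_ifs
      · rw [algebraMap_smul_vec]
      · rw [algebraMap_smul_vec]
      · rw [AddMonoidHom.zero_apply, AddMonoidHom.zero_apply, smul_zero])
    (fun a b s h h' g g' => by
      rw [tensorLift_tvec _ _ _ ⟨h, h'⟩ ⟨g, g'⟩]
      rcases Nat.mod_two_eq_zero_or_one b with hb | hb
      · rw [eps_smul_tvec_even a hb (by omega) g']
        have h1 : tensorLift _ e.one_le (codiag_compatible e e')
            (tvec lo hi hi' a (b - 1) s) = if b = 2 then 0 else codiagVal hi a (b - 1) s := by
          split_ifs with h2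
          · rw [tvec_eq_zero_right (by omega), map_zero]
          · rw [tensorLift_tvec _ _ _ ⟨h, h'⟩ (by omega)]
        rw [h1]
        by_cases hab : a = b
        · subst hab
          rw [codiagVal_fst (a := a) (b := a) (by omega), eps_smul_vec_even hb (by omega) h']
          split_ifs with h2
          · rw [vec_eq_zero (by omega)]
          · rw [codiagVal_snd (by omega) (by omega)]
        · have h3 : (if b = 2 then 0 else codiagVal hi a (b - 1) s) =
              (0 : (stringOn k 2 hi).carrier) := by
            split_ifs
            · rfl
            · exact codiagVal_eq_zero (by omega) (by omega) s
          rw [h3]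
          by_cases hab' : a = b + 1
          · rw [codiagVal_fst (by omega), eps_smul_vec_odd (by omega)]
          · rw [codiagVal_eq_zero (by omega) (by omega), smul_zero]
      · rw [eps_smul_tvec_odd a hb, map_zero]
        by_cases hab' : a = b + 1
        · rw [codiagVal_snd hab' hb, eps_smul_vec_odd hb]
        · rw [codiagVal_eq_zero (by omega) (by omega), smul_zero])
    (fun a b s h h' g g' => by
      have := e.one_le
      rw [tensorLift_tvec _ _ _ ⟨h, h'⟩ ⟨g, g'⟩]
      rcases Nat.mod_two_eq_zero_or_one a with ha | ha
      · rw [leftAction_eps_tvec_even ha h]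
        have h1 : tensorLift _ e.one_le (codiag_compatible e e')
            (tvec lo hi hi' (a + 1) b s) = if a + 1 ≤ hi then codiagVal hi (a + 1) b s else 0 := by
          split_ifs with h2
          · rw [tensorLift_tvec _ _ _ (by omega) ⟨g, g'⟩]
          · rw [tvec_eq_zero_left (by omega), map_zero]
        rw [h1]
        by_cases hab : a = b
        · subst hab
          rw [codiagVal_fst (a := a) (b := a) (by omega), leftAction_eps_vec_even ha g]
          split_ifs with h2
          · rw [codiagVal_fst (by omega)]
          · rw [vec_eq_zero (by omega)]
        · have h3 : (if a + 1 ≤ hi then codiagVal hi (a + 1) b s else 0) =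
              (0 : (stringOn k 2 hi).carrier) := by
            split_ifs
            · exact codiagVal_eq_zero (by omega) (by omega) s
            · rfl
          rw [h3]
          by_cases hab' : a = b + 1
          · rw [codiagVal_snd hab' (by omega), leftAction_eps_vec_odd (by omega)]
          · rw [codiagVal_eq_zero (by omega) (by omega), map_zero]
      · rw [leftAction_eps_tvec_odd ha, map_zero]
        by_cases hab' : a = b + 1
        · rw [codiagVal_fst (by omega), leftAction_eps_vec_odd ha]
        · rw [codiagVal_eq_zero (by omega) (by omega), map_zero])

theorem codiag_tvec (e : StringEnds n lo hi) (e' : StringEnds n 2 hi') {a b : ℕ}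
    (ha : lo ≤ a ∧ a ≤ hi) (hb : 2 ≤ b ∧ b ≤ hi') (s : k) :
    (codiag e e').lin (tvec lo hi hi' a b s) = codiagVal hi a b s :=
  tensorLift_tvec _ e.one_le (codiag_compatible e e') ha hb s

theorem diag_comp_codiag (e : StringEnds n lo hi) (e' : StringEnds n 2 hi') :
    (diag e e').comp (codiag e e') = Hom.id (stringOn k 2 hi) := by
  have := e.le_two
  have := e.hi_le
  have := e'.le_hi
  refine Hom.ext_string fun a s h h' => ?_
  change (codiag e e').lin ((diag e e').lin _) = vec 2 hi a s
  rw [diag_vec e e' h h']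
  rcases Nat.mod_two_eq_zero_or_one a with ha | ha
  · rw [diagVal_even ha, codiag_tvec e e' (by omega) (by omega), codiagVal_fst (by omega)]
  · rw [diagVal_odd ha, codiag_tvec e e' (by omega) (by omega), codiagVal_fst (by omega)]

/-- The value of the projection to degree `d` on pairs of basis vectors. -/
def gradeVal (lo hi hi' : ℕ) (d : ℤ) (a b : ℕ) : k →+ (strTensor k lo hi hi').carrier :=
  if ((a : ℤ) - b) / 2 = d then tvec lo hi hi' a b else 0

theorem gradeVal_pos {d : ℤ} {a b : ℕ} (h : ((a : ℤ) - b) / 2 = d) (s : k) :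
    gradeVal lo hi hi' d a b s = tvec lo hi hi' a b s := by rw [gradeVal, if_pos h]

theorem gradeVal_neg {d : ℤ} {a b : ℕ} (h : ((a : ℤ) - b) / 2 ≠ d) (s : k) :
    gradeVal lo hi hi' d a b s = 0 := by rw [gradeVal, if_neg h, AddMonoidHom.zero_apply]

theorem gradeVal_eq_zero {d : ℤ} {a b : ℕ} {s : k} (h : tvec lo hi hi' a b s = 0) :
    gradeVal lo hi hi' d a b s = 0 := by
  by_cases hd : ((a : ℤ) - b) / 2 = d
  · rw [gradeVal_pos hd, h]
  · exact gradeVal_neg hd s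

/-- The quotient is rounded down, so for `a`, `b` even the equal elements `m_{a-1} ⊗ m_b` and `m_a ⊗
m_{b+1}` both get degree `(a-b)/2 - 1`. For the same reason both actions of `ε` preserve the degree:
raising an even `a` by 1, or lowering an even `b` by 1, does not change it when the other index is
even. -/
theorem grade_compatible (hlo : 1 ≤ lo) (d : ℤ) :
    TensorCompatible lo hi hi' (gradeVal (k := k) lo hi hi' d) where
  pred a b s ha hb h1 h2 h3 h4 := by
    by_cases hd : ((a : ℤ) - (b + 1 : ℕ)) / 2 = d
    · rw [gradeVal_pos (by omega), gradeVal_pos hd, tvec_pred ha (by omega) h2 hb h3]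
    · rw [gradeVal_neg (by omega), gradeVal_neg hd]
  low b s h1 h2 h3 h4 := by
    apply gradeVal_eq_zero
    by_cases h : lo ≤ hi
    · rw [← tvec_pred h1 (by omega) h h2 h3, tvec_eq_zero_left (by omega)]
    · exact tvec_eq_zero_left (by omega) _ _
  high a s h1 h2 h3 h4 := by
    apply gradeVal_eq_zero
    by_cases h : 2 ≤ hi'
    · rw [tvec_pred h2 (by omega) h4 h1 h, tvec_eq_zero_right (by omega)]
    · exact tvec_eq_zero_right (by omega) _ _
  odd a b s h1 h2 := gradeVal_eq_zero (tvec_odd h1 h2 s)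

/-- No bounds on `a` and `b`, since outside the range both sides vanish; the actions of `ε` can then
be applied without watching the ends. -/
theorem tensorLift_gradeVal (hlo : 1 ≤ lo) (d : ℤ) (a b : ℕ) (s : k) :
    tensorLift (gradeVal lo hi hi' d) hlo (grade_compatible hlo d) (tvec lo hi hi' a b s) =
      gradeVal lo hi hi' d a b s := by
  by_cases ha : lo ≤ a ∧ a ≤ hi
  · by_cases hb : 2 ≤ b ∧ b ≤ hi'
    · exact tensorLift_tvec _ _ _ ha hb s
    · rw [tvec_eq_zero_right hb, map_zero, gradeVal_eq_zero (tvec_eq_zero_right hb _ _)]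
  · rw [tvec_eq_zero_left ha, map_zero, gradeVal_eq_zero (tvec_eq_zero_left ha _ _)]

variable (lo hi hi') in
/-- The projection of the tensor product of two strings to the part of degree `d`. -/
def grade (hlo : 1 ≤ lo) (d : ℤ) : Hom (strTensor k lo hi hi') (strTensor k lo hi hi') :=
  Hom.ofTensor (tensorLift _ hlo (grade_compatible hlo d))
    (fun c a b s h h' g g' => by
      rw [tensorLift_gradeVal, tensorLift_gradeVal]
      unfold gradeVal
      split_ifs
      · rw [algebraMap_smul_tvec]
      · rw [AddMonoidHom.zero_apply, AddMonoidHom.zero_apply, smul_zero])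
    (fun a b s h h' g g' => by
      rw [tensorLift_gradeVal]
      rcases Nat.mod_two_eq_zero_or_one b with hb | hb
      · rw [eps_smul_tvec_even a hb (by omega) g', tensorLift_gradeVal]
        rcases Nat.mod_two_eq_zero_or_one a with ha | ha
        · by_cases hd : ((a : ℤ) - b) / 2 = d
          · rw [gradeVal_pos hd, gradeVal_pos (by omega),
              eps_smul_tvec_even a hb (by omega) g']
          · rw [gradeVal_neg hd, gradeVal_neg (by omega), smul_zero]
        · rw [gradeVal_eq_zero (tvec_odd ha (by omega) s)]
          by_cases hd : ((a : ℤ) - b) / 2 = d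
          · rw [gradeVal_pos hd, eps_smul_tvec_even a hb (by omega) g', tvec_odd ha (by omega)]
          · rw [gradeVal_neg hd, smul_zero]
      · rw [eps_smul_tvec_odd a hb, map_zero]
        by_cases hd : ((a : ℤ) - b) / 2 = d
        · rw [gradeVal_pos hd, eps_smul_tvec_odd a hb]
        · rw [gradeVal_neg hd, smul_zero])
    (fun a b s h h' g g' => by
      rw [tensorLift_gradeVal]
      rcases Nat.mod_two_eq_zero_or_one a with ha | ha
      · rw [leftAction_eps_tvec_even ha h, tensorLift_gradeVal]
        rcases Nat.mod_two_eq_zero_or_one b with hb | hb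
        · by_cases hd : ((a : ℤ) - b) / 2 = d
          · rw [gradeVal_pos hd, gradeVal_pos (by omega), leftAction_eps_tvec_even ha h]
          · rw [gradeVal_neg hd, gradeVal_neg (by omega), map_zero]
        · rw [gradeVal_eq_zero (tvec_odd (by omega) hb s)]
          by_cases hd : ((a : ℤ) - b) / 2 = d
          · rw [gradeVal_pos hd, leftAction_eps_tvec_even ha h, tvec_odd (by omega) hb]
          · rw [gradeVal_neg hd, map_zero]
      · rw [leftAction_eps_tvec_odd ha, map_zero]
        by_cases hd : ((a : ℤ) - b) / 2 = d
        · rw [gradeVal_pos hd, leftAction_eps_tvec_odd ha]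
        · rw [gradeVal_neg hd, map_zero])

theorem grade_tvec (hlo : 1 ≤ lo) (d : ℤ) (a b : ℕ) (s : k) :
    (grade lo hi hi' hlo d).lin (tvec lo hi hi' a b s) = gradeVal lo hi hi' d a b s :=
  tensorLift_gradeVal hlo d a b s

theorem grade_comp_grade (hlo : 1 ≤ lo) (d : ℤ) :
    (grade (k := k) lo hi hi' hlo d).comp (grade lo hi hi' hlo d) = grade lo hi hi' hlo d := by
  refine Hom.ext_tensor fun a b s _ _ _ _ => ?_
  change (grade lo hi hi' hlo d).lin ((grade lo hi hi' hlo d).lin _) = _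
  rw [grade_tvec]
  by_cases hd : ((a : ℤ) - b) / 2 = d
  · rw [gradeVal_pos hd, grade_tvec, gradeVal_pos hd]
  · rw [gradeVal_neg hd, map_zero]

/-- The part of degree 0 is spanned by `m_a ⊗ m_a` with `a` even and by `m_{b+1} ⊗ m_b`, and these
are exactly the elements in the image of the diagonal embedding. -/
theorem codiag_comp_diag (e : StringEnds n lo hi) (e' : StringEnds n 2 hi') :
    (codiag e e').comp (diag (k := k) e e') = grade lo hi hi' e.one_le 0 := by
  refine Hom.ext_tensor fun a b s ha ha' hb hb' => ?_
  change (diag e e').lin ((codiag e e').lin _) = _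
  rw [codiag_tvec e e' ⟨ha, ha'⟩ ⟨hb, hb'⟩, grade_tvec]
  by_cases h0 : a = b ∧ a % 2 = 0
  · rw [codiagVal_fst (Or.inl h0), gradeVal_pos (by omega), diag_vec e e' (by omega) ha',
      diagVal_even h0.2, h0.1]
  by_cases h1 : a = b + 1
  · rcases Nat.mod_two_eq_zero_or_one b with h2 | h2
    · rw [codiagVal_fst (Or.inr ⟨h1, h2⟩), gradeVal_pos (by omega), diag_vec e e' (by omega) ha',
        diagVal_odd (by omega), h1, Nat.add_sub_cancel]
    · rw [codiagVal_snd h1 h2, gradeVal_pos (by omega), diag_vec e e' hb (by omega),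
        diagVal_odd h2]
      obtain ⟨c, rfl⟩ : ∃ c, b = c + 1 := ⟨b - 1, by omega⟩
      rw [h1]
      exact tvec_pred (a := c + 2) (b := c) (by omega) (by omega) (by omega) (by omega) (by omega) s
  · rw [codiagVal_eq_zero h0 h1, map_zero]
    rcases Nat.mod_two_eq_zero_or_one a with h2 | h2
    · rw [gradeVal_neg (by omega)]
    · rcases Nat.mod_two_eq_zero_or_one b with h3 | h3
      · rw [gradeVal_neg (by omega)]
      · rw [gradeVal_eq_zero (tvec_odd h2 h3 s)]

theorem sum_grade (e : StringEnds n lo hi) (e' : StringEnds n 2 hi')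
    (t : (strTensor k lo hi hi').carrier) :
    ∑ d ∈ Finset.Icc (-(n + 1 : ℤ)) (n + 1), (grade lo hi hi' e.one_le d).lin t = t := by
  have := e.one_le
  have := e.hi_le
  have := e'.hi_le
  have h : (∑ d ∈ Finset.Icc (-(n + 1 : ℤ)) (n + 1),
      ((grade (k := k) lo hi hi' e.one_le d).lin.toAddMonoidHom)) = AddMonoidHom.id _ := by
    refine tensor_hom_ext fun a b s ha ha' hb hb' => ?_
    rw [AddMonoidHom.finsetSum_apply, AddMonoidHom.id_apply, Finset.sum_eq_single (((a : ℤ) - b) / 2)]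
    · exact (grade_tvec e.one_le _ a b s).trans (gradeVal_pos rfl s)
    · intro d _ hd
      exact (grade_tvec e.one_le d a b s).trans (gradeVal_neg (Ne.symm hd) s)
    -- From `1 ≤ a ≤ 2n+3` and `2 ≤ b ≤ 2n+3` the degree lies between `-(n+1)` and `n`, so the
    -- summation range is large enough.
    · intro hd
      rw [Finset.mem_Icc] at hd
      omega
  have := DFunLike.congr_fun h t
  rwa [AddMonoidHom.finsetSum_apply] at this

/-- The quotient map of strings forgetting `m_1`. -/
def trunc (lo hi : ℕ) (h1 : 1 ≤ lo) (h2 : lo ≤ 2) : Hom (stringOn k lo hi) (stringOn k 2 hi) :=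
  Hom.ofString (strLift (vec 2 hi))
    (fun c a s h h' => by
      rw [strLift_vec _ ⟨h, h'⟩, strLift_vec _ ⟨h, h'⟩, algebraMap_smul_vec])
    (fun a s h h' => by
      rw [strLift_vec _ ⟨h, h'⟩]
      rcases Nat.mod_two_eq_zero_or_one a with ha | ha
      · rw [eps_smul_vec_even ha (by omega) h', eps_smul_vec_even ha (by omega) h']
        by_cases h3 : lo ≤ a - 1
        · rw [strLift_vec _ (by omega)]
        · rw [vec_eq_zero (by omega), map_zero, vec_eq_zero (by omega)]
      · rw [eps_smul_vec_odd ha, eps_smul_vec_odd ha, map_zero])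
    (fun a s h h' => by
      rw [strLift_vec _ ⟨h, h'⟩]
      rcases Nat.mod_two_eq_zero_or_one a with ha | ha
      · rw [leftAction_eps_vec_even ha h, leftAction_eps_vec_even ha (by omega)]
        by_cases h3 : a + 1 ≤ hi
        · rw [strLift_vec _ (by omega)]
        · rw [vec_eq_zero (by omega), map_zero, vec_eq_zero (by omega)]
      · rw [leftAction_eps_vec_odd ha, leftAction_eps_vec_odd ha, map_zero])

theorem trunc_vec (h1 : 1 ≤ lo) (h2 : lo ≤ 2) {a : ℕ} (h : lo ≤ a ∧ a ≤ hi) (s : k) :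
    (trunc lo hi h1 h2).lin (vec lo hi a s) = vec 2 hi a s := strLift_vec _ h s

end Diagonal

end DualBimodule

/-! ### The head of the value at the simple module -/

/-- The simple `D`-module. -/
def Residue (k : Type u) [Field k] : Type u := k

namespace Residue

variable (k : Type u) [Field k]

instance : AddCommGroup (Residue k) := inferInstanceAs (AddCommGroup k)

instance : Module k[ε] (Residue k) :=
  Module.compHom k (TrivSqZeroExt.fstHom k k k).toRingHom

/-- The generator of the simple module. -/
def gen : Residue k := (1 : k)

variable {k}

/-- The coordinate of an element of the simple module. -/
def val (x : Residue k) : k := x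

theorem smul_def (d : k[ε]) (x : Residue k) : d • x = (d.fst * x.val : k) := rfl

theorem smul_gen (x : Residue k) : algebraMap k k[ε] x.val • gen k = x := by
  rw [smul_def, TrivSqZeroExt.algebraMap_eq_inl]
  exact mul_one x.val

theorem eps_smul (x : Residue k) : (ε : k[ε]) • x = 0 := by
  rw [smul_def]
  exact zero_mul x.val

instance : Module.Finite k[ε] (Residue k) :=
  Module.Finite.of_surjective (LinearMap.toSpanSingleton k[ε] (Residue k) (gen k))
    fun x => ⟨algebraMap k k[ε] x.val, smul_gen x⟩

variable (k) in
/-- The simple module as an object of the category of finite-dimensional modules. -/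
abbrev obj : FGModuleCat.{u} k[ε] := FGModuleCat.of k[ε] (Residue k)

end Residue

namespace DualCat

variable {k : Type u} [Field k]

/-- The value of `F` at the simple module has at most `n` generators. -/
def HeadGen (n : ℕ) (F : DualCat k) : Prop :=
  ∃ s : Finset ((eval (Residue.obj k)).obj F), s.card ≤ n ∧
    Submodule.span k[ε] (s : Set ((eval (Residue.obj k)).obj F)) = ⊤

/-- The elements of `s` generate only a submodule containing the image of the idempotent `h.r ≫
h.i`, not the whole value of `F`; their images under `h.r` still generate the value of `G`. This
form suits the degree projections. -/
theorem headGen_of_forall_mem_span {n : ℕ} {F G : DualCat k} (h : Retract G F)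
    (s : Finset ((eval (Residue.obj k)).obj F)) (hs : s.card ≤ n)
    (hspan : ∀ t, ((eval (Residue.obj k)).map (h.r ≫ h.i)).hom.hom t ∈
      Submodule.span k[ε] (s : Set ((eval (Residue.obj k)).obj F))) : HeadGen n G := by
  classical
  let r := ((eval (Residue.obj k)).map h.r).hom.hom
  let i := ((eval (Residue.obj k)).map h.i).hom.hom
  have hri : ∀ x, r (i x) = x := fun x =>
    LinearMap.congr_fun (congrArg (fun f => f.hom.hom) (h.map (eval (Residue.obj k))).retract) x
  refine ⟨s.image r, Finset.card_image_le.trans hs, ?_⟩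
  rw [eq_top_iff]
  intro x _
  have h1 : i (r (i x)) ∈ Submodule.span k[ε] (s : Set ((eval (Residue.obj k)).obj F)) := by
    have h2 := hspan (i x)
    rw [Functor.map_comp] at h2
    exact h2
  have h3 := Submodule.mem_map_of_mem (f := r) h1
  rw [hri, hri, Submodule.map_span] at h3
  rwa [Finset.coe_image]

theorem HeadGen.of_retract {n : ℕ} {F G : DualCat k} (hF : HeadGen n F) (h : Retract G F) :
    HeadGen n G := by
  obtain ⟨s, hs, hs'⟩ := hF
  exact headGen_of_forall_mem_span h s hs fun t => by rw [hs']; exact Submodule.mem_top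

end DualCat

namespace DualBimodule

variable {k : Type u} [Field k]

/-! ### A string with `n` valleys needs `n + 1` generators at the simple module -/

section Lower

variable {n lo hi : ℕ}

/-- The coordinates of the even basis vectors of a string. -/
def evenCoord (e : StringEnds n lo hi) :
    (stringOn k lo hi).carrier →+ Residue k →+ (Fin (n + 1) → Residue k) where
  toFun v :=
    { toFun := fun c i => ((v : StringSpace k lo hi) ⟨2 * i.1 + 2, by
          have := e.le_two; omega, by have := e.le_hi; have := i.2; omega⟩ * c.val : k)
      map_zero' := by funext i; exact mul_zero (M₀ := k) _
      map_add' := fun c d => by funext i; exact mul_add (R := k) _ _ _ }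
  map_zero' := by ext c i; exact zero_mul (M₀ := k) _
  map_add' v w := by ext c i; exact add_mul (R := k) _ _ _

/-- Multiples of `ε` are supported on odd basis vectors, so on the even coordinates `D` acts through
its residue field. The same holds for the left action. -/
theorem evenCoord_smul (e : StringEnds n lo hi) (d : k[ε]) (v : (stringOn k lo hi).carrier)
    (c : Residue k) : evenCoord e (d • v) c = d • evenCoord e v c := by
  funext i
  let v' : StringSpace k lo hi := v
  let j : {j : ℕ // lo ≤ j ∧ j ≤ hi} := ⟨2 * i.1 + 2, by have := e.le_two; omega,
      by have := e.le_hi; have := i.2; omega⟩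
  have h : stringRight k lo hi v' j = 0 :=
    stringRight_even k lo hi v' j (by rw [Nat.odd_iff]; simp only [j]; omega)
  have key : (d.fst * v' j + d.snd * stringRight k lo hi v' j) * c.val =
      d.fst * (v' j * c.val) := by
    rw [h, mul_zero, add_zero, mul_assoc]
  exact key

theorem evenCoord_leftAction (e : StringEnds n lo hi) (d : k[ε]) (v : (stringOn k lo hi).carrier)
    (c : Residue k) :
    evenCoord e ((stringOn k lo hi).leftAction d v) c = d • evenCoord e v c := by
  funext i
  let v' : StringSpace k lo hi := v
  let j : {j : ℕ // lo ≤ j ∧ j ≤ hi} := ⟨2 * i.1 + 2, by have := e.le_two; omega,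
      by have := e.le_hi; have := i.2; omega⟩
  have h : stringLeft k lo hi v' j = 0 :=
    stringLeft_even k lo hi v' j (by rw [Nat.odd_iff]; simp only [j]; omega)
  have key : (d.fst * v' j + d.snd * stringLeft k lo hi v' j) * c.val =
      d.fst * (v' j * c.val) := by
    rw [h, mul_zero, add_zero, mul_assoc]
  exact key

theorem evenCoord_balanced (e : StringEnds n lo hi) (d : k[ε]) (v : (stringOn k lo hi).carrier)
    (c : Residue k) : evenCoord e (d • v) c = evenCoord e v (d • c) := by
  rw [evenCoord_smul]
  funext i
  exact mul_left_comm (G := k) _ _ _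

/-- The projection of the value of a string at the simple module to its head. -/
def headMap (e : StringEnds n lo hi) :
    (stringOn k lo hi).TensorObj (Residue k) →ₗ[k[ε]] (Fin (n + 1) → Residue k) :=
  { (stringOn k lo hi).liftAdd (evenCoord e) (evenCoord_balanced e) with
    map_smul' := fun d => DFunLike.congr_fun ((stringOn k lo hi).hom_ext
      (f := ((stringOn k lo hi).liftAdd (evenCoord e) (evenCoord_balanced e)).comp
        (DistribSMul.toAddMonoidHom _ d))
      (g := (DistribSMul.toAddMonoidHom _ d).comp
        ((stringOn k lo hi).liftAdd (evenCoord e) (evenCoord_balanced e)))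
      (evenCoord_leftAction e d)) }

theorem headMap_surjective (e : StringEnds n lo hi) :
    Function.Surjective (headMap (k := k) e) := by
  intro w
  -- The coordinate at `2i+2` is `w i`; the values at odd `j` are irrelevant.
  let v : StringSpace k lo hi := fun j =>
    if h : (j.1 - 2) / 2 < n + 1 then w ⟨(j.1 - 2) / 2, h⟩ else (0 : k)
  refine ⟨(stringOn k lo hi).tmul v (Residue.gen k), ?_⟩
  funext i
  change (v _ * 1 : k) = w i
  rw [mul_one]
  have h : (2 * i.1 + 2 - 2) / 2 < n + 1 := by have := i.2; omega
  refine (dif_pos h).trans (congrArg w (Fin.ext ?_))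
  change (2 * i.1 + 2 - 2) / 2 = i.1
  omega

/-- The even basis vectors give a quotient `k^{n+1}` on which `ε` acts by zero, so generators over
`D` are generators over `k` and there must be at least `n+1` of them. -/
theorem not_headGen_string (e : StringEnds n lo hi) {F : DualCat k}
    (i : F ≅ (stringOn k lo hi).toCat) : ¬ DualCat.HeadGen n F := by
  classical
  intro h
  obtain ⟨s, hs, hs'⟩ : ∃ s : Finset ((stringOn k lo hi).TensorObj (Residue k)), s.card ≤ n ∧
      Submodule.span k[ε] (s : Set ((stringOn k lo hi).TensorObj (Residue k))) = ⊤ :=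
    h.of_retract (Retract.ofIso i.symm)
  let ψ : (stringOn k lo hi).TensorObj (Residue k) →ₗ[k[ε]] (Fin (n + 1) → Residue k) := headMap e
  have h1 : Submodule.span k[ε] (ψ '' s) = ⊤ := by
    have h2 := (Submodule.map_span ψ s).symm
    exact h2.trans ((congrArg _ hs').trans
      ((Submodule.map_top ψ).trans (LinearMap.range_eq_top.mpr (headMap_surjective e))))
  let S : Finset (Fin (n + 1) → k) := Finset.image ψ s
  have hS : S.card ≤ n := Finset.card_image_le.trans hs
  let N : Submodule k (Fin (n + 1) → k) :=
    Submodule.span k (S : Set (Fin (n + 1) → k))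
  -- The same subspace viewed as a `D`-submodule, which is possible because `D` acts through its
  -- residue field.
  let N' : Submodule k[ε] (Fin (n + 1) → Residue k) :=
    { carrier := {w | (fun i => (w i).val) ∈ N}
      add_mem' := fun h h' => N.add_mem h h'
      zero_mem' := N.zero_mem
      smul_mem' := fun d w hw => N.smul_mem d.fst hw }
  have h3 : Submodule.span k[ε] (ψ '' s) ≤ N' := by
    rw [Submodule.span_le]
    rintro _ ⟨x, hx, rfl⟩
    have hm : (fun i => (ψ x i).val) ∈ (S : Set (Fin (n + 1) → k)) :=
      Finset.mem_coe.mpr (Finset.mem_image_of_mem ψ hx)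
    exact (Submodule.subset_span hm : (fun i => (ψ x i).val) ∈ N)
  have h4 : N = ⊤ := by
    rw [eq_top_iff]
    intro w _
    exact h3 (h1 ▸ Submodule.mem_top)
  have h5 : Module.finrank k N ≤ n :=
    (finrank_span_finset_le_card S).trans hS
  have h6 : Module.finrank k N = n + 1 := by
    rw [h4, finrank_top]
    exact Module.finrank_fin_fun k
  rw [h6] at h5
  omega

end Lower

/-! ### A part of nonzero degree needs at most `n` generators at the simple module -/

section Upper

variable {n lo hi hi' : ℕ}

variable (k lo hi hi') in
/-- The element `(m_a ⊗ m_b) ⊗ 1` of the value at the simple module. -/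
def headVec (a b : ℕ) : (strTensor k lo hi hi').TensorObj (Residue k) :=
  (strTensor k lo hi hi').tmul (tvec lo hi hi' a b 1) (Residue.gen k)

theorem tmul_tvec (a b : ℕ) (s : k) (c : Residue k) :
    (strTensor k lo hi hi').tmul (tvec lo hi hi' a b s) c =
      algebraMap k k[ε] (s * c.val) • headVec k lo hi hi' a b := by
  rw [headVec, smul_tmul, leftAction_algebraMap, algebraMap_smul_tvec, mul_one]
  conv_lhs => rw [← Residue.smul_gen c, ← tmul_balanced, algebraMap_smul_tvec]
  rw [mul_comm]

theorem headVec_eq {a b a' b' : ℕ}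
    (h : tvec lo hi hi' a b (1 : k) = tvec lo hi hi' a' b' 1) :
    headVec k lo hi hi' a b = headVec k lo hi hi' a' b' := by rw [headVec, h, headVec]

theorem headVec_eq_zero {a b : ℕ} (h : tvec lo hi hi' a b (1 : k) = 0) :
    headVec k lo hi hi' a b = 0 := by rw [headVec, h, zero_tmul]

/-- Here `m_b = m_{b+1} ε`, and `ε` kills the simple module. -/
theorem headVec_odd (a : ℕ) {b : ℕ} (hb : b % 2 = 1) (h : b + 1 ≤ hi') :
    headVec k lo hi hi' a b = 0 := by
  have h1 : tvec lo hi hi' a b (1 : k) = (ε : k[ε]) • tvec lo hi hi' a (b + 1) 1 := by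
    rw [eps_smul_tvec_even a (by omega) (by omega) h, Nat.add_sub_cancel]
  rw [headVec, h1, tmul_balanced, Residue.eps_smul, tmul_zero]

theorem headVec_succ {a : ℕ} (ha : a % 2 = 0) (h : lo ≤ a) (b : ℕ) :
    headVec k lo hi hi' (a + 1) b = (ε : k[ε]) • headVec k lo hi hi' a b := by
  rw [headVec, headVec, smul_tmul, leftAction_eps_tvec_even ha h]

/-- Generators with `b` even and `a` even or `a = 1` suffice. An odd `a ≥ 3` is a left multiple of
`ε`. An odd `b` gives zero unless `b` is the top index `hi'`, and then `m_a ⊗ m_b` is either zero or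
equal to `m_{a-1} ⊗ m_{b-1}`. -/
theorem headVec_mem (e : StringEnds n lo hi) (d : ℤ)
    (N : Submodule k[ε] ((strTensor k lo hi hi').TensorObj (Residue k)))
    (hN : ∀ a b, lo ≤ a → a ≤ hi → 2 ≤ b → b ≤ hi' → b % 2 = 0 → (a % 2 = 0 ∨ a = 1) →
      ((a : ℤ) - b) / 2 = d → headVec k lo hi hi' a b ∈ N) (a b : ℕ)
    (ha : lo ≤ a) (ha' : a ≤ hi) (hb : 2 ≤ b) (hb' : b ≤ hi') (h : ((a : ℤ) - b) / 2 = d) :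
    headVec k lo hi hi' a b ∈ N := by
  have := e.le_two
  have := e.one_le
  have key : ∀ a b, lo ≤ a → a ≤ hi → 2 ≤ b → b ≤ hi' → b % 2 = 0 →
      ((a : ℤ) - b) / 2 = d → headVec k lo hi hi' a b ∈ N := by
    intro a b ha ha' hb hb' hb2 h
    by_cases h1 : a % 2 = 0 ∨ a = 1
    · exact hN a b ha ha' hb hb' hb2 h1 h
    · obtain ⟨c, rfl⟩ : ∃ c, a = c + 1 := ⟨a - 1, by omega⟩
      rw [headVec_succ (by omega) (by omega)]
      exact N.smul_mem _ (hN c b (by omega) (by omega) hb hb' hb2 (by omega) (by omega))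
  rcases Nat.mod_two_eq_zero_or_one b with h2 | h2
  · exact key a b ha ha' hb hb' h2 h
  by_cases h3 : b + 1 ≤ hi'
  · rw [headVec_odd a h2 h3]
    exact N.zero_mem
  rcases Nat.mod_two_eq_zero_or_one a with h4 | h4
  · obtain ⟨c, rfl⟩ : ∃ c, b = c + 1 := ⟨b - 1, by omega⟩
    rw [← headVec_eq (tvec_pred h4 (by omega) ha' (by omega) (by omega) 1)]
    by_cases h5 : lo ≤ a - 1
    · exact key _ _ h5 (by omega) (by omega) (by omega) (by omega) (by omega)
    · rw [headVec_eq_zero (tvec_eq_zero_left (by omega) _ _)]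
      exact N.zero_mem
  · rw [headVec_eq_zero (tvec_odd h4 h2 _)]
    exact N.zero_mem

/-- A part of nonzero degree in a tensor product of strings with `n` valleys has at most `n`
generators after evaluation at the simple module. -/
theorem exists_generators_grade (hn : 1 ≤ n) (e : StringEnds n lo hi) (e' : StringEnds n 2 hi')
    {d : ℤ} (hd : d ≠ 0) :
    ∃ s : Finset ((strTensor k lo hi hi').TensorObj (Residue k)), s.card ≤ n ∧
      ∀ t, (grade lo hi hi' e.one_le d).tensor (Residue k) t ∈
        Submodule.span k[ε] (s : Set ((strTensor k lo hi hi').TensorObj (Residue k))) := by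
  classical
  have := e.hi_le
  have := e'.hi_le
  have := e'.le_hi
  have := e.one_le
  have := e.le_two
  obtain ⟨s, hs, hmem⟩ : ∃ s : Finset ((strTensor k lo hi hi').TensorObj (Residue k)),
      s.card ≤ n ∧ ∀ a b, lo ≤ a → a ≤ hi → 2 ≤ b → b ≤ hi' → b % 2 = 0 → (a % 2 = 0 ∨ a = 1) →
      ((a : ℤ) - b) / 2 = d → headVec k lo hi hi' a b ∈
        Submodule.span k[ε] (s : Set ((strTensor k lo hi hi').TensorObj (Residue k))) := by
    rcases lt_or_gt_of_ne hd with h | h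
    -- Negative degree: one generator for each even `b = 2j+4` up to `2n+2`. The degree forces `a =
    -- b + 2d`, replaced by the odd end `a = 1` when this number is not positive.
    · refine ⟨(Finset.range n).image fun j : ℕ => headVec k lo hi hi'
        (if (j : ℤ) + 2 + d ≤ 0 then 1 else (2 * ((j : ℤ) + 2 + d)).toNat) (2 * j + 4),
        Finset.card_image_le.trans (Finset.card_range n).le, ?_⟩
      intro a b ha ha' hb hb' hb2 ha2 hab
      by_cases hb4 : 4 ≤ b
      · refine Submodule.subset_span (Finset.mem_coe.mpr (Finset.mem_image.mpr
          ⟨(b - 4) / 2, Finset.mem_range.mpr (by omega), ?_⟩))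
        congr 1
        · split_ifs <;> omega
        · omega
      -- The remaining vector is `m_1 ⊗ m_2 = m_2 ⊗ m_3`. As `n ≥ 1`, the right factor contains
      -- `m_4`, so `m_3 = m_4 ε` and the vector dies on the simple module.
      · obtain rfl : b = 2 := by omega
        obtain rfl : a = 1 := by omega
        rw [headVec_eq (tvec_pred (a := 2) (b := 2) rfl (by omega) (by have := e.le_hi; omega)
          rfl (by omega) 1), headVec_odd 2 (by omega) (by omega)]
        exact Submodule.zero_mem _
    -- Positive degree: `a = b + 2d` with `a ≤ 2n+2` excludes `b = 2n+2`, leaving `b = 2j+2` with `j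
    -- < n`.
    · refine ⟨(Finset.range n).image fun j : ℕ => headVec k lo hi hi'
        (2 * ((j : ℤ) + 1 + d)).toNat (2 * j + 2),
        Finset.card_image_le.trans (Finset.card_range n).le, ?_⟩
      intro a b ha ha' hb hb' hb2 ha2 hab
      refine Submodule.subset_span (Finset.mem_coe.mpr (Finset.mem_image.mpr
        ⟨(b - 2) / 2, Finset.mem_range.mpr (by omega), ?_⟩))
      congr 1 <;> omega
  refine ⟨s, hs, fun t => ?_⟩
  induction t using (strTensor k lo hi hi').tensor_induction with
  | h0 => rw [map_zero]; exact Submodule.zero_mem _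
  | h2 t t' h h' => rw [map_add]; exact Submodule.add_mem _ h h'
  | h1 v c =>
    rw [Hom.tensor_tmul]
    let N := Submodule.span k[ε] (s : Set ((strTensor k lo hi hi').TensorObj (Residue k)))
    -- Passing to the quotient by the span turns membership into the vanishing of an additive map,
    -- which can be tested on the elements `m_a ⊗ m_b`.
    let g : (strTensor k lo hi hi').carrier →+ (strTensor k lo hi hi').TensorObj (Residue k) ⧸ N :=
      { toFun := fun v => N.mkQ
          ((strTensor k lo hi hi').tmul ((grade lo hi hi' e.one_le d).lin v) c)
        map_zero' := by rw [map_zero, zero_tmul, map_zero]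
        map_add' := fun v w => by rw [map_add, add_tmul, map_add] }
    have hg : g = 0 := by
      refine tensor_hom_ext fun a b r ha ha' hb hb' => ?_
      change N.mkQ ((strTensor k lo hi hi').tmul ((grade lo hi hi' e.one_le d).lin _) c) = 0
      rw [grade_tvec]
      by_cases hab : ((a : ℤ) - b) / 2 = d
      · rw [gradeVal_pos hab, tmul_tvec, map_smul]
        have hm := headVec_mem e d N hmem a b ha ha' hb hb' hab
        rw [(Submodule.Quotient.mk_eq_zero N).mpr hm |> fun h =>
          (show N.mkQ (headVec k lo hi hi' a b) = 0 from h), smul_zero]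
      · rw [gradeVal_neg hab, zero_tmul, map_zero]
    exact (Submodule.Quotient.mk_eq_zero N).mp (DFunLike.congr_fun hg v)

end Upper

end DualBimodule

/-! ### The diagonal and the truncation as 2-morphisms -/

namespace DualBimodule

variable {k : Type u} [Field k] {n lo hi hi' : ℕ}

variable (k) in
/-- The 1-morphism of tensoring with the string `m_lo, …, m_hi`. -/
abbrev strCat (lo hi : ℕ) : DualCat k := (stringOn k lo hi).toCat

/-- The diagonal embedding as a 2-morphism. -/
def diagCat (e : StringEnds n lo hi) (e' : StringEnds n 2 hi') :
    strCat k 2 hi ⟶ strCat k 2 hi' ⊗ strCat k lo hi :=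
  (diag e e').toCat ≫ (toCatComp (stringOn k lo hi) (stringOn k 2 hi')).inv

theorem StringEnds.upper (e : StringEnds n lo hi) : StringEnds n 2 hi :=
  ⟨by omega, le_rfl, e.le_hi, e.hi_le⟩

/-- The 2-morphism forgetting `m_1`. -/
def truncCat (e : StringEnds n lo hi) : strCat k lo hi ⟶ strCat k 2 hi :=
  (trunc lo hi e.one_le e.le_two).toCat

/-- The diagonal embedding involves only `m_a ⊗ m_b` with `a ≥ 2`, so forgetting `m_1` in the
bimodule applied last does not affect it. Once `M` inverts both diagonals, it must invert the
truncation on images of `strCat k 2 hi'`. -/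
theorem diagCat_comp_whiskerLeft_truncCat (e : StringEnds n lo hi) (e' : StringEnds n 2 hi') :
    diagCat e e' ≫ (strCat k 2 hi' ◁ truncCat e) = diagCat e.upper e' := by
  apply ObjectProperty.hom_ext
  refine natTrans_ext (B := stringOn k 2 hi) fun Z v z => ?_
  let g₁ : (stringOn k 2 hi).carrier →+ (stringOn k 2 hi).TensorObj ((stringOn k 2 hi').TensorObj Z) :=
    { toFun := fun v => (trunc lo hi e.one_le e.le_two).tensor _
        ((stringOn k lo hi).assocHom (stringOn k 2 hi') Z
          ((strTensor k lo hi hi').tmul ((diag e e').lin v) z))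
      map_zero' := by rw [map_zero, zero_tmul, map_zero, map_zero]
      map_add' := fun v w => by rw [map_add, add_tmul, map_add, map_add] }
  let g₂ : (stringOn k 2 hi).carrier →+ (stringOn k 2 hi).TensorObj ((stringOn k 2 hi').TensorObj Z) :=
    { toFun := fun v => ((stringOn k 2 hi).assocHom (stringOn k 2 hi') Z
          ((strTensor k 2 hi hi').tmul ((diag e.upper e').lin v) z))
      map_zero' := by rw [map_zero, zero_tmul, map_zero]
      map_add' := fun v w => by rw [map_add, add_tmul, map_add] }
  have hg : g₁ = g₂ := by
    refine str_hom_ext fun a s h h' => ?_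
    change (trunc lo hi e.one_le e.le_two).tensor _ ((stringOn k lo hi).assocHom (stringOn k 2 hi') Z
          ((strTensor k lo hi hi').tmul ((diag e e').lin _) z)) =
      ((stringOn k 2 hi).assocHom (stringOn k 2 hi') Z
          ((strTensor k 2 hi hi').tmul ((diag e.upper e').lin _) z))
    have key : ∀ b, (trunc lo hi e.one_le e.le_two).tensor _
        ((stringOn k lo hi).assocHom (stringOn k 2 hi') Z
          ((strTensor k lo hi hi').tmul (tvec lo hi hi' a b s) z)) =
        ((stringOn k 2 hi).assocHom (stringOn k 2 hi') Z
          ((strTensor k 2 hi hi').tmul (tvec 2 hi hi' a b s) z)) := by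
      intro b
      change (stringOn k 2 hi).tmul ((trunc lo hi e.one_le e.le_two).lin (vec lo hi a s)) _ =
        (stringOn k 2 hi).tmul (vec 2 hi a s) _
      rw [trunc_vec _ _ ⟨e.le_two.trans h, h'⟩]
      rfl
    rw [diag_vec e e' h h', diag_vec e.upper e' h h']
    rcases Nat.mod_two_eq_zero_or_one a with ha | ha
    · rw [diagVal_even ha, diagVal_even ha, key]
    · rw [diagVal_odd ha, diagVal_odd ha, key]
  exact DFunLike.congr_fun hg v

theorem sum_toCat_eq_id {ι : Type*} {B : DualBimodule k} (s : Finset ι) (f : ι → Hom B B)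
    (h : ∀ b, ∑ i ∈ s, (f i).lin b = b) : ∑ i ∈ s, (f i).toCat = 𝟙 B.toCat := by
  apply ObjectProperty.hom_ext
  refine natTrans_ext (B := B) fun Z b z => ?_
  let ev : (B.toCat ⟶ B.toCat) →+ B.TensorObj Z :=
    { toFun := fun η => (η.hom.app Z).hom.hom (B.tmul b z)
      map_zero' := rfl
      map_add' := fun _ _ => rfl }
  let g : B.carrier →+ B.TensorObj Z :=
    { toFun := fun b => B.tmul b z
      map_zero' := B.zero_tmul z
      map_add' := fun b c => B.add_tmul b c z }
  have h1 : ev (∑ i ∈ s, (f i).toCat) = ∑ i ∈ s, g ((f i).lin b) := map_sum ev _ _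
  rw [← map_sum, h] at h1
  exact h1

/-- The four shapes are the four choices of ends: `lo` is 2 for `W`, `S` and 1 for `N`, `M`; `hi` is
`2n+2` for `W`, `N` and `2n+3` for `S`, `M`. -/
theorem exists_stringEnds_of_mem_cellJ {F : DualCat k} (h : F ∈ cellJ k n) :
    ∃ lo hi, StringEnds n lo hi ∧ Nonempty (F ≅ strCat k lo hi) := by
  obtain ⟨s, ⟨i⟩⟩ := h
  cases s
  · exact ⟨2, 2 * n + 2, ⟨by omega, by omega, by omega, by omega⟩, ⟨ObjectProperty.isoMk _ i⟩⟩
  · exact ⟨2, 2 * n + 3, ⟨by omega, by omega, by omega, by omega⟩, ⟨ObjectProperty.isoMk _ i⟩⟩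
  · exact ⟨1, 2 * n + 2, ⟨by omega, by omega, by omega, by omega⟩, ⟨ObjectProperty.isoMk _ i⟩⟩
  · exact ⟨1, 2 * n + 3, ⟨by omega, by omega, by omega, by omega⟩, ⟨ObjectProperty.isoMk _ i⟩⟩

theorem strCat_mem_cellJ (e : StringEnds n lo hi) : strCat k lo hi ∈ cellJ k n := by
  have := e.one_le
  have := e.le_two
  have := e.le_hi
  have := e.hi_le
  obtain rfl | rfl : lo = 1 ∨ lo = 2 := by omega
  · obtain rfl | rfl : hi = 2 * n + 2 ∨ hi = 2 * n + 3 := by omega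
    · exact ⟨.N, ⟨Iso.refl _⟩⟩
    · exact ⟨.M, ⟨Iso.refl _⟩⟩
  · obtain rfl | rfl : hi = 2 * n + 2 ∨ hi = 2 * n + 3 := by omega
    · exact ⟨.W, ⟨Iso.refl _⟩⟩
    · exact ⟨.S, ⟨Iso.refl _⟩⟩

end DualBimodule

theorem isIso_of_commSq {C : Type*} [Category* C] {X Y X' Y' : C} (f : X ⟶ Y) (g : X' ⟶ Y')
    (a : X ≅ X') (b : Y ≅ Y') (h : f ≫ b.hom = a.hom ≫ g) (hg : IsIso g) : IsIso f := by
  have h2 : f = a.hom ≫ g ≫ b.inv := by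
    rw [← Category.assoc, ← h, Category.assoc, Iso.hom_inv_id, Category.comp_id]
  rw [h2]
  infer_instance

theorem LEJ.refl {k : Type u} [Field k] (F : DualCat k) : LEJ F F :=
  ⟨𝟙_ _, 𝟙_ _, (Retract.ofIso ((λ_ _ ≪≫ ρ_ F).symm)).isSummand⟩

/-! ### Finitary 2-representations -/

namespace FinitaryTwoRep

open DualBimodule

variable {k : Type u} [Field k] {A : Type w} [Category.{v} A] [Preadditive A] [Linear k A]
  [IsFinitary k A] (M : FinitaryTwoRep k A)

/-- The functor `F ↦ M(F) X`. -/
def orbit (X : A) : DualCat k ⥤ A := M.functor ⋙ (evaluation A A).obj X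

instance (X : A) : (M.orbit X).Additive := by
  have := M.additive
  exact ⟨fun {F G f g} => by
    change (M.functor.map (f + g)).app X = _
    rw [M.functor.map_add]
    rfl⟩

instance (F : DualCat k) : (M.functor.obj F).Additive := M.additive_obj F

section Composition

attribute [local instance] endofunctorMonoidalCategory

instance : M.functor.Monoidal := M.monoidal

/-- The 2-representation respects composition. -/
def actComp (F G : DualCat k) (X : A) : M.act (F ⊗ G) X ≅ M.act G (M.act F X) :=
  ((Functor.Monoidal.μIso M.functor F G).app X).symm

/-- In `F ⊗ G` the functor `F` is applied first, so naturality of the monoidal structure of `M`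
conjugates the component of `M(F ◁ g)` at `X` into the component of `M(g)` at `M(F) X`. -/
theorem isIso_of_isIso_whiskerLeft {F G G' : DualCat k} (g : G ⟶ G') (X : A)
    (h : IsIso ((M.functor.map (F ◁ g)).app X)) :
    IsIso ((M.functor.map g).app (M.act F X)) := by
  exact isIso_of_commSq _ _ ((Functor.Monoidal.μIso M.functor F G).app X)
    ((Functor.Monoidal.μIso M.functor F G').app X)
    (congrArg (fun η => NatTrans.app η X)
      (Functor.LaxMonoidal.μ_natural_right (F := M.functor) F g)) h

end Composition

theorem isZero_act_obj (F : DualCat k) {X : A} (h : IsZero X) : IsZero (M.act F X) :=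
  (M.functor.obj F).map_isZero h

theorem isZero_act_of_isZero {F : DualCat k} (h : IsZero F) (X : A) : IsZero (M.act F X) :=
  (M.orbit X).map_isZero h

theorem isZero_act_of_retract {F G : DualCat k} (h : Retract F G) {X : A}
    (hG : IsZero (M.act G X)) : IsZero (M.act F X) :=
  isZero_of_retract (h.map (M.orbit X)) hG

theorem isZero_act_of_LEJ {F G : DualCat k} (h : LEJ F G) (hF : ∀ X, IsZero (M.act F X)) (X : A) :
    IsZero (M.act G X) := by
  obtain ⟨H₁, H₂, hs⟩ := h
  obtain ⟨r⟩ := hs.nonempty_retract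
  refine M.isZero_act_of_retract r (isZero_of_iso (M.actComp H₂ (F ⊗ H₁) X).symm ?_)
  refine isZero_of_iso (M.actComp F H₁ _).symm ?_
  exact M.isZero_act_obj _ (hF _)

/-! ### Consequences of being the apex -/

variable {M} {n lo hi hi' : ℕ}

/-- An indecomposable summand of a composition involving a member of the apex is annihilated or
belongs to the apex. -/
theorem IsApex.annihilated_or_mem {J : Set (DualCat k)} (hJ : M.IsApex J) {F G H₁ H₂ : DualCat k}
    (hF : F ∈ J) (hG : IsIndecomposable G) (r : Retract G (H₂ ⊗ F ⊗ H₁)) :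
    (∀ X, IsZero (M.act G X)) ∨ G ∈ J := by
  by_contra! h
  obtain ⟨⟨X, hX⟩, hGJ⟩ := h
  -- The cell of `G` lies above `J` and is not annihilated, so maximality of the apex forces it to
  -- be `J`.
  let J' : Set (DualCat k) := {G' | IsIndecomposable G' ∧ LEJ G G' ∧ LEJ G' G}
  have hGJ' : G ∈ J' := ⟨hG, LEJ.refl G, LEJ.refl G⟩
  have h1 : J' = J := hJ.2.2 J' ⟨G, hG, rfl⟩ (fun h0 => hX (h0 G hGJ' X))
    ⟨F, hF, G, hGJ', H₁, H₂, r.isSummand⟩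
  exact hGJ (h1 ▸ hGJ')

/-- Members of one cell lie below each other, so if one of them acts by zero then all of them do. -/
theorem IsApex.not_annihilated {J : Set (DualCat k)} (hJ : M.IsApex J) {F : DualCat k}
    (hF : F ∈ J) : ∃ X, ¬ IsZero (M.act F X) := by
  by_contra! h
  obtain ⟨⟨F₀, hF₀, rfl⟩, hann, -⟩ := hJ
  exact hann fun G hG X => M.isZero_act_of_LEJ hG.2.1 (M.isZero_act_of_LEJ hF.2.2 h) X

/-- Every indecomposable summand of `G` inherits the bound of `n` generators, hence is not a string
with `n` valleys; not being in the apex, it is annihilated. -/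
theorem IsApex.isZero_of_headGen (hJ : M.IsApex (cellJ k n)) {F G H₁ H₂ : DualCat k}
    (hF : F ∈ cellJ k n) (r : Retract G (H₂ ⊗ F ⊗ H₁)) (hG : DualCat.HeadGen n G) (X : A) :
    IsZero (M.act G X) := by
  refine DualCat.induction_retract (P := fun G => ∀ X, IsZero (M.act G X)) G ?_ ?_ ?_ X
  · exact fun G h X => M.isZero_act_of_isZero h X
  · exact fun s h h' X => isZero_of_splitting (s.map (M.orbit X)) (h X) (h' X)
  · intro G' hG' r'
    refine (hJ.annihilated_or_mem hF hG' (r'.trans r)).resolve_right fun hm => ?_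
    obtain ⟨lo, hi, e, ⟨i⟩⟩ := exists_stringEnds_of_mem_cellJ hm
    exact not_headGen_string e i (hG.of_retract r')

/-- An indecomposable summand of the image of an object under a composition involving a member of
the apex is a summand of its image under a member of the apex. -/
theorem IsApex.exists_retract {J : Set (DualCat k)} (hJ : M.IsApex J) {F H₁ H₂ : DualCat k}
    (hF : F ∈ J) {X Y : A} (hY : IsIndecomposable Y)
    (r : Retract Y (M.act (H₂ ⊗ F ⊗ H₁) X)) : ∃ F' ∈ J, Nonempty (Retract Y (M.act F' X)) := by
  have hfin := IsFinitary.finite_hom (k := k) (A := A)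
  refine DualCat.induction_retract
    (P := fun G => Retract Y (M.act G X) → ∃ F' ∈ J, Nonempty (Retract Y (M.act F' X)))
    (H₂ ⊗ F ⊗ H₁) ?_ ?_ ?_ r
  · exact fun G h r => absurd (isZero_of_retract r (M.isZero_act_of_isZero h X)) hY.1
  · intro G₁ G₂ G s h h' r
    rcases hY.retract_or_retract (k := k) (s.map (M.orbit X)) r with ⟨⟨r'⟩⟩ | ⟨⟨r'⟩⟩
    · exact h r'
    · exact h' r'
  · intro G hG r' r
    rcases hJ.annihilated_or_mem hF hG r' with h | h
    · exact absurd (isZero_of_retract r (h X)) hY.1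
    · exact ⟨G, h, ⟨r⟩⟩

/-- The projection to degree `d` splits off a 1-morphism with at most `n` generators at the simple
module, and such a summand of a composition through the apex acts by zero. -/
theorem IsApex.map_grade_eq_zero (hn : 1 ≤ n) (hJ : M.IsApex (cellJ k n))
    (e : StringEnds n lo hi) (e' : StringEnds n 2 hi') {d : ℤ} (hd : d ≠ 0) (X : A) :
    (M.orbit X).map (grade lo hi hi' e.one_le d).toCat = 0 := by
  obtain ⟨G, i, r, h1, h2⟩ := IsIdempotentComplete.idempotents_split _
    (grade (k := k) lo hi hi' e.one_le d).toCat (by rw [← Hom.toCat_comp, grade_comp_grade])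
  obtain ⟨s, hs, hspan⟩ := exists_generators_grade (k := k) hn e e' hd
  have hG : DualCat.HeadGen n G := by
    refine DualCat.headGen_of_forall_mem_span ⟨i, r, h1⟩ s hs fun t => ?_
    rw [h2]
    exact hspan t
  have hr : Retract G (𝟙_ _ ⊗ strCat k 2 hi' ⊗ strCat k lo hi) :=
    (⟨i, r, h1⟩ : Retract G _).trans (Retract.ofIso ((toCatComp _ _).symm ≪≫ (λ_ _).symm))
  have h0 := hJ.isZero_of_headGen (strCat_mem_cellJ e') hr hG X
  have hr0 : (M.orbit X).map r = 0 := IsZero.eq_of_tgt h0 _ _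
  rw [← h2, Functor.map_comp, hr0, zero_comp]

/-- The diagonal embedding is split, with complement the sum of the nonzero degrees, all of which
are killed by `M`. -/
theorem IsApex.isIso_map_diagCat (hn : 1 ≤ n) (hJ : M.IsApex (cellJ k n))
    (e : StringEnds n lo hi) (e' : StringEnds n 2 hi') (X : A) :
    IsIso ((M.orbit X).map (diagCat e e')) := by
  have h1 : (diag (k := k) e e').toCat ≫ (codiag e e').toCat = 𝟙 _ := by
    rw [← Hom.toCat_comp, diag_comp_codiag, Hom.toCat_id]
  have h2 : (M.orbit X).map ((codiag e e').toCat ≫ (diag e e').toCat) = 𝟙 _ := by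
    rw [← Hom.toCat_comp, codiag_comp_diag]
    have h3 := congrArg (M.orbit X).map (sum_toCat_eq_id _ _ (sum_grade (k := k) e e'))
    rw [Functor.map_sum, CategoryTheory.Functor.map_id, Finset.sum_eq_single 0] at h3
    · exact h3
    · exact fun d _ hd => hJ.map_grade_eq_zero hn e e' hd X
    · intro h
      rw [Finset.mem_Icc] at h
      omega
  have : IsIso ((M.orbit X).map (diag e e').toCat) :=
    ⟨(M.orbit X).map (codiag e e').toCat, by rw [← Functor.map_comp, h1, CategoryTheory.Functor.map_id],
      by rw [← Functor.map_comp, h2]⟩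
  rw [diagCat, Functor.map_comp]
  infer_instance

/-- Multiplication in the apex, up to annihilated 1-morphisms. -/
theorem IsApex.nonempty_act_act_iso (hn : 1 ≤ n) (hJ : M.IsApex (cellJ k n))
    (e : StringEnds n lo hi) (e' : StringEnds n 2 hi') (X : A) :
    Nonempty (M.act (strCat k lo hi) (M.act (strCat k 2 hi') X) ≅ M.act (strCat k 2 hi) X) := by
  have := hJ.isIso_map_diagCat hn e e' X
  exact ⟨(M.actComp _ _ X).symm ≪≫ (asIso ((M.orbit X).map (diagCat e e'))).symm⟩

/-- Cancellation: the diagonal followed by the truncation is the diagonal of the truncated string,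
and `M` inverts both diagonals. -/
theorem IsApex.isIso_map_truncCat (hn : 1 ≤ n) (hJ : M.IsApex (cellJ k n))
    (e : StringEnds n lo hi) (e' : StringEnds n 2 hi') (X : A) :
    IsIso ((M.functor.map (truncCat e)).app (M.act (strCat k 2 hi') X)) := by
  apply M.isIso_of_isIso_whiskerLeft
  change IsIso ((M.orbit X).map (strCat k 2 hi' ◁ truncCat e))
  have h1 := hJ.isIso_map_diagCat hn e e' X
  have h2 := hJ.isIso_map_diagCat hn e.upper e' X
  rw [← diagCat_comp_whiskerLeft_truncCat e e', Functor.map_comp] at h2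
  exact IsIso.of_isIso_comp_left ((M.orbit X).map (diagCat e e')) _

/-- Forgetting `m_1` does not change the action on summands of images of `W` and `S`. -/
theorem IsApex.nonempty_act_iso_of_retract (hn : 1 ≤ n) (hJ : M.IsApex (cellJ k n))
    (e : StringEnds n lo hi) (e' : StringEnds n 2 hi') {X Y : A}
    (r : Retract Y (M.act (strCat k 2 hi') X)) :
    Nonempty (M.act (strCat k lo hi) Y ≅ M.act (strCat k 2 hi) Y) := by
  -- The component at a retract is a retract of the component, and isomorphisms are stable under
  -- retracts.
  have h : MorphismProperty.isomorphisms A ((M.functor.map (truncCat e)).app Y) :=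
    MorphismProperty.of_retract (NatTrans.retractArrowApp (M.functor.map (truncCat e)) r)
      (hJ.isIso_map_truncCat hn e e' X)
  exact ⟨@asIso _ _ _ _ _ h⟩

end FinitaryTwoRep

/-! ### Finding indecomposable summands -/

/-- Descent on the dimension of the endomorphism algebra: in a proper splitting, the property passes
to one of the two summands. -/
theorem exists_isIndecomposable_retract {k C : Type*} [Field k] [Category* C] [Preadditive C]
    [Linear k C] (hfin : ∀ X Y : C, Module.Finite k (X ⟶ Y)) (p : C → Prop)
    (hzero : ∀ X, IsZero X → ¬ p X)
    (hp : ∀ {Y Z X : C}, Splitting Y Z X → p X → p Y ∨ p Z) {X : C} (hX : p X) :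
    ∃ Y, IsIndecomposable Y ∧ Nonempty (Retract Y X) ∧ p Y := by
  suffices h : ∀ (m : ℕ) (X : C), Module.finrank k (X ⟶ X) = m → p X →
      ∃ Y, IsIndecomposable Y ∧ Nonempty (Retract Y X) ∧ p Y from h _ X rfl hX
  intro m
  induction m using Nat.strong_induction_on with
  | _ m ih =>
    intro X hm hX
    by_cases hi : IsIndecomposable X
    · exact ⟨X, hi, ⟨Retract.refl X⟩, hX⟩
    obtain ⟨Y, Z, ⟨s⟩, hY, hZ⟩ :=
      exists_splitting_of_not_isIndecomposable (fun h => hzero X h hX) hi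
    rcases hp s hX with h | h
    · obtain ⟨V, hV, ⟨r⟩, hpV⟩ := ih _ (hm ▸ s.finrank_end_lt (k := k) hZ) Y rfl h
      exact ⟨V, hV, ⟨r.trans s.fst⟩, hpV⟩
    · obtain ⟨V, hV, ⟨r⟩, hpV⟩ := ih _ (hm ▸ s.swap.finrank_end_lt (k := k) hY) Z rfl h
      exact ⟨V, hV, ⟨r.trans s.snd⟩, hpV⟩

namespace FinitaryTwoRep

open DualBimodule

variable {k : Type u} [Field k] {A : Type w} [Category.{v} A] [Preadditive A] [Linear k A]
  [IsFinitary k A] {M : FinitaryTwoRep k A}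

theorem exists_isIndecomposable_retract_of_not_isZero_act (F : DualCat k) {X : A}
    (h : ¬ IsZero (M.act F X)) :
    ∃ Y, IsIndecomposable Y ∧ Nonempty (Retract Y X) ∧ ¬ IsZero (M.act F Y) :=
  exists_isIndecomposable_retract (IsFinitary.finite_hom (k := k)) (fun X => ¬ IsZero (M.act F X))
    (fun _ h h' => h' (M.isZero_act_obj F h))
    (fun s h => by
      by_contra! h'
      exact h (isZero_of_splitting (s.map (M.functor.obj F)) h'.1 h'.2)) h

theorem exists_isIndecomposable_retract_of_not_isZero (k : Type u) [Field k] {A : Type w}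
    [Category.{v} A] [Preadditive A] [Linear k A] [IsFinitary k A] {X : A} (h : ¬ IsZero X) :
    ∃ Y, IsIndecomposable Y ∧ Nonempty (Retract Y X) := by
  obtain ⟨Y, hY, hr, -⟩ := exists_isIndecomposable_retract (IsFinitary.finite_hom (k := k))
    (fun X : A => ¬ IsZero X) (fun _ h h' => h' h)
    (fun s h => by
      by_contra! h'
      exact h (isZero_of_splitting s h'.1 h'.2)) h
  exact ⟨Y, hY, hr⟩

/-- No nonzero object is annihilated by the apex of a transitive 2-representation. -/
theorem IsApex.exists_not_isZero_act {J : Set (DualCat k)} (hJ : M.IsApex J)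
    (htrans : M.IsTransitive) {F : DualCat k} (hF : F ∈ J) {X : A} (hX : ¬ IsZero X) :
    ∃ F' ∈ J, ¬ IsZero (M.act F' X) := by
  obtain ⟨X₁, hX₁, ⟨r₁⟩⟩ := exists_isIndecomposable_retract_of_not_isZero k hX
  obtain ⟨Z, hZ⟩ := hJ.not_annihilated hF
  obtain ⟨Z₁, hZ₁, -, hFZ⟩ := exists_isIndecomposable_retract_of_not_isZero_act F hZ
  obtain ⟨Y, hY, ⟨r⟩⟩ := exists_isIndecomposable_retract_of_not_isZero k hFZ
  -- Transitivity reaches `Z₁`, on which `F` is nonzero, from `X₁`. So `Y`, a summand of `F Z₁`, is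
  -- a summand of `F U X₁`, and a member of the apex already produces it from `X₁`.
  obtain ⟨U, hU⟩ := htrans X₁ Z₁ hX₁ hZ₁
  obtain ⟨r₂⟩ := hU.nonempty_retract
  have r₃ : Retract Y (M.act (U ⊗ F ⊗ 𝟙_ _) X₁) :=
    (r.trans (r₂.map (M.functor.obj F))).trans
      (Retract.ofIso ((M.actComp U F X₁).symm ≪≫ (M.orbit X₁).mapIso (U ◁ᵢ (ρ_ F).symm)))
  obtain ⟨F', hF', ⟨r₄⟩⟩ := hJ.exists_retract hF hY r₃
  exact ⟨F', hF', fun h => hY.1 (isZero_of_retract (r₄.trans (r₁.map (M.functor.obj F'))) h)⟩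

/-! ### The indecomposable objects `W Z` and `S Z` -/

section Apex

variable {n : ℕ}

/-- The bounds for `W_n`. -/
theorem stringEnds_W (n : ℕ) : StringEnds n 2 (2 * n + 2) :=
  ⟨by omega, by omega, by omega, by omega⟩

/-- The bounds for `S_n`. -/
theorem stringEnds_S (n : ℕ) : StringEnds n 2 (2 * n + 3) :=
  ⟨by omega, by omega, by omega, by omega⟩

/-- Some member `F` of the cell does not kill `Y`. As `Y` is a summand of an image, `F` acts on it
like a string `F₀` starting with `m_2`, and `F₀ Y ≅ F₀ W Y`; hence `W Y = 0` is impossible. -/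
theorem IsApex.not_isZero_act_W (hn : 1 ≤ n) (hJ : M.IsApex (cellJ k n)) (htrans : M.IsTransitive)
    {hi : ℕ} (e : StringEnds n 2 hi) {X Y : A} (r : Retract Y (M.act (strCat k 2 hi) X))
    (hY : ¬ IsZero Y) : ¬ IsZero (M.act (strCat k 2 (2 * n + 2)) Y) := by
  intro h
  obtain ⟨F, hF, hFY⟩ := hJ.exists_not_isZero_act htrans (strCat_mem_cellJ (stringEnds_W n)) hY
  obtain ⟨lo', hi', e', ⟨i⟩⟩ := exists_stringEnds_of_mem_cellJ hF
  obtain ⟨j⟩ := hJ.nonempty_act_iso_of_retract hn e' e r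
  obtain ⟨l⟩ := hJ.nonempty_act_act_iso hn e'.upper (stringEnds_W n) Y
  exact hFY (isZero_of_iso ((M.orbit Y).mapIso i ≪≫ j ≪≫ l.symm).symm (M.isZero_act_obj _ h))

/-- There is an object whose images under `W` and `S` are indecomposable. -/
theorem IsApex.exists_isIndecomposable_act (hn : 1 ≤ n) (hJ : M.IsApex (cellJ k n))
    (htrans : M.IsTransitive) : ∃ Z : A, IsIndecomposable (M.act (strCat k 2 (2 * n + 2)) Z) ∧
      IsIndecomposable (M.act (strCat k 2 (2 * n + 3)) Z) := by
  classical
  have hfin := IsFinitary.finite_hom (k := k) (A := A)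
  let W : DualCat k := strCat k 2 (2 * n + 2)
  let S : DualCat k := strCat k 2 (2 * n + 3)
  -- Among all nonzero objects `W Z`, take one whose endomorphism algebra has least dimension.
  have hex : ∃ m, ∃ Z : A, ¬ IsZero (M.act W Z) ∧
      Module.finrank k (M.act W Z ⟶ M.act W Z) = m := by
    obtain ⟨Z, hZ⟩ := hJ.not_annihilated (strCat_mem_cellJ (stringEnds_W n))
    exact ⟨_, Z, hZ, rfl⟩
  obtain ⟨Z, hZ, hm⟩ := Nat.find_spec hex
  have hWZ : IsIndecomposable (M.act W Z) := by
    by_contra h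
    obtain ⟨X, Y, ⟨s⟩, hX, hY⟩ := exists_splitting_of_not_isIndecomposable hZ h
    -- A splitting `X ⊕ Y` of `W Z` gives the splitting `W X ⊕ W Y` of `W W Z ≅ W Z`, so `W X`
    -- contradicts minimality.
    obtain ⟨i⟩ := hJ.nonempty_act_act_iso hn (stringEnds_W n) (stringEnds_W n) Z
    have hWX := hJ.not_isZero_act_W hn htrans (stringEnds_W n) s.fst hX
    have hWY := hJ.not_isZero_act_W hn htrans (stringEnds_W n) s.snd hY
    have h1 := Splitting.finrank_end_lt (k := k) (Y := M.act W X) (Z := M.act W Y)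
      ((s.map (M.functor.obj W)).ofIso i) hWY
    exact Nat.find_min hex (hm ▸ h1) ⟨X, hWX, rfl⟩
  refine ⟨Z, hWZ, ?_⟩
  -- Since `W S Z ≅ W Z` is indecomposable and `W` kills no nonzero summand of `S Z`, a proper
  -- splitting of `S Z` cannot exist.
  obtain ⟨i⟩ := hJ.nonempty_act_act_iso hn (stringEnds_W n) (stringEnds_S n) Z
  by_contra h
  have hSZ : ¬ IsZero (M.act S Z) := fun h0 => hZ (isZero_of_iso i (M.isZero_act_obj W h0))
  obtain ⟨X, Y, ⟨s⟩, hX, hY⟩ := exists_splitting_of_not_isIndecomposable hSZ h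
  rcases hWZ.isZero_or_isZero ((s.map (M.functor.obj W)).ofIso i) with h0 | h0
  · exact hJ.not_isZero_act_W hn htrans (stringEnds_S n) s.fst hX h0
  · exact hJ.not_isZero_act_W hn htrans (stringEnds_S n) s.snd hY h0

theorem IsApex.nonempty_iso_or (hn : 1 ≤ n) (hJ : M.IsApex (cellJ k n)) (htrans : M.IsTransitive)
    {Z : A} (hW : IsIndecomposable (M.act (strCat k 2 (2 * n + 2)) Z))
    (hS : IsIndecomposable (M.act (strCat k 2 (2 * n + 3)) Z)) {Y : A} (hY : IsIndecomposable Y) :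
    Nonempty (Y ≅ M.act (strCat k 2 (2 * n + 2)) Z) ∨
      Nonempty (Y ≅ M.act (strCat k 2 (2 * n + 3)) Z) := by
  let W : DualCat k := strCat k 2 (2 * n + 2)
  obtain ⟨U, hU⟩ := htrans _ _ hW hY
  obtain ⟨r⟩ := hU.nonempty_retract
  -- Replacing `W Z` by `W W Z` makes the composition pass through the apex, so `Y` is a summand of
  -- `F (W Z)` with `F` in the cell; by the product rule this object is `W Z` or `S Z`.
  obtain ⟨i⟩ := hJ.nonempty_act_act_iso hn (stringEnds_W n) (stringEnds_W n) Z
  have r' : Retract Y (M.act (𝟙_ _ ⊗ W ⊗ U) (M.act W Z)) :=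
    r.trans (Retract.ofIso ((M.functor.obj U).mapIso i.symm ≪≫ (M.actComp W U _).symm ≪≫
      (M.orbit _).mapIso (λ_ (W ⊗ U)).symm))
  obtain ⟨F, hF, ⟨r₁⟩⟩ := hJ.exists_retract (strCat_mem_cellJ (stringEnds_W n)) hY r'
  obtain ⟨lo, hi, e, ⟨j⟩⟩ := exists_stringEnds_of_mem_cellJ hF
  obtain ⟨l⟩ := hJ.nonempty_act_act_iso hn e (stringEnds_W n) Z
  have r₂ : Retract Y (M.act (strCat k 2 hi) Z) :=
    r₁.trans (Retract.ofIso ((M.orbit _).mapIso j ≪≫ l))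
  have := e.le_hi
  have := e.hi_le
  obtain rfl | rfl : hi = 2 * n + 2 ∨ hi = 2 * n + 3 := by omega
  · exact Or.inl (hW.nonempty_iso_of_retract hY.1 r₂)
  · exact Or.inr (hS.nonempty_iso_of_retract hY.1 r₂)

end Apex

/-! ### Rank, action matrices and the conclusion -/

theorem rank_eq_of_isCompleteList {r : ℕ} {X : Fin r → A} (hX : M.IsCompleteList X) :
    M.rank = r := by
  let f : Fin r → IndecomposableClasses A := fun i =>
    ⟨Quotient.mk (isIsomorphicSetoid A) (X i), X i, hX.1 i, rfl⟩
  have hf : Function.Bijective f := by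
    constructor
    · intro i j h
      have h1 : Nonempty (X i ≅ X j) := Quotient.exact (congrArg Subtype.val h)
      exact (hX.2 (X i) (hX.1 i)).unique ⟨Iso.refl _⟩ h1
    · rintro ⟨_, Y, hY, rfl⟩
      obtain ⟨i, ⟨e⟩, -⟩ := hX.2 Y hY
      exact ⟨i, Subtype.ext (Quotient.sound ⟨e.symm⟩)⟩
  exact (Nat.card_eq_of_bijective f hf).symm.trans (Nat.card_fin r)

theorem nonempty_iso_biproduct_of_single {r : ℕ} (X : Fin r → A) (m : Fin r → ℕ) (i : Fin r)
    (hi : m i = 1) (hm : ∀ j, j ≠ i → m j = 0) {Y : A} (e : Nonempty (Y ≅ X i)) :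
    Nonempty (Y ≅ ⨁ fun p : (Σ i : Fin r, Fin (m i)) => X p.1) := by
  obtain ⟨e⟩ := e
  let : Unique (Σ i : Fin r, Fin (m i)) :=
    { default := ⟨i, Fin.cast hi.symm 0⟩
      uniq := by
        rintro ⟨j, x⟩
        by_cases h : j = i
        · subst h
          congr 1
          apply Fin.ext
          have hx : x.1 < m j := x.2
          change x.1 = 0
          omega
        · have hx : x.1 < m j := x.2
          have := hm j h
          omega }
  exact ⟨e ≪≫ (biproductUniqueIso (fun p : (Σ i : Fin r, Fin (m i)) => X p.1)).symm⟩

end FinitaryTwoRep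

end

open DualBimodule FinitaryTwoRep in
/-- The proof does not use simplicity: the argument only needs `M` to be transitive. -/
theorem mainTheorem2 {k : Type u} [Field k] [IsAlgClosed k] [CharZero k]
    {A : Type w} [Category.{v} A] [Preadditive A] [Linear k A] [IsFinitary k A]
    (M : FinitaryTwoRep k A) (htrans : M.IsTransitive) (hsimple : M.IsSimple)
    (n : ℕ) (hn : 1 ≤ n) (hapex : M.IsApex (cellJ k n)) :
    ((∃ X : Fin 1 → A, M.IsCompleteList X ∧
        ∀ F ∈ cellJ k n, M.IsActionMatrix X F !![1]) ∨
      (∃ X : Fin 2 → A, M.IsCompleteList X ∧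
        (∀ F : DualCat k, IsString .N n F ∨ IsString .W n F →
          M.IsActionMatrix X F !![1, 1; 0, 0]) ∧
        (∀ F : DualCat k, IsString .M n F ∨ IsString .S n F →
          M.IsActionMatrix X F !![0, 0; 1, 1]))) ∧
    (M.rank = 1 ∨ M.rank = 2) := by
  obtain ⟨Z, hW, hS⟩ := hapex.exists_isIndecomposable_act hn htrans
  let X₁ := M.act (strCat k 2 (2 * n + 2)) Z
  let X₂ := M.act (strCat k 2 (2 * n + 3)) Z
  have hcover : ∀ Y : A, IsIndecomposable Y → Nonempty (Y ≅ X₁) ∨ Nonempty (Y ≅ X₂) :=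
    fun Y hY => hapex.nonempty_iso_or hn htrans hW hS hY
  -- The result depends only on the upper end `hi` of the acting string, not on `lo` or on the
  -- object acted upon; this makes the columns of each action matrix equal.
  have hact : ∀ {lo hi hi' : ℕ}, StringEnds n lo hi → StringEnds n 2 hi' → ∀ F : DualCat k,
      Nonempty (F.obj ≅ (stringOn k lo hi).tensorFunctor) →
      Nonempty (M.act F (M.act (strCat k 2 hi') Z) ≅ M.act (strCat k 2 hi) Z) := by
    rintro lo hi hi' e e' F ⟨i⟩
    obtain ⟨j⟩ := hapex.nonempty_act_act_iso hn e e' Z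
    exact ⟨(M.orbit _).mapIso (ObjectProperty.isoMk _ i : F ≅ strCat k lo hi) ≪≫ j⟩
  -- The dichotomy of ranks: `W Z` and `S Z` either coincide up to isomorphism or are the two
  -- indecomposable objects.
  by_cases h12 : Nonempty (X₁ ≅ X₂)
  · obtain ⟨i⟩ := h12
    have hlist : M.IsCompleteList ![X₁] := by
      refine ⟨fun j => by fin_cases j; exact hW, fun Y hY => ⟨0, ?_, fun j _ => by fin_cases j; rfl⟩⟩
      rcases hcover Y hY with h | ⟨⟨l⟩⟩
      · exact h
      · exact ⟨l ≪≫ i.symm⟩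
    refine ⟨Or.inl ⟨![X₁], hlist, fun F hF j => ?_⟩, Or.inl (rank_eq_of_isCompleteList hlist)⟩
    fin_cases j
    refine nonempty_iso_biproduct_of_single (k := k) _ _ 0 rfl (fun j hj => absurd (Subsingleton.elim j 0) hj) ?_
    obtain ⟨lo, hi, e, ⟨l⟩⟩ := exists_stringEnds_of_mem_cellJ hF
    obtain ⟨q⟩ := hact e (stringEnds_W n) F ⟨(isTensorFunctor k).ι.mapIso l⟩
    have := e.le_hi
    have := e.hi_le
    obtain rfl | rfl : hi = 2 * n + 2 ∨ hi = 2 * n + 3 := by omega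
    · exact ⟨q⟩
    · exact ⟨q ≪≫ i.symm⟩
  · have hlist : M.IsCompleteList ![X₁, X₂] := by
      refine ⟨fun j => by fin_cases j; exacts [hW, hS], fun Y hY => ?_⟩
      rcases hcover Y hY with ⟨⟨l⟩⟩ | ⟨⟨l⟩⟩
      · refine ⟨0, ⟨l⟩, fun j hj => ?_⟩
        fin_cases j
        · rfl
        · exact absurd (hj.map fun q => l.symm ≪≫ q) h12
      · refine ⟨1, ⟨l⟩, fun j hj => ?_⟩
        fin_cases j
        · exact absurd (hj.map fun q => q.symm ≪≫ l) h12
        · rfl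
    refine ⟨Or.inr ⟨![X₁, X₂], hlist, fun F hF j => ?_, fun F hF j => ?_⟩,
      Or.inr (rank_eq_of_isCompleteList hlist)⟩
    · have h : ∀ {hi' : ℕ}, StringEnds n 2 hi' →
          Nonempty (M.act F (M.act (strCat k 2 hi') Z) ≅ X₁) := fun e' =>
        hF.elim (hact (lo := 1) ⟨by omega, by omega, by omega, by omega⟩ e' F)
          (hact (stringEnds_W n) e' F)
      fin_cases j
      · exact nonempty_iso_biproduct_of_single (k := k) _ _ 0 rfl
          (fun j hj => by fin_cases j; exacts [absurd rfl hj, rfl]) (h (stringEnds_W n))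
      · exact nonempty_iso_biproduct_of_single (k := k) _ _ 0 rfl
          (fun j hj => by fin_cases j; exacts [absurd rfl hj, rfl]) (h (stringEnds_S n))
    · have h : ∀ {hi' : ℕ}, StringEnds n 2 hi' →
          Nonempty (M.act F (M.act (strCat k 2 hi') Z) ≅ X₂) := fun e' =>
        hF.elim (hact (lo := 1) ⟨by omega, by omega, by omega, by omega⟩ e' F)
          (hact (stringEnds_S n) e' F)
      fin_cases j
      · exact nonempty_iso_biproduct_of_single (k := k) _ _ 1 rfl
          (fun j hj => by fin_cases j; exacts [rfl, absurd rfl hj]) (h (stringEnds_W n))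
      · exact nonempty_iso_biproduct_of_single (k := k) _ _ 1 rfl
          (fun j hj => by fin_cases j; exacts [rfl, absurd rfl hj]) (h (stringEnds_S n))
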